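/- \textbf{Setting.} On $\mathbb R^4$ let $x\cdot y=x_0y_0-x_1y_1-x_2y_2-x_3y_3$, $\eta=\mathrm{diag}(1,-1,-1,-1)$, and let $V_+=\{p:\ p\cdot p\ge 0,\ p_0\ge 0\}$. Let $\mathscr S_K(\mathbb R^{4n})$ be the space of Schwartz functions on $\mathbb R^{4n}$ with $K^n$ complex components $f(x_1,\dots,x_n)_{k_1\dots k_n}$, $1\le k_j\le K$ (so it is $\mathbb C$ for $n=0$), and let $\underline{\mathscr S}=\bigoplus_{n\ge0}\mathscr S_K(\mathbb R^{4n})$. Consider a Wightman quantum field theory with field components $\phi_1,\dots,\phi_K$, $K<\infty$, on a separable complex Hilbert space $\mathcal H$, that is: \begin{itemize} \item a strongly continuous unitary representation $U$ of $\mathbb R^4\rtimes SL(2,\mathbb C)$ such that the joint spectrum of the generators $P$ of the translations, $U(y,1)=e^{iy\cdot P}$, lies in $V_+$, and a $U$-invariant unit vector $\Omega$; \item a dense $U$-invariant subspace of $\mathcal H$ that contains $\Omega$ and on which the $\phi_k(f)$, $f\in\mathscr S(\mathbb R^4)$, are linear operators that leave it invariant and depend linearly on $f$, with matrix elements that are tempered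 distributions in $f$, and with $\phi_k(f)^*=\phi_{\bar k}(\bar f)$ on this subspace, for an involution $k\mapsto\bar k$ of the indices; \item with $\phi(f)=\sum_k\phi_k(f_k)$ for $f\in\mathscr S_K(\mathbb R^4)$, covariance $U(y,A)\phi(f)U(y,A)^{-1}=\phi(f_{(y,A)})$, where $f_{(y,A)}(x)_k=\sum_l D(A^{-1})_{lk}f(\Lambda(A)^{-1}(x-y))_l$ for a $K$-dimensional representation $D$ of $SL(2,\mathbb C)$ and the covering homomorphism $\Lambda$ onto the proper orthochronous Lorentz group; \item locality: $\phi_k(f)$ and $\phi_l(g)$ anticommute if $k,l$ are both Fermi indices, and commute otherwise, whenever the supports of $f$ and $g$ are spacelike separated; \item cyclicity: the vectors $\phi(f_1)\cdots\phi(f_n)\Omega$, $n\ge0$, span a dense subspace of $\mathcal H$. \end{itemize} Then for every $n$ there is a unique continuous linear map $\Psi^n:\mathscr S_K(\mathbb R^{4n})\to\mathcal H$ with $\Psi^n(f_1\otimes\dots\otimes f_n)=\phi(f_1)\cdots\phi(f_n)\Omega$ for all $f_j\in\mathscr S_K(\mathbb R^4)$. Put $\Psi(g)=\sum_n\Psi^n(g^n)$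 for $g=(g^n)_n\in\underline{\mathscr S}$ and $\mathcal D=\mathrm{span}\{\Psi^n(f^n):\ n\ge 0,\ f^n\in\mathscr S_K(\mathbb R^{4n})\}$. Let $\theta$ be a real antisymmetric $4\times4$ matrix and write $p\,\theta\,q=(p,\eta\theta\eta q)$ with the Euclidean scalar product $(\cdot,\cdot)$. For $f\in\mathscr S_K(\mathbb R^4)$ and $g^n\in\mathscr S_K(\mathbb R^{4n})$ the Moyal tensor product $f\otimes_\theta g^n\in\mathscr S_K(\mathbb R^{4(n+1)})$ is given through Fourier transforms $\tilde h(p)=(2\pi)^{-2m}\int h(x)e^{-i\sum_j p_j\cdot x_j}\,dx$ on $\mathbb R^{4m}$ by $$\widetilde{(f\otimes_\theta g^n)}(p,q_1,\dots,q_n)_{k\,l_1\dots l_n}=\prod_{r=1}^n e^{-\frac i2 p\theta q_r}\ \tilde f(p)_k\ \tilde g^n(q_1,\dots,q_n)_{l_1\dots l_n},$$ extended to $g\in\underline{\mathscr S}$ by linearity. The deformed field is $\phi^\theta(f)\Psi(g)=\Psi(f\otimes_\theta g)$, $g\in\underline{\mathscr S}$. \textbf{Proposition.} For every real antisymmetric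 $\theta$: \begin{enumerate} \item[a)] $\mathcal D$ is dense in $\mathcal H$, and for every $f\in\mathscr S_K(\mathbb R^4)$ the operator $\phi^\theta(f)$ is well defined and linear on $\mathcal D$. \item[b)] For $\psi,\psi'\in\mathcal D$ the map $f\mapsto\langle\psi,\phi^\theta(f)\psi'\rangle$ is a tempered distribution, i.e. a continuous linear functional on $\mathscr S_K(\mathbb R^4)$. \item[c)] $\phi^\theta(f)^*\supset\phi^\theta(f^*)$ for all $f\in\mathscr S_K(\mathbb R^4)$, where $f^*(x)_k=\overline{f(x)_{\bar k}}$. \item[d)] (Reeh--Schlieder property) For every non-empty open set $\mathcal O\subset\mathbb R^4$ the vectors $\phi^\theta(f_1)\cdots\phi^\theta(f_n)\Omega$, with $n\ge0$ and $f_1,\dots,f_n\in\mathscr S_K(\mathbb R^4)$ supported in $\mathcal O$, span a dense subspace of $\mathcal H$. \end{enumerate} -/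

import Mathlib

open scoped SchwartzMap FourierTransform ComplexConjugate InnerProductSpace

namespace DeformedWightman

noncomputable section

/-! ### Minkowski space and test functions -/

/-- The vector space `ℝ⁴`. -/
abbrev E4 : Type := EuclideanSpace ℝ (Fin 4)

/-- The diagonal of the Minkowski metric `diag(1, -1, -1, -1)`. -/
def eta (μ : Fin 4) : ℝ := if μ = 0 then 1 else -1

/-- The Minkowski product `x · y = x₀ y₀ - x₁ y₁ - x₂ y₂ - x₃ y₃`. -/
def mink (x y : E4) : ℝ := ∑ μ, eta μ * x μ * y μ

/-- The closed forward light cone. -/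
def forwardCone : Set E4 := {p | 0 ≤ mink p p ∧ 0 ≤ p 0}

/-- `p θ q = (p, η θ η q)`. -/
def thetaForm (θ : Matrix (Fin 4) (Fin 4) ℝ) (p q : E4) : ℝ :=
  ∑ μ, ∑ ν, p μ * (eta μ * θ μ ν * eta ν) * q ν

/-- The space `ℝ⁴ⁿ` of configurations `x = (x₁, …, xₙ)` of `n` points of `ℝ⁴`. -/
abbrev Conf (n : ℕ) : Type := EuclideanSpace ℝ (Fin n × Fin 4)

/-- The `j`-th point of a configuration. -/
def pt {n : ℕ} (j : Fin n) : Conf n →L[ℝ] E4 :=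
  ((EuclideanSpace.equiv (Fin 4) ℝ).symm : (Fin 4 → ℝ) →L[ℝ] E4) ∘L
    ContinuousLinearMap.pi fun μ => EuclideanSpace.proj (j, μ)

/-- The configuration of the last `n` of `n + 1` points. -/
def tailPts {n : ℕ} : Conf (n + 1) →L[ℝ] Conf n :=
  ((EuclideanSpace.equiv (Fin n × Fin 4) ℝ).symm : (Fin n × Fin 4 → ℝ) →L[ℝ] Conf n) ∘L
    ContinuousLinearMap.pi fun i => EuclideanSpace.proj (i.1.succ, i.2)

/-- `K`-component test functions on `ℝ⁴`. -/
abbrev Test (K : ℕ) : Type := 𝓢(E4, Fin K → ℂ)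

/-- `Kⁿ`-component test functions on `ℝ⁴ⁿ`; for `n = 0` these are the complex numbers. -/
abbrev TestN (K n : ℕ) : Type := 𝓢(Conf n, (Fin n → Fin K) → ℂ)

/-- The `k`-th component of a test function. -/
def comp {K : ℕ} (k : Fin K) : Test K →L[ℂ] 𝓢(E4, ℂ) :=
  SchwartzMap.postcompCLM (ContinuousLinearMap.proj k)

/-- Complex conjugation of scalar test functions. -/
def conjTest : 𝓢(E4, ℂ) →L[ℝ] 𝓢(E4, ℂ) :=
  SchwartzMap.postcompCLM (Complex.conjCLE : ℂ →L[ℝ] ℂ)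

/-- `f*(x)ₖ = conj (f(x)_{bar k})`. -/
def starTest {K : ℕ} (bar : Fin K → Fin K) : Test K →L[ℝ] Test K :=
  SchwartzMap.postcompCLM (ContinuousLinearMap.pi fun k =>
    (Complex.conjCLE : ℂ →L[ℝ] ℂ) ∘L ContinuousLinearMap.proj (bar k))

/-- `F = f₁ ⊗ … ⊗ fₙ`. -/
def IsTensor {K n : ℕ} (f : Fin n → Test K) (F : TestN K n) : Prop :=
  ∀ x k, F x k = ∏ j, f j (pt j x) (k j)

/-- The Borchers-Uhlmann algebra as a vector space: terminating sequences of test functions. -/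
abbrev BU (K : ℕ) : Type := Π₀ n, TestN K n

/-! ### The tensor product of a one-point and an `n`-point test function -/

/-- The product of component vectors, as a bilinear map. -/
def compMul (K n : ℕ) : (Fin K → ℂ) →L[ℝ] ((Fin n → Fin K) → ℂ) →L[ℝ]
    ((Fin (n + 1) → Fin K) → ℂ) :=
  LinearMap.mkContinuous₂
    (LinearMap.mk₂ ℝ (fun u v k => u (k 0) * v (Fin.tail k))
      (fun _ _ _ => by ext; simp [add_mul]) (fun _ _ _ => by ext; simp [mul_assoc])
      (fun _ _ _ => by ext; simp [mul_add]) (fun _ _ _ => by ext; simp [mul_left_comm]))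
    1 (fun u v => by
      rw [one_mul, pi_norm_le_iff_of_nonneg (by positivity)]
      intro k
      rw [LinearMap.mk₂_apply, norm_mul]
      exact mul_le_mul (norm_le_pi_norm u _) (norm_le_pi_norm v _) (norm_nonneg _) (norm_nonneg _))

theorem compMul_apply {K n : ℕ} (u : Fin K → ℂ) (v : (Fin n → Fin K) → ℂ) (k : Fin (n + 1) → Fin K) :
    compMul K n u v k = u (k 0) * v (Fin.tail k) := rfl

theorem norm_conf_le {n : ℕ} (x : Conf (n + 1)) : ‖x‖ ≤ ‖pt 0 x‖ + ‖tailPts x‖ := by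
  have h : ‖x‖ ^ 2 = ‖pt 0 x‖ ^ 2 + ‖tailPts x‖ ^ 2 := by
    simp only [EuclideanSpace.norm_sq_eq, Fintype.sum_prod_type]
    rw [Fin.sum_univ_succ]
    rfl
  nlinarith [norm_nonneg x, norm_nonneg (pt 0 x), norm_nonneg (tailPts x)]

theorem exists_bound_comp {V W F : Type*} [NormedAddCommGroup V] [NormedSpace ℝ V]
    [NormedAddCommGroup W] [NormedSpace ℝ W] [NormedAddCommGroup F] [NormedSpace ℝ F]
    (L : V →L[ℝ] W) (f : 𝓢(W, F)) (k i : ℕ) :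
    ∃ C, 0 ≤ C ∧ ∀ x, ‖L x‖ ^ k * ‖iteratedFDeriv ℝ i (f ∘ L) x‖ ≤ C := by
  obtain ⟨C, hC, h⟩ := f.decay k i
  refine ⟨‖L‖ ^ i * C, by positivity, fun x => ?_⟩
  rw [L.iteratedFDeriv_comp_right (f.smooth i) x le_rfl]
  have := (iteratedFDeriv ℝ i f (L x)).norm_compContinuousLinearMap_le fun _ => L
  simp only [Finset.prod_const, Finset.card_univ, Fintype.card_fin] at this
  calc _ ≤ ‖L x‖ ^ k * (‖iteratedFDeriv ℝ i f (L x)‖ * ‖L‖ ^ i) := by gcongr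
    _ = ‖L‖ ^ i * (‖L x‖ ^ k * ‖iteratedFDeriv ℝ i f (L x)‖) := by ring
    _ ≤ _ := by gcongr; exact h _

/-- `(f ⊗ g)(x₀, x₁, …, xₙ)_{k₀ k₁ … kₙ} = f(x₀)_{k₀} g(x₁, …, xₙ)_{k₁ … kₙ}`. -/
def tensor {K n : ℕ} (f : Test K) : TestN K n →ₗ[ℂ] TestN K (n + 1) where
  toFun g :=
    { toFun := fun x k => f (pt 0 x) (k 0) * g (tailPts x) (Fin.tail k)
      smooth' := by
        have h1 := (f.smooth ⊤).comp (pt (0 : Fin (n + 1))).contDiff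
        have h2 := (g.smooth ⊤).comp (tailPts (n := n)).contDiff
        exact (compMul K n).isBoundedBilinearMap.contDiff.comp (h1.prodMk h2)
      decay' := by
        intro k m
        have h1 := (f.smooth ⊤).comp (pt (0 : Fin (n + 1))).contDiff
        have h2 := (g.smooth ⊤).comp (tailPts (n := n)).contDiff
        choose A hA0 hA using fun a i => exists_bound_comp (pt (0 : Fin (n + 1))) f a i
        choose B hB0 hB using fun a i => exists_bound_comp (tailPts (n := n)) g a i
        refine ⟨‖compMul K n‖ * ∑ i ∈ Finset.range (m + 1), (m.choose i : ℝ) *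
          (2 ^ k * (A k i * B 0 (m - i) + A 0 i * B k (m - i))), fun x => ?_⟩
        have h := (compMul K n).norm_iteratedFDeriv_le_of_bilinear h1 h2 x (n := m)
          (mod_cast le_top)
        refine (mul_le_mul_of_nonneg_left h (by positivity)).trans ?_
        rw [mul_left_comm, Finset.mul_sum]
        refine mul_le_mul_of_nonneg_left (Finset.sum_le_sum fun i _ => ?_)
          (by positivity)
        set a := ‖iteratedFDeriv ℝ i (f ∘ pt (0 : Fin (n + 1))) x‖
        set b := ‖iteratedFDeriv ℝ (m - i) (g ∘ tailPts (n := n)) x‖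
        have hx : ‖x‖ ^ k ≤ 2 ^ k * (‖pt 0 x‖ ^ k + ‖tailPts x‖ ^ k) := by
          have h0 := norm_conf_le x
          rcases le_total ‖pt 0 x‖ ‖tailPts x‖ with h | h
          · calc ‖x‖ ^ k ≤ (2 * ‖tailPts x‖) ^ k := by gcongr; linarith
              _ = 2 ^ k * ‖tailPts x‖ ^ k := mul_pow _ _ _
              _ ≤ _ := by gcongr; exact le_add_of_nonneg_left (by positivity)
          · calc ‖x‖ ^ k ≤ (2 * ‖pt 0 x‖) ^ k := by gcongr; linarith
              _ = 2 ^ k * ‖pt 0 x‖ ^ k := mul_pow _ _ _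
              _ ≤ _ := by gcongr; exact le_add_of_nonneg_right (by positivity)
        have e1 := hA k i x
        have e2 := hA 0 i x
        have e3 := hB k (m - i) x
        have e4 := hB 0 (m - i) x
        rw [pow_zero, one_mul] at e2 e4
        calc ‖x‖ ^ k * (m.choose i * a * b)
            ≤ (2 ^ k * (‖pt 0 x‖ ^ k + ‖tailPts x‖ ^ k)) * (m.choose i * a * b) := by gcongr
          _ = m.choose i * (2 ^ k * ((‖pt 0 x‖ ^ k * a) * b + a * (‖tailPts x‖ ^ k * b))) := by
              ring
          _ ≤ _ := by
              gcongr
              · exact hA0 k i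
              · exact hA0 0 i }
  map_add' g h := by ext x k; exact mul_add _ _ _
  map_smul' c g := by ext x k; exact mul_left_comm _ _ _

/-! ### The Moyal tensor product -/

/-- The momentum `pⱼ = 2π η ξⱼ` that belongs to the variable `ξⱼ` of the Euclidean Fourier
transform `∫ F(x) exp(-2π i ⟪x, ξ⟫) dx`: one has `∑ⱼ pⱼ · xⱼ = 2π ⟪x, ξ⟫`. -/
def momentum {n : ℕ} (j : Fin n) (ξ : Conf n) : E4 :=
  WithLp.toLp 2 fun μ => 2 * Real.pi * eta μ * ξ (j, μ)

theorem sum_mink_momentum {n : ℕ} (ξ x : Conf n) :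
    ∑ j, mink (momentum j ξ) (pt j x) = 2 * Real.pi * ⟪x, ξ⟫_ℝ := by
  have h : ∀ μ, eta μ * eta μ = 1 := fun μ => by unfold eta; split_ifs <;> norm_num
  simp only [mink, momentum, PiLp.inner_apply, Fintype.sum_prod_type, Finset.mul_sum]
  refine Finset.sum_congr rfl fun j _ => Finset.sum_congr rfl fun μ _ => ?_
  have e : pt j x μ = x (j, μ) := rfl
  simp only [e, RCLike.inner_apply, conj_trivial]
  linear_combination (2 * Real.pi * ξ (j, μ) * x (j, μ)) * h μ

/-- The phase `∏ᵣ exp(-(i/2) p₀ θ pᵣ)`, `r = 1, …, n`. -/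
def moyalPhase {n : ℕ} (θ : Matrix (Fin 4) (Fin 4) ℝ) (ξ : Conf (n + 1)) : ℂ :=
  ∏ r : Fin n, Complex.exp
    (-(Complex.I / 2) * (thetaForm θ (momentum 0 ξ) (momentum r.succ ξ) : ℝ))

theorem expI_hasTemperateGrowth :
    (fun t : ℝ => Complex.exp (-(Complex.I / 2) * t)).HasTemperateGrowth := by
  have h : ∀ n : ℕ, iteratedDeriv n (fun t : ℝ => Complex.exp (-(Complex.I / 2) * t)) =
      fun t : ℝ => (-(Complex.I / 2)) ^ n * Complex.exp (-(Complex.I / 2) * t) := by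
    intro n
    induction n with
    | zero => simp
    | succ n ih =>
      rw [iteratedDeriv_succ, ih]
      funext t
      have h1 : HasDerivAt (fun t : ℝ => Complex.exp (-(Complex.I / 2) * t))
          (Complex.exp (-(Complex.I / 2) * t) * (-(Complex.I / 2) * 1)) t :=
        ((Complex.ofRealCLM.hasDerivAt (x := t)).const_mul (-(Complex.I / 2))).cexp
      rw [(h1.const_mul ((-(Complex.I / 2)) ^ n)).deriv]
      ring
  refine ⟨(contDiff_const.mul Complex.ofRealCLM.contDiff).cexp, fun n => ⟨0, 1, fun t => ?_⟩⟩
  rw [norm_iteratedFDeriv_eq_norm_iteratedDeriv, h]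
  have : ‖Complex.exp (-(Complex.I / 2) * t)‖ = 1 := by
    rw [Complex.norm_exp]; simp
  simp only [norm_mul, norm_pow, this]
  simp only [norm_neg, norm_div, Complex.norm_I]
  norm_num
  exact pow_le_one₀ (by norm_num) (by norm_num)

theorem moyalPhase_hasTemperateGrowth {n : ℕ} (θ : Matrix (Fin 4) (Fin 4) ℝ) :
    (moyalPhase (n := n) θ).HasTemperateGrowth := by
  have hm : ∀ (j : Fin (n + 1)) (μ : Fin 4),
      (fun ξ : Conf (n + 1) => momentum j ξ μ).HasTemperateGrowth := fun j μ =>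
    (Function.HasTemperateGrowth.const (2 * Real.pi * eta μ)).mul
      (EuclideanSpace.proj (𝕜 := ℝ) (j, μ)).hasTemperateGrowth
  have hf : (fun ξ : Conf (n + 1) =>
      ∑ r : Fin n, thetaForm θ (momentum 0 ξ) (momentum r.succ ξ)).HasTemperateGrowth := by
    unfold thetaForm
    refine .sum fun r _ => .sum fun μ _ => .sum fun ν _ => ?_
    exact ((hm 0 μ).mul (.const _)).mul (hm r.succ ν)
  convert expI_hasTemperateGrowth.comp hf using 1
  funext ξ
  simp [moyalPhase, ← Complex.exp_sum, Finset.mul_sum]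

/-- The Moyal tensor product `f ⊗_θ g` of a one-point and an `n`-point test function: its Fourier
transform is that of `f ⊗ g`, multiplied by `∏ᵣ exp(-(i/2) p₀ θ pᵣ)`. -/
def moyal {K n : ℕ} (θ : Matrix (Fin 4) (Fin 4) ℝ) (f : Test K) :
    TestN K n →ₗ[ℂ] TestN K (n + 1) :=
  (FourierTransform.fourierInvCLM ℂ (TestN K (n + 1)) ∘L
    SchwartzMap.smulLeftCLM _ (moyalPhase θ) ∘L
    FourierTransform.fourierCLM ℂ (TestN K (n + 1))).toLinearMap ∘ₗ tensor f

theorem fourier_moyal {K n : ℕ} (θ : Matrix (Fin 4) (Fin 4) ℝ) (f : Test K) (g : TestN K n)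
    (ξ : Conf (n + 1)) : 𝓕 (moyal θ f g) ξ = moyalPhase θ ξ • 𝓕 (tensor f g) ξ := by
  have h : 𝓕 (moyal θ f g) = SchwartzMap.smulLeftCLM _ (moyalPhase θ) (𝓕 (tensor f g)) :=
    FourierTransform.fourier_fourierInv_eq _
  rw [h, SchwartzMap.smulLeftCLM_apply_apply (moyalPhase_hasTemperateGrowth θ)]

/-- The map `g ↦ f ⊗_θ g` on terminating sequences of test functions. -/
def moyalBU {K : ℕ} (θ : Matrix (Fin 4) (Fin 4) ℝ) (f : Test K) : BU K →ₗ[ℂ] BU K :=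
  DFinsupp.lsum ℂ fun n => DFinsupp.lsingle (n + 1) ∘ₗ moyal θ f

/-! ### The undeformed Wightman theory -/

/-- The group `SL(2, ℂ)`. -/
abbrev SL2C : Type := Matrix.SpecialLinearGroup (Fin 2) ℂ

/-- The unit matrix and the Pauli matrices. -/
def pauli : Fin 4 → Matrix (Fin 2) (Fin 2) ℂ :=
  ![1, !![0, 1; 1, 0], !![0, -Complex.I; Complex.I, 0], !![1, 0; 0, -1]]

/-- The covering homomorphism from `SL(2, ℂ)` onto the proper orthochronous Lorentz group,
determined by `A X(x) A* = X(Λ(A) x)` with `X(x) = ∑ᵥ xᵥ σᵥ`. -/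
def lorentz (A : SL2C) : Matrix (Fin 4) (Fin 4) ℝ :=
  Matrix.of fun μ ν => ((pauli μ * A.1 * pauli ν * A.1.conjTranspose).trace).re / 2

/-- The joint spectrum of the generators `P` of the translations `T y = exp(i y · P)` lies in the
closed set `S`: the operator `∫ f(y) T(y) dy` vanishes whenever `p ↦ ∫ f(y) exp(i p · y) dy`
vanishes on `S`. -/
def HasJointSpectrumIn {H : Type*} [NormedAddCommGroup H] [InnerProductSpace ℂ H]
    (T : E4 → H ≃ₗᵢ[ℂ] H) (S : Set E4) : Prop :=
  ∀ f : 𝓢(E4, ℂ),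
    (∀ p ∈ S, ∫ y : E4, f y * Complex.exp (Complex.I * (mink p y : ℝ)) = 0) →
    ∀ ψ ψ' : H, ∫ y : E4, f y * ⟪ψ, T y ψ'⟫_ℂ = 0

/-- `φ(f) = ∑ₖ φₖ(fₖ)`. -/
def smear {K : ℕ} {M : Type*} [AddCommGroup M] [Module ℂ M]
    (φ : Fin K → 𝓢(E4, ℂ) →ₗ[ℂ] Module.End ℂ M) (f : Test K) : Module.End ℂ M :=
  ∑ k, φ k (comp k f)

/-- A Wightman quantum field theory with `K` field components on the Hilbert space `H`. -/
structure WightmanTheory (K : ℕ) (H : Type*) [NormedAddCommGroup H] [InnerProductSpace ℂ H] where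
  /-- the representation of the covering `ℝ⁴ ⋊ SL(2, ℂ)` of the Poincaré group -/
  U : E4 → SL2C → H ≃ₗᵢ[ℂ] H
  U_one : ∀ ψ, U 0 1 ψ = ψ
  U_mul : ∀ y A y' A' ψ,
    U y A (U y' A' ψ) = U (y + Matrix.toEuclideanLin (lorentz A) y') (A * A') ψ
  U_continuous : ∀ ψ, Continuous fun g : E4 × SL2C => U g.1 g.2 ψ
  spectrum_condition : HasJointSpectrumIn (fun y => U y 1) forwardCone
  /-- the vacuum vector -/
  vacuum : H
  vacuum_norm : ‖vacuum‖ = 1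
  vacuum_invariant : ∀ y A, U y A vacuum = vacuum
  /-- the common invariant domain of the fields -/
  domain : Submodule ℂ H
  domain_dense : Dense (domain : Set H)
  vacuum_mem : vacuum ∈ domain
  U_mem : ∀ y A, ∀ ψ ∈ domain, U y A ψ ∈ domain
  /-- the components `φₖ` of the fields -/
  field : Fin K → 𝓢(E4, ℂ) →ₗ[ℂ] Module.End ℂ domain
  field_tempered : ∀ k (ψ ψ' : domain), Continuous fun f => ⟪(ψ : H), (field k f ψ' : H)⟫_ℂ
  /-- the index of the adjoint field component -/
  bar : Fin K → Fin K
  bar_involutive : Function.Involutive bar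
  field_adjoint : ∀ k f (ψ ψ' : domain),
    ⟪(field k f ψ : H), (ψ' : H)⟫_ℂ = ⟪(ψ : H), (field (bar k) (conjTest f) ψ' : H)⟫_ℂ
  /-- the finite-dimensional representation of `SL(2, ℂ)` according to which the fields
  transform -/
  D : SL2C →* Matrix (Fin K) (Fin K) ℂ
  field_covariant : ∀ y A (f fyA : Test K),
    (∀ x k, fyA x k =
      ∑ l, D A⁻¹ l k * f (Matrix.toEuclideanLin (lorentz A⁻¹) (x - y)) l) →
    ∀ ψ : domain, U y A (smear field f ψ : H) = smear field fyA ⟨U y A ψ, U_mem y A ψ ψ.2⟩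
  /-- the Fermi indices; the other ones are the Bose indices -/
  fermi : Set (Fin K)
  field_local : ∀ k l (f g : 𝓢(E4, ℂ)),
    (∀ x ∈ tsupport f, ∀ y ∈ tsupport g, mink (x - y) (x - y) < 0) → ∀ ψ : domain,
    (k ∈ fermi ∧ l ∈ fermi → field k f (field l g ψ) + field l g (field k f ψ) = 0) ∧
    (¬ (k ∈ fermi ∧ l ∈ fermi) → field k f (field l g ψ) - field l g (field k f ψ) = 0)
  cyclic : Dense (Submodule.span ℂ {v : H | ∃ (n : ℕ) (f : Fin n → Test K),
    v = ((List.ofFn fun j => smear field (f j)).prod ⟨vacuum, vacuum_mem⟩ : domain)} : Set H)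

namespace WightmanTheory

variable {K : ℕ} {H : Type*} [NormedAddCommGroup H] [InnerProductSpace ℂ H]

/-- The vector `φ(f₁) ⋯ φ(fₙ) Ω`. -/
def fieldVector (W : WightmanTheory K H) {n : ℕ} (f : Fin n → Test K) : H :=
  ((List.ofFn fun j => smear W.field (f j)).prod ⟨W.vacuum, W.vacuum_mem⟩ : W.domain)

/-- The continuous linear map `T` extends `f₁ ⊗ … ⊗ fₙ ↦ φ(f₁) ⋯ φ(fₙ) Ω` to all test functions
on `ℝ⁴ⁿ`. -/
def IsVectorDistribution (W : WightmanTheory K H) (n : ℕ) (T : TestN K n →L[ℂ] H) : Prop :=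
  ∀ (f : Fin n → Test K) (F : TestN K n), IsTensor f F → T F = W.fieldVector f

open Classical in
/-- The vector-valued distribution `Ψⁿ`. -/
def PsiN (W : WightmanTheory K H) (n : ℕ) : TestN K n →L[ℂ] H :=
  if h : ∃ T, W.IsVectorDistribution n T then h.choose else 0

/-- `Ψ(g) = ∑ₙ Ψⁿ(gⁿ)`. -/
def Psi (W : WightmanTheory K H) : BU K →ₗ[ℂ] H :=
  DFinsupp.lsum ℂ fun n => (W.PsiN n).toLinearMap

/-- The domain `𝒟`, the span of all vectors `Ψⁿ(fⁿ)`. -/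
def DD (W : WightmanTheory K H) : Submodule ℂ H :=
  Submodule.span ℂ {v | ∃ (n : ℕ) (F : TestN K n), v = W.PsiN n F}

/-- The deformed field operator `φ^θ(f)`, the operator whose graph consists of the pairs
`(Ψ(g), Ψ(f ⊗_θ g))`. -/
def deformedField (W : WightmanTheory K H) (θ : Matrix (Fin 4) (Fin 4) ℝ) (f : Test K) :
    H →ₗ.[ℂ] H :=
  (LinearMap.range (W.Psi.prod (W.Psi ∘ₗ moyalBU θ f))).toLinearPMap

/-- The vectors `φ^θ(f₁) ⋯ φ^θ(fₙ) Ω`, `n ≥ 0`, with test functions supported in `O`. -/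
inductive IsDeformedVector (W : WightmanTheory K H) (θ : Matrix (Fin 4) (Fin 4) ℝ) (O : Set E4) :
    H → Prop
  | vacuum : IsDeformedVector W θ O W.vacuum
  | field (f : Test K) (hf : tsupport f ⊆ O) (v : (W.deformedField θ f).domain)
      (hv : IsDeformedVector W θ O v) : IsDeformedVector W θ O (W.deformedField θ f v)

/-- The space `𝒟_θ(O)` generated from the vacuum by deformed fields smeared in `O`. -/
def localDomain (W : WightmanTheory K H) (θ : Matrix (Fin 4) (Fin 4) ℝ) (O : Set E4) :
    Submodule ℂ H :=
  Submodule.span ℂ {v | W.IsDeformedVector θ O v}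

end WightmanTheory

end

end DeformedWightman

/-! Parts a) to c) rest on one identity, `inner_psiN_moyal`: ⟨Ψ(h), Ψ(f ⊗_θ g)⟩ = ⟨Ψ(f* ⊗_θ h),
Ψ(g)⟩. For θ = 0 it is the adjoint relation of the undeformed fields. In general the two sides carry
phases built from pθΣq and pθΣk, where p, q, k are the momenta of f, of g and of the complex
conjugate of h. By translation invariance the matrix element lives on p + Σq + Σk = 0, and pθp = 0,
so the two phases agree there. `clm_expMul_sum` makes "lives on" precise: a translation invariant
distribution is annihilated by multiplication with the total momentum P. It therefore contains no
transversal derivatives and cannot see a factor exp(i Σ q_μ P_μ).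

If Ψ(g) = 0, the identity makes Ψ(f ⊗_θ g) orthogonal to the dense space 𝒟, so φ^θ(f) is well
defined. Part c) is the identity itself, and b) follows from the continuity of Ψⁿ and of the Moyal
product.

For d), let ψ be orthogonal to all products of deformed fields smeared in O. The localization is
removed one field at a time, from the left. Fix the first k fields and translate the others by z.
Since φ^θ is well defined, the matrix element with ψ depends on the translated fields only through
the vector that they generate. The spectrum condition then makes its Fourier transform one-sided
along directions of the forward cone, so if it vanishes for small z, it vanishes for all z
(`eq_zero_of_oneSided`). Finally ψ is orthogonal to all products of deformed fields. These are
total, because the twist by θ is inverted by the twist by -θ.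

The analytic groundwork has two sources. Schwartz spaces are complete and metrizable, hence
barrelled, which upgrades weak and separate continuity to continuity. A decomposition of test
functions into time-frequency shifts of a window yields the kernel theorem, hence existence and
uniqueness of Ψⁿ, and also the reduction to test functions of small support. -/

namespace DeformedWightman

open Filter Topology MeasureTheory

set_option linter.unusedSectionVars false

noncomputable section

/-! ### Completeness and barrelledness of Schwartz spaces -/

section Completeness

variable {E F : Type*} [NormedAddCommGroup E] [NormedSpace ℝ E] [NormedAddCommGroup F]
  [NormedSpace ℝ F]

/-- Bounded continuous functions with values in the `n`-linear maps. -/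
abbrev JetSpace (E F : Type*) [NormedAddCommGroup E] [NormedSpace ℝ E] [NormedAddCommGroup F]
    [NormedSpace ℝ F] (n : ℕ) : Type _ :=
  @BoundedContinuousFunction E (E [×n]→L[ℝ] F) _ SeminormedAddCommGroup.toPseudoMetricSpace

/-- The weighted derivative `x ↦ ‖x‖ ^ k • D^n f(x)` as a bounded continuous function. -/
def jet (k n : ℕ) (f : 𝓢(E, F)) : JetSpace E F n :=
  BoundedContinuousFunction.ofNormedAddCommGroup
    (fun x => ‖x‖ ^ k • iteratedFDeriv ℝ n f x)
    ((continuous_norm.pow k).smul ((f.smooth n).continuous_iteratedFDeriv le_rfl))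
    (SchwartzMap.seminorm ℝ k n f) (fun x => by
      rw [norm_smul, norm_pow, norm_norm]
      exact SchwartzMap.le_seminorm ℝ k n f x)

theorem jet_apply (k n : ℕ) (f : 𝓢(E, F)) (x : E) :
    jet k n f x = ‖x‖ ^ k • iteratedFDeriv ℝ n f x := rfl

/-- Schwartz convergence thus becomes convergence of all jets in sup norm, so completeness can be
inherited from spaces of bounded continuous functions. -/
theorem norm_jet (k n : ℕ) (f : 𝓢(E, F)) : ‖jet k n f‖ = SchwartzMap.seminorm ℝ k n f := by
  apply le_antisymm
  · exact BoundedContinuousFunction.norm_ofNormedAddCommGroup_le _ (apply_nonneg _ _) _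
  · refine SchwartzMap.seminorm_le_bound ℝ k n f (norm_nonneg (jet k n f)) fun x => ?_
    have := (jet k n f).norm_coe_le_norm x
    rwa [jet_apply, norm_smul, norm_pow, norm_norm] at this

theorem jet_add (k n : ℕ) (f g : 𝓢(E, F)) : jet k n (f + g) = jet k n f + jet k n g := by
  ext1 x
  have h : iteratedFDeriv ℝ n (⇑(f + g)) x = iteratedFDeriv ℝ n f x + iteratedFDeriv ℝ n g x :=
    iteratedFDeriv_add_apply (f.smooth n).contDiffAt (g.smooth n).contDiffAt
  rw [BoundedContinuousFunction.add_apply, jet_apply, jet_apply, jet_apply, h, smul_add]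

theorem jet_smul (k n : ℕ) (c : ℝ) (f : 𝓢(E, F)) : jet k n (c • f) = c • jet k n f := by
  ext1 x
  have h : iteratedFDeriv ℝ n (⇑(c • f)) x = c • iteratedFDeriv ℝ n f x :=
    iteratedFDeriv_const_smul_apply (f.smooth n).contDiffAt
  exact (congrArg _ h).trans (smul_comm _ _ _)

/-- The weighted derivative as a linear map. -/
def jetLM (k n : ℕ) : 𝓢(E, F) →ₗ[ℝ] JetSpace E F n where
  toFun := jet k n
  map_add' := jet_add k n
  map_smul' := jet_smul k n

theorem jet_sub (k n : ℕ) (f g : 𝓢(E, F)) : jet k n (f - g) = jet k n f - jet k n g :=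
  map_sub (jetLM k n) f g

theorem continuous_jet (k n : ℕ) : Continuous (jet k n : 𝓢(E, F) → _) := by
  refine (schwartz_withSeminorms ℝ E F).continuous_of_isBounded
    (norm_withSeminorms ℝ (JetSpace E F n)) (jetLM k n) fun _ => ⟨{(k, n)}, 1, fun f => ?_⟩
  simp only [Seminorm.comp_apply, coe_normSeminorm, Finset.sup_singleton, one_smul]
  exact (norm_jet k n f).le

theorem tendsto_schwartz_iff {ι : Type*} {l : Filter ι} {u : ι → 𝓢(E, F)} {f : 𝓢(E, F)} :
    Tendsto u l (𝓝 f) ↔ ∀ k n, Tendsto (fun i => SchwartzMap.seminorm ℝ k n (u i - f)) l (𝓝 0) := by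
  rw [(schwartz_withSeminorms ℝ E F).tendsto_nhds]
  constructor
  · intro h k n
    rw [Metric.tendsto_nhds]
    intro ε hε
    filter_upwards [h (k, n) ε hε] with i hi
    rw [Real.dist_eq, sub_zero, abs_of_nonneg (apply_nonneg _ _)]
    exact hi
  · intro h kn ε hε
    filter_upwards [(h kn.1 kn.2).eventually (gt_mem_nhds hε)] with i hi
    exact hi

/-- Along a Cauchy sequence all weighted derivatives converge uniformly. Uniform convergence makes
each limit the derivative of the preceding one, so the limits are the derivatives of one smooth
function, and the bounded weighted limits give its decay. -/
instance [CompleteSpace F] : CompleteSpace 𝓢(E, F) := by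
  have : (uniformity 𝓢(E, F)).IsCountablyGenerated :=
    IsUniformAddGroup.uniformity_countably_generated
  refine UniformSpace.complete_of_cauchySeq_tendsto fun u hu => ?_
  have hc : ∀ k n, ∃ g, Tendsto (fun j => jet k n (u j)) atTop (𝓝 g) := fun k n => by
    have hl : UniformContinuous (jetLM (E := E) (F := F) k n) :=
      uniformContinuous_addMonoidHom_of_continuous (f := (jetLM k n).toAddMonoidHom)
        (continuous_jet k n)
    exact cauchySeq_tendsto_of_complete (hu.map hl)
  choose g hg using hc
  have hpt : ∀ k n x, Tendsto (fun j => ‖x‖ ^ k • iteratedFDeriv ℝ n (u j) x) atTop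
      (𝓝 (g k n x)) := fun k n x =>
    ((continuous_eval_const x).tendsto (g k n)).comp (hg k n)
  have hpt0 : ∀ n x, Tendsto (fun j => iteratedFDeriv ℝ n (u j) x) atTop (𝓝 (g 0 n x)) :=
    fun n x => by simpa using hpt 0 n x
  have hg0 : ∀ k n x, g k n x = ‖x‖ ^ k • g 0 n x := fun k n x =>
    tendsto_nhds_unique (hpt k n x) ((hpt0 n x).const_smul _)
  have hunif : ∀ n, TendstoUniformly (fun j x => iteratedFDeriv ℝ n (u j) x) (g 0 n) atTop := by
    intro n
    have := BoundedContinuousFunction.tendsto_iff_tendstoUniformly.1 (hg 0 n)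
    intro U hU
    filter_upwards [this U hU] with j hj x
    have hx := hj x
    simp only [jet_apply, pow_zero, one_smul] at hx
    exact hx
  have hderiv : ∀ n x, HasFDerivAt (g 0 n) (g 0 (n + 1) x).curryLeft x := by
    intro n x
    let e := continuousMultilinearCurryLeftEquiv ℝ (fun _ : Fin (n + 1) => E) F
    have h1 : TendstoUniformly (fun j x => fderiv ℝ (iteratedFDeriv ℝ n (u j)) x)
        (fun x => e (g 0 (n + 1) x)) atTop := by
      have h2 := e.toContinuousLinearEquiv.toContinuousLinearMap.uniformContinuous.comp_tendstoUniformly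
        (hunif (n + 1))
      intro U hU
      filter_upwards [h2 U hU] with j hj x
      rw [congrFun (fderiv_iteratedFDeriv (𝕜 := ℝ) (f := u j) (n := n)) x]
      exact hj x
    exact hasFDerivAt_of_tendstoUniformly (l := atTop) h1
      (fun j x => ((u j).smooth (n + 1 : ℕ)).differentiable_iteratedFDeriv
        (by exact_mod_cast Nat.lt_succ_self n) |>.differentiableAt.hasFDerivAt)
      (hpt0 n) x
  let f : E → F := fun x => g 0 0 x 0
  have hT : HasFTaylorSeriesUpTo (⊤ : ℕ∞) f (fun x n => g 0 n x) :=
    (hasFTaylorSeriesUpTo_top_iff' le_rfl).2 ⟨fun x => rfl, fun n x => hderiv n x⟩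
  have hD : ∀ n x, iteratedFDeriv ℝ n f x = g 0 n x := fun n x =>
    (hT.eq_iteratedFDeriv (by exact_mod_cast le_top) x).symm
  let fS : 𝓢(E, F) :=
    { toFun := f
      smooth' := hT.contDiff
      decay' := fun k n => ⟨‖g k n‖, fun x => by
        have := (g k n).norm_coe_le_norm x
        rwa [hg0, norm_smul, norm_pow, norm_norm, ← hD] at this⟩ }
  have hjet : ∀ k n, jet k n fS = g k n := fun k n => by
    ext1 x
    rw [jet_apply, hg0, ← hD]
    rfl
  refine ⟨fS, tendsto_schwartz_iff.2 fun k n => ?_⟩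
  simp only [← norm_jet, jet_sub, hjet]
  have := (hg k n).sub_const (g k n)
  rw [sub_self] at this
  simpa using this.norm

/-- Completeness together with countably many seminorms gives the Baire property, and with it the
barrelledness behind every uniform boundedness argument below. -/
instance [CompleteSpace F] : BaireSpace 𝓢(E, F) := by
  have : (uniformity 𝓢(E, F)).IsCountablyGenerated :=
    IsUniformAddGroup.uniformity_countably_generated
  infer_instance

instance {G : Type*} [NormedAddCommGroup G] [NormedSpace ℂ G] [CompleteSpace G] :
    BarrelledSpace ℂ 𝓢(E, G) :=
  inferInstance

end Completeness

/-! ### Weak, separate and joint continuity on barrelled spaces -/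

section Barrelled

/-- By density the inequality extends to χ = v, where it reads ‖v‖² ≤ ‖v‖ r. -/
theorem norm_le_iff_of_dense {H : Type*} [NormedAddCommGroup H] [InnerProductSpace ℂ H]
    {D : Submodule ℂ H} (hD : Dense (D : Set H)) (v : H) {r : ℝ} (hr : 0 ≤ r) :
    ‖v‖ ≤ r ↔ ∀ χ ∈ D, ‖⟪χ, v⟫_ℂ‖ ≤ ‖χ‖ * r := by
  constructor
  · intro h χ _
    exact (norm_inner_le_norm χ v).trans (by gcongr)
  · intro h
    have h1 : ∀ χ : H, ‖⟪χ, v⟫_ℂ‖ ≤ ‖χ‖ * r := fun χ =>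
      hD.induction (P := fun χ => ‖⟪χ, v⟫_ℂ‖ ≤ ‖χ‖ * r) h
        (isClosed_le (by fun_prop) (by fun_prop)) χ
    rcases eq_or_ne v 0 with rfl | hv
    · simpa using hr
    · have := h1 v
      rw [inner_self_eq_norm_sq_to_K, norm_pow, RCLike.norm_ofReal, abs_norm, sq] at this
      exact le_of_mul_le_mul_left this (norm_pos_iff.2 hv)

/-- A linear map from a barrelled space to a Hilbert space is continuous if it is weakly
continuous with respect to a dense subspace. -/
theorem continuous_of_dense_weak {X H : Type*} [AddCommGroup X] [Module ℂ X] [TopologicalSpace X]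
    [IsTopologicalAddGroup X] [BarrelledSpace ℂ X] [NormedAddCommGroup H]
    [InnerProductSpace ℂ H] (D : Submodule ℂ H) (hD : Dense (D : Set H)) (L : X →ₗ[ℂ] H)
    (hL : ∀ χ ∈ D, Continuous fun f => ⟪χ, L f⟫_ℂ) : Continuous L := by
  -- The seminorm f ↦ ‖L f‖ has sublevel sets cut out by the continuous functions |⟨χ, L f⟩|, so it
  -- is lower semicontinuous; on a barrelled space this implies continuity.
  have hp : Continuous ((normSeminorm ℂ H).comp L) := by
    refine Seminorm.continuous_of_lowerSemicontinuous _
      (lowerSemicontinuous_iff_isClosed_preimage.2 fun r => ?_)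
    rcases lt_or_ge r 0 with hr | hr
    · convert isClosed_empty
      ext f
      simp only [Set.mem_preimage, Set.mem_Iic, Set.mem_empty_iff_false, iff_false, not_le]
      exact hr.trans_le (apply_nonneg _ _)
    · have : ((normSeminorm ℂ H).comp L) ⁻¹' Set.Iic r =
          ⋂ χ ∈ D, {f | ‖⟪χ, L f⟫_ℂ‖ ≤ ‖χ‖ * r} := by
        ext f
        simp only [Set.mem_preimage, Seminorm.comp_apply, coe_normSeminorm, Set.mem_Iic,
          Set.mem_iInter, Set.mem_ofPred_eq]
        exact norm_le_iff_of_dense hD _ hr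
      rw [this]
      exact isClosed_biInter fun χ hχ => isClosed_le (hL χ hχ).norm continuous_const
  refine continuous_of_continuousAt_zero L ?_
  rw [ContinuousAt, map_zero, tendsto_zero_iff_norm_tendsto_zero]
  have := hp.tendsto 0
  rwa [map_zero] at this

/-- A separately continuous bilinear map on Fréchet spaces is continuous. -/
theorem continuous_of_separately {X Y H : Type*} [AddCommGroup X] [Module ℂ X]
    [TopologicalSpace X] [IsTopologicalAddGroup X] [FirstCountableTopology X]
    [AddCommGroup Y] [Module ℂ Y] [UniformSpace Y] [IsUniformAddGroup Y]
    [ContinuousSMul ℂ Y] [FirstCountableTopology Y] [BarrelledSpace ℂ Y]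
    [NormedAddCommGroup H] [NormedSpace ℂ H] (B : X →ₗ[ℂ] Y →ₗ[ℂ] H)
    (h1 : ∀ g, Continuous fun f => B f g) (h2 : ∀ f, Continuous (B f)) :
    Continuous fun p : X × Y => B p.1 p.2 := by
  have h0 : Tendsto (fun p : X × Y => B p.1 p.2) (𝓝 (0 : X × Y)) (𝓝 0) := by
    refine tendsto_of_seq_tendsto fun u hu => ?_
    have hu1 : Tendsto (fun j => (u j).1) atTop (𝓝 0) := (continuous_fst.tendsto _).comp hu
    have hu2 : Tendsto (fun j => (u j).2) atTop (𝓝 0) := (continuous_snd.tendsto _).comp hu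
    let T : ℕ → Y →L[ℂ] H := fun j => ⟨B (u j).1, h2 _⟩
    -- The first arguments tend to 0, so these maps are bounded at each point, and Banach–Steinhaus
    -- makes them equicontinuous.
    have hE : UniformEquicontinuous ((fun S : Y →L[ℂ] H => (S : Y → H)) ∘ T) := by
      refine (norm_withSeminorms ℂ H).banach_steinhaus fun _ g => ?_
      have ht : Tendsto (fun j => B (u j).1 g) atTop (𝓝 (B 0 g)) := ((h1 g).tendsto 0).comp hu1
      exact ht.norm.bddAbove_range
    rw [Metric.tendsto_nhds]
    intro ε hε
    have := Metric.equicontinuousAt_iff_right.1 (hE.equicontinuous 0) ε hε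
    filter_upwards [hu2.eventually this] with j hj
    have hj' := hj j
    simp only [Function.comp_apply, map_zero] at hj'
    rw [dist_comm]
    exact hj'
  rw [continuous_iff_continuousAt]
  rintro ⟨f₀, g₀⟩
  -- Expansion around (f₀, g₀) reduces joint continuity there to joint continuity at the origin and
  -- the two separate continuities.
  have e : (fun p : X × Y => B p.1 p.2) = fun p =>
      B (p.1 - f₀) (p.2 - g₀) + B f₀ p.2 + B p.1 g₀ - B f₀ g₀ := by
    funext p
    simp only [map_sub, LinearMap.sub_apply]
    abel
  rw [ContinuousAt, e]
  have hs : Tendsto (fun p : X × Y => (p.1 - f₀, p.2 - g₀)) (𝓝 (f₀, g₀)) (𝓝 0) := by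
    have : Continuous fun p : X × Y => (p.1 - f₀, p.2 - g₀) := by fun_prop
    have h := this.tendsto (f₀, g₀)
    simp only [sub_self] at h
    exact h
  have c1 : Tendsto (fun p : X × Y => B f₀ p.2) (𝓝 (f₀, g₀)) (𝓝 (B f₀ g₀)) :=
    ((h2 f₀).comp continuous_snd).tendsto _
  have c2 : Tendsto (fun p : X × Y => B p.1 g₀) (𝓝 (f₀, g₀)) (𝓝 (B f₀ g₀)) :=
    ((h1 g₀).comp continuous_fst).tendsto _
  have := (((h0.comp hs).add c1).add c2).sub_const (B f₀ g₀)
  simpa using this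

theorem exists_bound_of_continuous_bilinear {X Y H ι κ : Type*} [AddCommGroup X] [Module ℂ X]
    [TopologicalSpace X] [AddCommGroup Y] [Module ℂ Y] [TopologicalSpace Y]
    [NormedAddCommGroup H] [NormedSpace ℂ H] {p : SeminormFamily ℂ X ι}
    {q : SeminormFamily ℂ Y κ} (hp : WithSeminorms p) (hq : WithSeminorms q)
    (B : X →ₗ[ℂ] Y →ₗ[ℂ] H) (hB : Continuous fun p : X × Y => B p.1 p.2) :
    ∃ (s : Finset ι) (t : Finset κ) (C : ℝ), 0 ≤ C ∧ ∀ f g, ‖B f g‖ ≤ C * s.sup p f * t.sup q g := by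
  have h0 : ∀ᶠ z in 𝓝 (0 : X) ×ˢ 𝓝 (0 : Y), ‖B z.1 z.2‖ < 1 := by
    rw [← nhds_prod_eq]
    have := (hB.norm.tendsto (0, 0)).eventually 
      (gt_mem_nhds (show ‖B (0 : X) (0 : Y)‖ < 1 by simp))
    exact this
  obtain ⟨U, hU, V, hV, hUV⟩ := Filter.mem_prod_iff.1 h0
  obtain ⟨s, r, hr, hs⟩ := (hp.mem_nhds_iff 0 U).1 hU
  obtain ⟨t, r', hr', ht⟩ := (hq.mem_nhds_iff 0 V).1 hV
  refine ⟨s, t, (2 / r) * (2 / r'), by positivity, fun f g => ?_⟩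
  -- The seminorms may vanish at f or g, so the rescaling into the neighbourhoods divides by the
  -- seminorm plus δ; at the end δ tends to 0.
  have key : ∀ δ > 0, ‖B f g‖ ≤ (2 / r) * (2 / r') * (s.sup p f + δ) * (t.sup q g + δ) := by
    intro δ hδ
    have hf : 0 < s.sup p f + δ := add_pos_of_nonneg_of_pos (apply_nonneg _ _) hδ
    have hg : 0 < t.sup q g + δ := add_pos_of_nonneg_of_pos (apply_nonneg _ _) hδ
    have ha : 0 < r / 2 / (s.sup p f + δ) := by positivity
    have hb : 0 < r' / 2 / (t.sup q g + δ) := by positivity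
    have hfU : ((r / 2 / (s.sup p f + δ) : ℝ) : ℂ) • f ∈ U := hs <| by
      rw [Seminorm.mem_ball_zero, map_smul_eq_mul, Complex.norm_real, Real.norm_of_nonneg ha.le,
        div_mul_eq_mul_div, div_lt_iff₀ hf]
      nlinarith [apply_nonneg (s.sup p) f]
    have hgV : ((r' / 2 / (t.sup q g + δ) : ℝ) : ℂ) • g ∈ V := ht <| by
      rw [Seminorm.mem_ball_zero, map_smul_eq_mul, Complex.norm_real, Real.norm_of_nonneg hb.le,
        div_mul_eq_mul_div, div_lt_iff₀ hg]
      nlinarith [apply_nonneg (t.sup q) g]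
    have h := hUV (Set.mk_mem_prod hfU hgV)
    simp only [Set.mem_ofPred_eq, map_smul, LinearMap.smul_apply, norm_smul, Complex.norm_real,
      Real.norm_of_nonneg ha.le, Real.norm_of_nonneg hb.le] at h
    have : ‖B f g‖ ≤ 1 / ((r / 2 / (s.sup p f + δ)) * (r' / 2 / (t.sup q g + δ))) := by
      rw [le_div_iff₀ (by positivity)]
      nlinarith
    refine this.trans (le_of_eq ?_)
    field_simp
  have hc : ContinuousWithinAt
      (fun δ : ℝ => (2 / r) * (2 / r') * (s.sup p f + δ) * (t.sup q g + δ)) (Set.Ioi 0) 0 := by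
    fun_prop
  have := ge_of_tendsto hc (eventually_nhdsWithin_of_forall key)
  simpa using this

end Barrelled

/-! ### A directed family of Schwartz seminorms -/

section Seminorms

variable {E F : Type*} [NormedAddCommGroup E] [NormedSpace ℝ E] [NormedAddCommGroup F]
  [NormedSpace ℂ F]

/-- The supremum of the Schwartz seminorms of order at most `(k, n)`. -/
def sn (k n : ℕ) : Seminorm ℂ 𝓢(E, F) := (Finset.Iic (k, n)).sup (schwartzSeminormFamily ℂ E F)

theorem sn_le {k n : ℕ} {v : 𝓢(E, F)} {M : ℝ} (hM : 0 ≤ M)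
    (h : ∀ k' ≤ k, ∀ n' ≤ n, ∀ x, ‖x‖ ^ k' * ‖iteratedFDeriv ℝ n' v x‖ ≤ M) : sn k n v ≤ M := by
  refine Seminorm.finset_sup_apply_le hM fun i hi => ?_
  obtain ⟨h1, h2⟩ := Prod.mk_le_mk.1 (Finset.mem_Iic.1 hi)
  exact SchwartzMap.seminorm_le_bound ℂ i.1 i.2 v hM (h i.1 h1 i.2 h2)

theorem le_sn {k n k' n' : ℕ} (hk : k' ≤ k) (hn : n' ≤ n) (v : 𝓢(E, F)) (x : E) :
    (1 + ‖x‖) ^ k' * ‖iteratedFDeriv ℝ n' v x‖ ≤ 2 ^ k * sn k n v :=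
  SchwartzMap.one_add_le_sup_seminorm_apply (m := (k, n)) hk hn v x

/-- The family `sn` is cofinal: every estimate needs one pair (k, n) instead of a finite set of
pairs. -/
theorem finset_sup_le_sn (s : Finset (ℕ × ℕ)) :
    ∃ k n, ∀ v : 𝓢(E, F), s.sup (schwartzSeminormFamily ℂ E F) v ≤ sn k n v := by
  refine ⟨s.sup Prod.fst, s.sup Prod.snd, fun v => ?_⟩
  refine Finset.sup_mono (f := schwartzSeminormFamily ℂ E F) (fun i hi => ?_) v
  exact Finset.mem_Iic.2 ⟨Finset.le_sup (f := Prod.fst) hi, Finset.le_sup (f := Prod.snd) hi⟩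

theorem continuous_sn (k n : ℕ) : Continuous (sn k n : 𝓢(E, F) → ℝ) := by
  have h : ∀ i, Continuous (schwartzSeminormFamily ℂ E F i) :=
    (schwartz_withSeminorms ℂ E F).continuous_seminorm
  exact Finset.sup_induction (p := fun q : Seminorm ℂ 𝓢(E, F) => Continuous q) continuous_const
    (fun a ha b hb => ha.sup hb) (fun i _ => h i)

theorem seminorm_le_sn {k n : ℕ} (v : 𝓢(E, F)) : SchwartzMap.seminorm ℝ k n v ≤ sn k n v :=
  Finset.le_sup (f := schwartzSeminormFamily ℂ E F) (Finset.mem_Iic.2 (le_refl (k, n))) v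

theorem exists_sn_bound (p : Seminorm ℂ 𝓢(E, F)) (hp : Continuous p) :
    ∃ (k n : ℕ) (C : ℝ), 0 ≤ C ∧ ∀ v, p v ≤ C * sn k n v := by
  obtain ⟨s, C, -, h⟩ := Seminorm.bound_of_continuous (schwartz_withSeminorms ℂ E F) p hp
  obtain ⟨k, n, hs⟩ := finset_sup_le_sn (E := E) (F := F) s
  refine ⟨k, n, C, C.2, fun v => (h v).trans ?_⟩
  exact mul_le_mul_of_nonneg_left (hs v) C.2

theorem exists_sn_bound_clm {H : Type*} [NormedAddCommGroup H] [NormedSpace ℂ H]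
    (T : 𝓢(E, F) →L[ℂ] H) : ∃ (k n : ℕ) (C : ℝ), 0 ≤ C ∧ ∀ v, ‖T v‖ ≤ C * sn k n v :=
  exists_sn_bound ((normSeminorm ℂ H).comp T.toLinearMap) (continuous_norm.comp T.continuous)

theorem exists_sn_bound_map {E' F' : Type*} [NormedAddCommGroup E'] [NormedSpace ℝ E']
    [NormedAddCommGroup F'] [NormedSpace ℂ F'] (T : 𝓢(E, F) →L[ℂ] 𝓢(E', F')) (k n : ℕ) :
    ∃ (k' n' : ℕ) (C : ℝ), 0 ≤ C ∧ ∀ v, sn k n (T v) ≤ C * sn k' n' v :=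
  exists_sn_bound ((sn (E := E') (F := F') k n).comp T.toLinearMap) ((continuous_sn k n).comp T.continuous)

theorem tendsto_schwartz_iff_sn {ι : Type*} {l : Filter ι} {u : ι → 𝓢(E, F)} {f : 𝓢(E, F)} :
    Tendsto u l (𝓝 f) ↔ ∀ k n, Tendsto (fun i => sn k n (u i - f)) l (𝓝 0) := by
  constructor
  · intro h k n
    have := ((continuous_sn (E := E) (F := F) k n).tendsto 0).comp
      (tendsto_sub_nhds_zero_iff.2 h)
    rwa [map_zero] at this
  · intro h
    refine tendsto_schwartz_iff.2 fun k n => ?_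
    exact squeeze_zero (fun i => apply_nonneg _ _) (fun i => seminorm_le_sn _) (h k n)

/-- A linear map into a normed space is continuous if it is bounded by a Schwartz seminorm. -/
def mkCLMOfBound {H : Type*} [NormedAddCommGroup H] [NormedSpace ℂ H] (T : 𝓢(E, F) →ₗ[ℂ] H)
    (k n : ℕ) (C : ℝ) (h : ∀ v, ‖T v‖ ≤ C * sn k n v) : 𝓢(E, F) →L[ℂ] H where
  toLinearMap := T
  cont := by
    refine continuous_of_continuousAt_zero T ?_
    rw [ContinuousAt, map_zero]
    refine squeeze_zero_norm h ?_
    have := ((continuous_sn (E := E) (F := F) k n).const_mul C).tendsto 0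
    simpa using this

/-- A linear map between Schwartz spaces is continuous if it is bounded with respect to the
seminorms. -/
theorem continuous_of_sn_bound {E' F' : Type*} [NormedAddCommGroup E'] [NormedSpace ℝ E']
    [NormedAddCommGroup F'] [NormedSpace ℂ F'] (T : 𝓢(E, F) →ₗ[ℂ] 𝓢(E', F'))
    (h : ∀ k n, ∃ (k' n' : ℕ) (C : ℝ), ∀ v, sn k n (T v) ≤ C * sn k' n' v) : Continuous T := by
  refine continuous_of_continuousAt_zero T ?_
  rw [ContinuousAt, map_zero, tendsto_schwartz_iff_sn]
  intro k n
  obtain ⟨k', n', C, hC⟩ := h k n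
  simp only [sub_zero]
  refine squeeze_zero (fun v => apply_nonneg _ _) hC ?_
  have := ((continuous_sn (E := E) (F := F) k' n').const_mul C).tendsto 0
  simpa using this

end Seminorms

/-! ### Multiplication operators that depend on a parameter -/

section Multipliers

variable {Y E F : Type*} [NormedAddCommGroup E] [NormedSpace ℝ E] [NormedAddCommGroup F]
  [NormedSpace ℂ F] [NormedAddCommGroup Y] [NormedSpace ℝ Y]

/-- Leibniz rule: 2 ^ n is the sum of the binomial coefficients, and 2 ^ (k + N) comes from `le_sn`.
The constant A stays explicit because it carries the dependence on parameters later. -/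
theorem sn_smul_le {k n N : ℕ} {m : E → ℂ} {A : ℝ} (hA : 0 ≤ A) (hm : ContDiff ℝ (⊤ : ℕ∞) m)
    (hb : ∀ i ≤ n, ∀ x, ‖iteratedFDeriv ℝ i m x‖ ≤ A * (1 + ‖x‖) ^ N) {u v : 𝓢(E, F)}
    (huv : ∀ x, v x = m x • u x) :
    sn k n v ≤ A * (2 ^ n * 2 ^ (k + N)) * sn (k + N) n u := by
  set S := sn (k + N) n u with hSdef
  have hS : 0 ≤ S := apply_nonneg _ _
  refine sn_le (by positivity) fun k' hk' n' hn' x => ?_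
  have hv : (v : E → F) = fun x => m x • u x := funext huv
  rw [hv]
  have h := norm_iteratedFDeriv_smul_le (𝕜 := ℝ) hm (u.smooth ⊤) x (n := n') (mod_cast le_top)
  have hx : ‖x‖ ^ k' ≤ (1 + ‖x‖) ^ k := by
    calc ‖x‖ ^ k' ≤ (1 + ‖x‖) ^ k' := by gcongr; linarith
      _ ≤ _ := pow_le_pow_right₀ (by linarith [norm_nonneg x]) hk'
  calc ‖x‖ ^ k' * ‖iteratedFDeriv ℝ n' (fun x => m x • u x) x‖
      ≤ (1 + ‖x‖) ^ k * ∑ i ∈ Finset.range (n' + 1), (n'.choose i : ℝ) *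
          ‖iteratedFDeriv ℝ i m x‖ * ‖iteratedFDeriv ℝ (n' - i) u x‖ := by gcongr
    _ ≤ ∑ i ∈ Finset.range (n' + 1), (n'.choose i : ℝ) * (A * 2 ^ (k + N) * S) := by
        rw [Finset.mul_sum]
        refine Finset.sum_le_sum fun i hi => ?_
        have hi' : i ≤ n := (Nat.lt_succ_iff.1 (Finset.mem_range.1 hi)).trans hn'
        have h1 := hb i hi' x
        have h2 := le_sn (le_refl (k + N)) ((Nat.sub_le n' i).trans hn') u x
        calc _ ≤ (1 + ‖x‖) ^ k * ((n'.choose i : ℝ) * (A * (1 + ‖x‖) ^ N) *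
              ‖iteratedFDeriv ℝ (n' - i) u x‖) := by gcongr
          _ = (n'.choose i : ℝ) * (A * ((1 + ‖x‖) ^ (k + N) *
              ‖iteratedFDeriv ℝ (n' - i) u x‖)) := by rw [pow_add]; ring
          _ ≤ (n'.choose i : ℝ) * (A * (2 ^ (k + N) * S)) := by gcongr
          _ = _ := by ring
    _ = 2 ^ n' * (A * 2 ^ (k + N) * S) := by
        rw [← Finset.sum_mul]
        congr 1
        exact_mod_cast Nat.sum_range_choose n'
    _ ≤ 2 ^ n * (A * 2 ^ (k + N) * S) := by
        gcongr
        norm_num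
    _ = _ := by ring

theorem iteratedFDeriv_slice {m : Y × E → ℂ} (hm : ContDiff ℝ (⊤ : ℕ∞) m) (i : ℕ) (y : Y) (x : E) :
    iteratedFDeriv ℝ i (fun x => m (y, x)) x =
      (iteratedFDeriv ℝ i m (y, x)).compContinuousLinearMap
        fun _ => ContinuousLinearMap.inr ℝ Y E := by
  have h := (ContinuousLinearMap.inr ℝ Y E).iteratedFDeriv_comp_right
    (f := fun z => m (z + (y, 0))) (n := (⊤ : ℕ∞)) (hm.comp (contDiff_id.add contDiff_const)) x
    (i := i) (mod_cast le_top)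
  rw [iteratedFDeriv_comp_add_right] at h
  have e1 : ((fun z => m (z + (y, 0))) ∘ (ContinuousLinearMap.inr ℝ Y E)) = fun x => m (y, x) := by
    funext x
    simp
  have e2 : (ContinuousLinearMap.inr ℝ Y E) x + (y, 0) = (y, x) := by simp
  rw [e1, e2] at h
  exact h

theorem norm_comp_inr_le {i : ℕ} (M : (Y × E) [×i]→L[ℝ] ℂ) :
    ‖M.compContinuousLinearMap fun _ => ContinuousLinearMap.inr ℝ Y E‖ ≤ ‖M‖ := by
  refine (M.norm_compContinuousLinearMap_le _).trans ?_
  refine mul_le_of_le_one_right (norm_nonneg _) (Finset.prod_le_one (fun _ _ => norm_nonneg _) ?_)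
  intro _ _
  refine ContinuousLinearMap.opNorm_le_bound _ zero_le_one fun x => ?_
  simp

theorem one_add_norm_prod_le (y : Y) (x : E) : 1 + ‖(y, x)‖ ≤ (1 + ‖y‖) * (1 + ‖x‖) := by
  have : ‖(y, x)‖ ≤ ‖y‖ + ‖x‖ :=
    max_le (le_add_of_nonneg_right (norm_nonneg _)) (le_add_of_nonneg_left (norm_nonneg _))
  nlinarith [mul_nonneg (norm_nonneg y) (norm_nonneg x)]

theorem exists_slice_bound {m : Y × E → ℂ} (hm : m.HasTemperateGrowth) (n : ℕ) :
    ∃ (N : ℕ) (C : ℝ), 0 ≤ C ∧ ∀ i ≤ n, ∀ y x,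
      ‖iteratedFDeriv ℝ i (fun x => m (y, x)) x‖ ≤ C * (1 + ‖y‖) ^ N * (1 + ‖x‖) ^ N := by
  obtain ⟨N, C, hC, h⟩ := hm.norm_iteratedFDeriv_le_uniform n
  refine ⟨N, C, hC, fun i hi y x => ?_⟩
  rw [iteratedFDeriv_slice hm.1, mul_assoc, ← mul_pow]
  refine (norm_comp_inr_le _).trans ((h i hi _).trans ?_)
  gcongr
  exact one_add_norm_prod_le y x

/-- Mean value theorem along the segment from (y₀, x) to (y, x), at the cost of one more derivative.
This yields continuity of the multiplication operators in the parameter. -/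
theorem exists_slice_diff_bound {m : Y × E → ℂ} (hm : m.HasTemperateGrowth) (n : ℕ) (y₀ : Y) :
    ∃ (N : ℕ) (C : ℝ), 0 ≤ C ∧ ∀ i ≤ n, ∀ y, ‖y - y₀‖ ≤ 1 → ∀ x,
      ‖iteratedFDeriv ℝ i (fun x => m (y, x) - m (y₀, x)) x‖ ≤
        C * ‖y - y₀‖ * (1 + ‖x‖) ^ N := by
  obtain ⟨N, C, hC, h⟩ := hm.norm_iteratedFDeriv_le_uniform (n + 1)
  refine ⟨N, C * (2 + ‖y₀‖) ^ N, by positivity, fun i hi y hy x => ?_⟩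
  have hs : ∀ y : Y, ContDiff ℝ (⊤ : ℕ∞) fun x => m (y, x) := fun y =>
    hm.1.comp (contDiff_const.prodMk contDiff_id)
  have hsub : iteratedFDeriv ℝ i (fun x => m (y, x) - m (y₀, x)) x =
      iteratedFDeriv ℝ i (fun x => m (y, x)) x - iteratedFDeriv ℝ i (fun x => m (y₀, x)) x :=
    iteratedFDeriv_sub_apply ((hs y).of_le (mod_cast le_top)).contDiffAt
      ((hs y₀).of_le (mod_cast le_top)).contDiffAt
  have hlin : iteratedFDeriv ℝ i (fun x => m (y, x) - m (y₀, x)) x =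
      (iteratedFDeriv ℝ i m (y, x) - iteratedFDeriv ℝ i m (y₀, x)).compContinuousLinearMap
        fun _ => ContinuousLinearMap.inr ℝ Y E := by
    rw [hsub, iteratedFDeriv_slice hm.1, iteratedFDeriv_slice hm.1]
    rfl
  rw [hlin]
  refine (norm_comp_inr_le _).trans ?_
  -- On the segment the first component stays within distance 1 of y₀, whence the factor 2 + ‖y₀‖.
  have hseg : ∀ z ∈ segment ℝ (y₀, x) (y, x), 1 + ‖z‖ ≤ (2 + ‖y₀‖) * (1 + ‖x‖) := by
    intro z hz
    have hc : Convex ℝ (Metric.closedBall y₀ 1 ×ˢ ({x} : Set E)) :=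
      (convex_closedBall y₀ 1).prod (convex_singleton x)
    have hmem := hc.segment_subset (x := (y₀, x)) (y := (y, x)) (by simp)
      (by simpa [dist_eq_norm] using hy) hz
    obtain ⟨hz1, hz2⟩ := hmem
    obtain ⟨z1, z2⟩ := z
    simp only [Metric.mem_closedBall, dist_eq_norm, Set.mem_singleton_iff] at hz1 hz2
    subst hz2
    refine (one_add_norm_prod_le z1 z2).trans ?_
    have : ‖z1‖ ≤ ‖z1 - y₀‖ + ‖y₀‖ := by simpa using norm_add_le (z1 - y₀) y₀
    refine mul_le_mul_of_nonneg_right ?_ (by positivity)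
    linarith
  have hmv := (convex_segment (𝕜 := ℝ) (y₀, x) (y, x)).norm_image_sub_le_of_norm_fderiv_le (𝕜 := ℝ)
    (f := iteratedFDeriv ℝ i m) (C := C * ((2 + ‖y₀‖) * (1 + ‖x‖)) ^ N)
    (fun z _ => (hm.1.differentiable_iteratedFDeriv
      (by exact_mod_cast ENat.natCast_lt_top i)).differentiableAt)
    (fun z hz => by
      rw [norm_fderiv_iteratedFDeriv]
      refine (h (i + 1) (by lia) z).trans ?_
      have := hseg z hz
      gcongr)
    (left_mem_segment ℝ _ _) (right_mem_segment ℝ _ _)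
  have hn : ‖((y, x) : Y × E) - (y₀, x)‖ = ‖y - y₀‖ := by
    simp [Prod.norm_def]
  rw [hn, mul_pow] at hmv
  linarith

theorem slice_hasTemperateGrowth {m : Y × E → ℂ} (hm : m.HasTemperateGrowth) (y : Y) :
    (fun x => m (y, x)).HasTemperateGrowth := by
  refine ⟨hm.1.comp (contDiff_const.prodMk contDiff_id), fun n => ?_⟩
  obtain ⟨N, C, -, h⟩ := exists_slice_bound hm n
  exact ⟨N, C * (1 + ‖y‖) ^ N, fun x => h n le_rfl y x⟩

/-- The family of multiplication operators that belongs to a function of temperate growth of a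
parameter `y` and a variable `x`. -/
def famMul (F : Type*) [NormedAddCommGroup F] [NormedSpace ℂ F] (m : Y × E → ℂ) (y : Y) :
    𝓢(E, F) →L[ℂ] 𝓢(E, F) :=
  SchwartzMap.smulLeftCLM F fun x => m (y, x)

theorem famMul_apply {m : Y × E → ℂ} (hm : m.HasTemperateGrowth) (y : Y) (u : 𝓢(E, F)) (x : E) :
    famMul F m y u x = m (y, x) • u x :=
  SchwartzMap.smulLeftCLM_apply_apply (slice_hasTemperateGrowth hm y) u x

theorem famMul_bound {m : Y × E → ℂ} (hm : m.HasTemperateGrowth) (k n : ℕ) :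
    ∃ (N k' : ℕ) (C : ℝ), 0 ≤ C ∧ ∀ y (u : 𝓢(E, F)),
      sn k n (famMul F m y u) ≤ C * (1 + ‖y‖) ^ N * sn k' n u := by
  obtain ⟨N, C, hC, h⟩ := exists_slice_bound hm n
  refine ⟨N, k + N, C * (2 ^ n * 2 ^ (k + N)), by positivity, fun y u => ?_⟩
  refine (sn_smul_le (A := C * (1 + ‖y‖) ^ N) (by positivity) (slice_hasTemperateGrowth hm y).1
    (fun i hi x => h i hi y x) (famMul_apply hm y u)).trans (le_of_eq ?_)
  ring

theorem continuous_famMul {m : Y × E → ℂ} (hm : m.HasTemperateGrowth) :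
    Continuous fun p : Y × 𝓢(E, F) => famMul F m p.1 p.2 := by
  rw [continuous_iff_continuousAt]
  rintro ⟨y₀, u₀⟩
  rw [ContinuousAt, tendsto_schwartz_iff_sn]
  intro k n
  obtain ⟨N, k', C, hC, hb⟩ := famMul_bound (F := F) hm k n
  obtain ⟨N', C', hC', hd⟩ := exists_slice_diff_bound hm n y₀
  have hev : ∀ᶠ p : Y × 𝓢(E, F) in 𝓝 (y₀, u₀), sn k n (famMul F m p.1 p.2 - famMul F m y₀ u₀) ≤
      C * (1 + ‖p.1‖) ^ N * sn k' n (p.2 - u₀) +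
        C' * ‖p.1 - y₀‖ * (2 ^ n * 2 ^ (k + N')) * sn (k + N') n u₀ := by
    have h1 : ∀ᶠ p : Y × 𝓢(E, F) in 𝓝 (y₀, u₀), ‖p.1 - y₀‖ < 1 := by
      have : Continuous fun p : Y × 𝓢(E, F) => ‖p.1 - y₀‖ := by fun_prop
      exact (this.tendsto (y₀, u₀)).eventually (gt_mem_nhds (by simp))
    filter_upwards [h1] with p hp
    -- The first term is small by a bound that is locally uniform in y, the second by the mean value
    -- estimate at the fixed u₀.
    have e : famMul F m p.1 p.2 - famMul F m y₀ u₀ =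
        famMul F m p.1 (p.2 - u₀) + (famMul F m p.1 u₀ - famMul F m y₀ u₀) := by
      rw [map_sub]; abel
    rw [e]
    refine (map_add_le_add _ _ _).trans (add_le_add (hb _ _) ?_)
    refine sn_smul_le (m := fun x => m (p.1, x) - m (y₀, x)) (by positivity)
      ((slice_hasTemperateGrowth hm _).1.sub (slice_hasTemperateGrowth hm _).1)
      (fun i hi x => hd i hi p.1 hp.le x) fun x => ?_
    rw [sub_apply, famMul_apply hm, famMul_apply hm, sub_smul]
  refine squeeze_zero' (Eventually.of_forall fun p => apply_nonneg _ _) hev ?_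
  have hc : Continuous fun p : Y × 𝓢(E, F) => C * (1 + ‖p.1‖) ^ N * sn k' n (p.2 - u₀) +
        C' * ‖p.1 - y₀‖ * (2 ^ n * 2 ^ (k + N')) * sn (k + N') n u₀ := by
    have := continuous_sn (E := E) (F := F) k' n
    fun_prop
  have := hc.tendsto (y₀, u₀)
  simpa using this

end Multipliers

/-! ### Translations of test functions -/

section Translations

/-- Translation of test functions, `(τ_y f)(x) = f(x - y)`. -/
def trans {V F : Type*} [NormedAddCommGroup V] [NormedSpace ℝ V] [NormedAddCommGroup F]
    [NormedSpace ℂ F] (y : V) : 𝓢(V, F) →L[ℂ] 𝓢(V, F) := SchwartzMap.compSubConstCLM ℂ y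

@[simp]
theorem trans_apply {V F : Type*} [NormedAddCommGroup V] [NormedSpace ℝ V]
    [NormedAddCommGroup F] [NormedSpace ℂ F] (y : V) (f : 𝓢(V, F)) (x : V) : trans y f x = f (x - y) := rfl

variable {V F : Type*} [NormedAddCommGroup V] [InnerProductSpace ℝ V] [FiniteDimensional ℝ V]
  [MeasurableSpace V] [BorelSpace V] [NormedAddCommGroup F] [NormedSpace ℂ F]

theorem cexp_hasTemperateGrowth {E : Type*} [NormedAddCommGroup E] [NormedSpace ℝ E] {q : E → ℝ}
    (hq : q.HasTemperateGrowth) : (fun x => Complex.exp (q x * Complex.I)).HasTemperateGrowth := by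
  have h : (fun x => -2 * q x).HasTemperateGrowth :=
    (Function.HasTemperateGrowth.const (-2 : ℝ)).mul hq
  convert expI_hasTemperateGrowth.comp h using 1
  funext x
  simp only [Function.comp_apply]
  congr 1
  push_cast
  ring

/-- The exponentials `exp(2π i ⟪y, x⟫)`. -/
def expFun (p : V × V) : ℂ := Complex.exp ((2 * Real.pi * ⟪p.1, p.2⟫_ℝ : ℝ) * Complex.I)

theorem expFun_hasTemperateGrowth : (expFun (V := V)).HasTemperateGrowth := by
  refine cexp_hasTemperateGrowth (E := V × V) (q := fun p => 2 * Real.pi * ⟪p.1, p.2⟫_ℝ) ?_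
  refine (Function.HasTemperateGrowth.const (2 * Real.pi)).mul ?_
  exact (innerSL ℝ (E := V)).bilinear_hasTemperateGrowth
    (ContinuousLinearMap.fst ℝ V V).hasTemperateGrowth
    (ContinuousLinearMap.snd ℝ V V).hasTemperateGrowth

theorem norm_expFun (p : V × V) : ‖expFun p‖ = 1 := Complex.norm_exp_ofReal_mul_I _

theorem fourier_trans (y : V) (f : 𝓢(V, F)) (ξ : V) : 𝓕 (trans y f) ξ = expFun (-y, ξ) • 𝓕 f ξ := by
  rw [SchwartzMap.fourier_coe, SchwartzMap.fourier_coe, Real.fourier_eq', Real.fourier_eq',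
    ← MeasureTheory.integral_smul]
  rw [← MeasureTheory.integral_add_right_eq_self _ y]
  congr 1
  funext x
  rw [trans_apply, add_sub_cancel_right, smul_smul, expFun, ← Complex.exp_add]
  congr 2
  rw [inner_add_left, inner_neg_left]
  push_cast
  ring

/-- On the Fourier side a translation is multiplication by a character, so joint continuity and
polynomial bounds in y become instances of the results on `famMul`. -/
theorem trans_eq_fourierInv [CompleteSpace F] (y : V) (f : 𝓢(V, F)) :
    trans y f = 𝓕⁻ (famMul F expFun (-y) (𝓕 f)) := by
  rw [← FourierTransform.fourierInv_fourier_eq (F := 𝓢(V, F)) (trans y f)]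
  congr 1
  ext ξ
  rw [fourier_trans, famMul_apply expFun_hasTemperateGrowth]

theorem continuous_trans [CompleteSpace F] : Continuous fun p : V × 𝓢(V, F) => trans p.1 p.2 := by
  simp only [trans_eq_fourierInv]
  have h := continuous_famMul (F := F) (expFun_hasTemperateGrowth (V := V))
  have h2 : Continuous fun p : V × 𝓢(V, F) => ((-p.1, 𝓕 p.2) : V × 𝓢(V, F)) :=
    continuous_fst.neg.prodMk
      ((FourierTransform.fourierCLM ℂ 𝓢(V, F)).continuous.comp continuous_snd)
  exact (FourierTransform.fourierInvCLM ℂ 𝓢(V, F)).continuous.comp (h.comp h2)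

theorem trans_bound [CompleteSpace F] (k n : ℕ) : ∃ (N k' n' : ℕ) (C : ℝ), 0 ≤ C ∧
    ∀ (y : V) (u : 𝓢(V, F)), sn k n (trans y u) ≤ C * (1 + ‖y‖) ^ N * sn k' n' u := by
  obtain ⟨k1, n1, C1, hC1, h1⟩ :=
    exists_sn_bound_map (FourierTransform.fourierInvCLM ℂ 𝓢(V, F)) k n
  obtain ⟨N, k2, C2, hC2, h2⟩ := famMul_bound (F := F) (expFun_hasTemperateGrowth (V := V)) k1 n1
  obtain ⟨k3, n3, C3, hC3, h3⟩ :=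
    exists_sn_bound_map (FourierTransform.fourierCLM ℂ 𝓢(V, F)) k2 n1
  refine ⟨N, k3, n3, C1 * C2 * C3, by positivity, fun y u => ?_⟩
  rw [trans_eq_fourierInv]
  refine (h1 _).trans ?_
  calc _ ≤ C1 * (C2 * (1 + ‖-y‖) ^ N * (C3 * sn k3 n3 u)) := by
        gcongr
        refine (h2 _ _).trans ?_
        gcongr
        exact h3 u
    _ = _ := by rw [norm_neg]; ring

end Translations

/-! ### Integrals of functions with values in a Schwartz space -/

section Integrals

variable {A E F : Type*} [MeasurableSpace A] [TopologicalSpace A] [OpensMeasurableSpace A]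
  [SecondCountableTopology A] {μ : Measure A}
  [NormedAddCommGroup E] [NormedSpace ℝ E] [NormedAddCommGroup F] [NormedSpace ℂ F]
  [CompleteSpace F] {γ : A → 𝓢(E, F)}

/-- The function `(x, v) ↦ ‖x‖ ^ k • D^n f(x)(v₁, …, vₙ)`, where the vectors `vⱼ` belong to the unit
ball. -/
def flatJet (k n : ℕ) (f : 𝓢(E, F)) :
    BoundedContinuousFunction (E × (Fin n → Metric.closedBall (0 : E) 1)) F :=
  BoundedContinuousFunction.ofNormedAddCommGroup
    (fun z => ‖z.1‖ ^ k • iteratedFDeriv ℝ n f z.1 fun i => (z.2 i : E))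
    (by
      refine (continuous_fst.norm.pow k).smul ?_
      have h1 : Continuous fun z : E × (Fin n → Metric.closedBall (0 : E) 1) =>
          iteratedFDeriv ℝ n f z.1 :=
        ((f.smooth n).continuous_iteratedFDeriv le_rfl).comp continuous_fst
      exact h1.eval (by fun_prop))
    (SchwartzMap.seminorm ℝ k n f) (fun z => by
      rw [norm_smul, norm_pow, norm_norm]
      refine le_trans ?_ (SchwartzMap.le_seminorm ℝ k n f z.1)
      gcongr
      refine ((iteratedFDeriv ℝ n f z.1).le_opNorm _).trans ?_
      refine mul_le_of_le_one_right (norm_nonneg _)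
        (Finset.prod_le_one (fun _ _ => norm_nonneg _) fun i _ => ?_)
      exact mem_closedBall_zero_iff.1 (z.2 i).2)

theorem flatJet_apply (k n : ℕ) (f : 𝓢(E, F)) (x : E)
    (v : Fin n → Metric.closedBall (0 : E) 1) :
    flatJet k n f (x, v) = ‖x‖ ^ k • iteratedFDeriv ℝ n f x fun i => (v i : E) := rfl

theorem norm_flatJet_le (k n : ℕ) (f : 𝓢(E, F)) :
    ‖flatJet k n f‖ ≤ SchwartzMap.seminorm ℝ k n f :=
  BoundedContinuousFunction.norm_ofNormedAddCommGroup_le _ (apply_nonneg _ _) _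

theorem norm_le_of_unit_ball {n : ℕ} (M : E [×n]→L[ℝ] F) {C : ℝ} (hC : 0 ≤ C)
    (h : ∀ v : Fin n → Metric.closedBall (0 : E) 1, ‖M fun i => (v i : E)‖ ≤ C) : ‖M‖ ≤ C := by
  refine M.opNorm_le_bound hC fun v => ?_
  have hv : v = fun i => ‖v i‖ • (‖v i‖⁻¹ • v i) := by
    funext i
    rcases eq_or_ne (v i) 0 with hi | hi
    · simp [hi]
    · rw [smul_smul, mul_inv_cancel₀ (norm_ne_zero_iff.2 hi), one_smul]
  have hm : M v = (∏ i, ‖v i‖) • M fun i => ‖v i‖⁻¹ • v i := by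
    conv_lhs => rw [hv]
    exact M.map_smul_univ _ _
  have hb := h fun i => ⟨‖v i‖⁻¹ • v i, by
    rw [mem_closedBall_zero_iff, norm_smul, norm_inv, norm_norm]
    exact inv_mul_le_one⟩
  rw [hm, norm_smul, Real.norm_of_nonneg (Finset.prod_nonneg fun _ _ => norm_nonneg _), mul_comm]
  exact mul_le_mul_of_nonneg_right hb (Finset.prod_nonneg fun _ _ => norm_nonneg _)

theorem seminorm_le_norm_flatJet (k n : ℕ) (f : 𝓢(E, F)) :
    SchwartzMap.seminorm ℝ k n f ≤ ‖flatJet k n f‖ := by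
  refine SchwartzMap.seminorm_le_bound ℝ k n f (norm_nonneg _) fun x => ?_
  have : ‖‖x‖ ^ k • iteratedFDeriv ℝ n f x‖ ≤ ‖flatJet k n f‖ :=
    norm_le_of_unit_ball _ (norm_nonneg _) fun v => (flatJet k n f).norm_coe_le_norm (x, v)
  rwa [norm_smul, norm_pow, norm_norm] at this

/-- The weighted derivatives as a linear map to bounded continuous functions. -/
def flatJetLM (k n : ℕ) : 𝓢(E, F) →ₗ[ℝ]
    BoundedContinuousFunction (E × (Fin n → Metric.closedBall (0 : E) 1)) F where
  toFun := flatJet k n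
  map_add' f g := by
    ext ⟨x, v⟩
    have h : iteratedFDeriv ℝ n (⇑(f + g)) x = iteratedFDeriv ℝ n f x + iteratedFDeriv ℝ n g x :=
      iteratedFDeriv_add_apply (f.smooth n).contDiffAt (g.smooth n).contDiffAt
    rw [BoundedContinuousFunction.add_apply, flatJet_apply, flatJet_apply, flatJet_apply, h,
      add_apply, smul_add]
  map_smul' c f := by
    ext ⟨x, v⟩
    have h : iteratedFDeriv ℝ n (⇑(c • f)) x = c • iteratedFDeriv ℝ n f x :=
      iteratedFDeriv_const_smul_apply (f.smooth n).contDiffAt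
    rw [flatJet_apply, h]
    exact smul_comm _ _ _

theorem continuous_flatJet (k n : ℕ) : Continuous (flatJet k n : 𝓢(E, F) → _) := by
  refine (schwartz_withSeminorms ℝ E F).continuous_of_isBounded
    (norm_withSeminorms ℝ _) (flatJetLM k n) fun _ => ⟨{(k, n)}, 1, fun f => ?_⟩
  simp only [Seminorm.comp_apply, coe_normSeminorm, Finset.sup_singleton, one_smul]
  exact norm_flatJet_le k n f

theorem integrable_flatJet (hγ : Continuous γ) (hi : ∀ k n, Integrable (fun a => sn k n (γ a)) μ)
    (k n : ℕ) : Integrable (fun a => flatJet k n (γ a)) μ := by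
  refine (hi k n).mono' ((continuous_flatJet k n).comp hγ).aestronglyMeasurable ?_
  exact Eventually.of_forall fun a => (norm_flatJet_le k n _).trans (seminorm_le_sn _)

theorem integrable_iteratedFDeriv (hγ : Continuous γ)
    (hi : ∀ k n, Integrable (fun a => sn k n (γ a)) μ) (n : ℕ) (x : E) :
    Integrable (fun a => iteratedFDeriv ℝ n (γ a) x) μ := by
  have hc : Continuous fun a => jet 0 n (γ a) x :=
    (continuous_eval_const x).comp ((continuous_jet 0 n).comp hγ)
  have e : (fun a => iteratedFDeriv ℝ n (γ a) x) = fun a => jet 0 n (γ a) x := by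
    funext a
    simp [jet_apply]
  rw [e]
  refine (hi 0 n).mono' hc.aestronglyMeasurable (Eventually.of_forall fun a => ?_)
  refine ((jet 0 n (γ a)).norm_coe_le_norm x).trans ?_
  rw [norm_jet]
  exact seminorm_le_sn _

/-- Differentiation under the integral, one order at a time; the integrable function `sn 0 (n + 1)
(γ a)` dominates the derivative. -/
theorem iteratedFDeriv_integral (hγ : Continuous γ)
    (hi : ∀ k n, Integrable (fun a => sn k n (γ a)) μ) (n : ℕ) (x : E) :
    iteratedFDeriv ℝ n (fun x => ∫ a, γ a x ∂μ) x = ∫ a, iteratedFDeriv ℝ n (γ a) x ∂μ := by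
  induction n generalizing x with
  | zero =>
    ext v
    rw [iteratedFDeriv_zero_apply]
    have h := (ContinuousMultilinearMap.apply ℝ (fun _ : Fin 0 => E) F v).integral_comp_comm
      (integrable_iteratedFDeriv hγ hi 0 x)
    simp only [ContinuousMultilinearMap.apply_apply, iteratedFDeriv_zero_apply] at h
    rw [h]
  | succ n ih =>
    let e : (E [×(n + 1)]→L[ℝ] F) ≃L[ℝ] (E →L[ℝ] E [×n]→L[ℝ] F) :=
      (continuousMultilinearCurryLeftEquiv ℝ (fun _ : Fin (n + 1) => E) F).toContinuousLinearEquiv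
    have he : ∀ M, ‖e M‖ = ‖M‖ :=
      (continuousMultilinearCurryLeftEquiv ℝ (fun _ : Fin (n + 1) => E) F).norm_map
    have e1 : ∀ a x, fderiv ℝ (iteratedFDeriv ℝ n (γ a)) x = e (iteratedFDeriv ℝ (n + 1) (γ a) x) :=
      fun a x => congrFun (fderiv_iteratedFDeriv (𝕜 := ℝ) (f := γ a) (n := n)) x
    have h1 : HasFDerivAt (fun x => ∫ a, iteratedFDeriv ℝ n (γ a) x ∂μ)
        (∫ a, e (iteratedFDeriv ℝ (n + 1) (γ a) x) ∂μ) x := by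
      refine hasFDerivAt_integral_of_dominated_of_fderiv_le (𝕜 := ℝ) (s := Set.univ)
        (bound := fun a => sn 0 (n + 1) (γ a)) (F := fun x a => iteratedFDeriv ℝ n (γ a) x)
        (F' := fun x a => e (iteratedFDeriv ℝ (n + 1) (γ a) x)) univ_mem
        (Eventually.of_forall fun y => (integrable_iteratedFDeriv hγ hi n y).1)
        (integrable_iteratedFDeriv hγ hi n x)
        (e.continuous.comp_aestronglyMeasurable (integrable_iteratedFDeriv hγ hi (n + 1) x).1)
        (Eventually.of_forall fun a y _ => ?_) (hi 0 (n + 1))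
        (Eventually.of_forall fun a y _ => ?_)
      · rw [he]
        refine le_trans ?_ (seminorm_le_sn _)
        simpa using SchwartzMap.le_seminorm ℝ 0 (n + 1) (γ a) y
      · rw [← e1]
        exact (((γ a).smooth (n + 1 : ℕ)).differentiable_iteratedFDeriv
          (by exact_mod_cast Nat.lt_succ_self n)).differentiableAt.hasFDerivAt
    have h2 : iteratedFDeriv ℝ n (fun x => ∫ a, γ a x ∂μ) =
        fun x => ∫ a, iteratedFDeriv ℝ n (γ a) x ∂μ := funext fun x => ih x
    rw [iteratedFDeriv_succ_eq_comp_left, Function.comp_apply, h2, h1.fderiv]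
    have h3 := ContinuousLinearMap.integral_comp_comm (𝕜 := ℝ)
      (Fₗ := E →L[ℝ] E [×n]→L[ℝ] F) e.toContinuousLinearMap
      (integrable_iteratedFDeriv hγ hi (n + 1) x)
    have h4 : ∫ a, e (iteratedFDeriv ℝ (n + 1) (γ a) x) ∂μ =
        e (∫ a, iteratedFDeriv ℝ (n + 1) (γ a) x ∂μ) := h3
    rw [h4]
    exact e.symm_apply_apply _

theorem flatJet_integral (hγ : Continuous γ) (hi : ∀ k n, Integrable (fun a => sn k n (γ a)) μ)
    {f : 𝓢(E, F)} (hf : ∀ x, f x = ∫ a, γ a x ∂μ) (k n : ℕ) :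
    ∫ a, flatJet k n (γ a) ∂μ = flatJet k n f := by
  ext ⟨x, v⟩
  have hf' : (f : E → F) = fun x => ∫ a, γ a x ∂μ := funext hf
  have h1 := (BoundedContinuousFunction.evalCLM (β := F) ℝ (x, v)).integral_comp_comm
    (integrable_flatJet hγ hi k n)
  have h2 := (ContinuousMultilinearMap.apply ℝ (fun _ : Fin n => E) F
    fun i => (v i : E)).integral_comp_comm (integrable_iteratedFDeriv hγ hi n x)
  simp only [ContinuousMultilinearMap.apply_apply] at h2
  rw [flatJet_apply, hf', iteratedFDeriv_integral hγ hi, ← h2, ← integral_smul]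
  exact h1.symm

/-- Continuous linear functionals commute with integrals of functions with values in a Schwartz
space. -/
theorem clm_real_integral (T : 𝓢(E, F) →L[ℝ] ℝ) (hγ : Continuous γ)
    (hi : ∀ k n, Integrable (fun a => sn k n (γ a)) μ)
    {f : 𝓢(E, F)} (hf : ∀ x, f x = ∫ a, γ a x ∂μ) : T f = ∫ a, T (γ a) ∂μ := by
  obtain ⟨s, C, -, hs⟩ := Seminorm.bound_of_continuous (schwartz_withSeminorms ℝ E F)
    ((normSeminorm ℝ ℝ).comp T.toLinearMap) (continuous_norm.comp T.continuous)
  -- T is bounded by finitely many seminorms, so it factors through J, which maps to a finite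
  -- product of Banach spaces. Hahn–Banach extends the factor from the range of J to the whole
  -- product, where functionals commute with Bochner integrals.
  let J : 𝓢(E, F) →ₗ[ℝ] (∀ i : s, BoundedContinuousFunction (E × (Fin i.1.2 → Metric.closedBall (0 : E) 1)) F) :=
    LinearMap.pi fun i => flatJetLM i.1.1 i.1.2
  have hJ : ∀ u, ‖T u‖ ≤ C * ‖J u‖ := by
    intro u
    refine (hs u).trans (mul_le_mul_of_nonneg_left ?_ C.2)
    refine Seminorm.finset_sup_apply_le (norm_nonneg _) fun i hi => ?_
    have := norm_le_pi_norm (J u) ⟨i, hi⟩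
    exact (seminorm_le_norm_flatJet i.1 i.2 u).trans this
  have hker : LinearMap.ker J ≤ LinearMap.ker T.toLinearMap := by
    intro u hu
    rw [LinearMap.mem_ker] at hu ⊢
    have := hJ u
    rw [hu, norm_zero, mul_zero] at this
    exact norm_le_zero_iff.1 this
  let T₁ : LinearMap.range J →ₗ[ℝ] ℝ :=
    ((LinearMap.ker J).liftQ T.toLinearMap hker) ∘ₗ J.quotKerEquivRange.symm.toLinearMap
  have hT₁ : ∀ u, T₁ ⟨J u, LinearMap.mem_range_self J u⟩ = T u := by
    intro u
    have : J.quotKerEquivRange.symm ⟨J u, LinearMap.mem_range_self J u⟩ =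
        (LinearMap.ker J).mkQ u := by
      rw [LinearEquiv.symm_apply_eq]
      rfl
    simp only [T₁, LinearMap.comp_apply, LinearEquiv.coe_coe, this]
    rfl
  let T₂ : StrongDual ℝ (LinearMap.range J) := T₁.mkContinuous C <| by
    rintro ⟨-, u, rfl⟩
    rw [hT₁]
    exact hJ u
  obtain ⟨T₃, hT₃, -⟩ := exists_extension_norm_eq (LinearMap.range J) T₂
  have hT : ∀ u, T₃ (J u) = T u := fun u =>
    (hT₃ ⟨J u, LinearMap.mem_range_self J u⟩).trans (hT₁ u)
  have hint : Integrable (fun a => J (γ a)) μ :=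
    Integrable.of_eval fun i => integrable_flatJet hγ hi i.1.1 i.1.2
  have hI : ∫ a, J (γ a) ∂μ = J f := by
    funext i
    have := (ContinuousLinearMap.proj (R := ℝ) (φ := fun i : s => BoundedContinuousFunction (E × (Fin i.1.2 → Metric.closedBall (0 : E) 1)) F)
      i).integral_comp_comm hint
    refine this.symm.trans ?_
    exact flatJet_integral hγ hi hf i.1.1 i.1.2
  rw [← hT f, ← hI, ← T₃.integral_comp_comm hint]
  simp only [hT]

/-- Real functionals separate the points of H, so the scalar case suffices. -/
theorem clm_integral {H : Type*} [NormedAddCommGroup H] [NormedSpace ℂ H] [CompleteSpace H]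
    (T : 𝓢(E, F) →L[ℂ] H) (hγ : Continuous γ)
    (hi : ∀ k n, Integrable (fun a => sn k n (γ a)) μ)
    {f : 𝓢(E, F)} (hf : ∀ x, f x = ∫ a, γ a x ∂μ) :
    Integrable (fun a => T (γ a)) μ ∧ T f = ∫ a, T (γ a) ∂μ := by
  have hint : Integrable (fun a => T (γ a)) μ := by
    obtain ⟨k, n, C, hC, h⟩ := exists_sn_bound_clm T
    exact ((hi k n).const_mul C).mono' (T.continuous.comp hγ).aestronglyMeasurable
      (Eventually.of_forall fun a => h _)
  refine ⟨hint, (SeparatingDual.eq_iff_forall_dual_eq (R := ℝ)).2 fun g => ?_⟩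
  rw [← g.integral_comp_comm hint]
  exact clm_real_integral (g ∘L T.restrictScalars ℝ) hγ hi hf

end Integrals

/-! ### Tensor products along an orthogonal splitting -/

section Tensor

variable {X X₁ X₂ : Type*} [NormedAddCommGroup X] [InnerProductSpace ℝ X]
  [NormedAddCommGroup X₁] [InnerProductSpace ℝ X₁] [NormedAddCommGroup X₂] [InnerProductSpace ℝ X₂]
  (e : X ≃ₗᵢ[ℝ] WithLp 2 (X₁ × X₂))

/-- The first component with respect to a splitting. -/
def pr1 : X →L[ℝ] X₁ :=
  ContinuousLinearMap.fst ℝ X₁ X₂ ∘L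
    (WithLp.prodContinuousLinearEquiv 2 ℝ X₁ X₂ : WithLp 2 (X₁ × X₂) →L[ℝ] X₁ × X₂) ∘L
    (e.toContinuousLinearEquiv : X →L[ℝ] WithLp 2 (X₁ × X₂))

/-- The second component with respect to a splitting. -/
def pr2 : X →L[ℝ] X₂ :=
  ContinuousLinearMap.snd ℝ X₁ X₂ ∘L
    (WithLp.prodContinuousLinearEquiv 2 ℝ X₁ X₂ : WithLp 2 (X₁ × X₂) →L[ℝ] X₁ × X₂) ∘L
    (e.toContinuousLinearEquiv : X →L[ℝ] WithLp 2 (X₁ × X₂))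

/-- The point with given components. -/
def glue (a : X₁) (b : X₂) : X := e.symm (WithLp.toLp 2 (a, b))

theorem pr1_apply (x : X) : pr1 e x = (e x).fst := rfl

theorem pr2_apply (x : X) : pr2 e x = (e x).snd := rfl

@[simp]
theorem pr1_glue (a : X₁) (b : X₂) : pr1 e (glue e a b) = a := by simp [pr1_apply, glue]

@[simp]
theorem pr2_glue (a : X₁) (b : X₂) : pr2 e (glue e a b) = b := by simp [pr2_apply, glue]

theorem inner_split (x y : X) :
    ⟪x, y⟫_ℝ = ⟪pr1 e x, pr1 e y⟫_ℝ + ⟪pr2 e x, pr2 e y⟫_ℝ := by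
  rw [← e.inner_map_map, WithLp.prod_inner_apply]
  rfl

theorem norm_sq_split (x : X) : ‖x‖ ^ 2 = ‖pr1 e x‖ ^ 2 + ‖pr2 e x‖ ^ 2 := by
  rw [← e.norm_map, WithLp.prod_norm_sq_eq_of_L2]
  rfl

theorem norm_pr1_le (x : X) : ‖pr1 e x‖ ≤ ‖x‖ := by
  rw [← sq_le_sq₀ (norm_nonneg _) (norm_nonneg _), norm_sq_split e x]
  exact le_add_of_nonneg_right (sq_nonneg _)

theorem norm_pr2_le (x : X) : ‖pr2 e x‖ ≤ ‖x‖ := by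
  rw [← sq_le_sq₀ (norm_nonneg _) (norm_nonneg _), norm_sq_split e x]
  exact le_add_of_nonneg_left (sq_nonneg _)

theorem one_add_norm_split_le (x : X) : 1 + ‖x‖ ≤ (1 + ‖pr1 e x‖) * (1 + ‖pr2 e x‖) := by
  have h := norm_sq_split e x
  have : ‖x‖ ≤ ‖pr1 e x‖ + ‖pr2 e x‖ := by
    refine abs_le_of_sq_le_sq' ?_ (by positivity) |>.2
    nlinarith [norm_nonneg (pr1 e x), norm_nonneg (pr2 e x)]
  nlinarith [mul_nonneg (norm_nonneg (pr1 e x)) (norm_nonneg (pr2 e x))]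

theorem norm_iteratedFDeriv_comp_le {V W : Type*} [NormedAddCommGroup V] [NormedSpace ℝ V]
    [NormedAddCommGroup W] [NormedSpace ℝ W] (L : V →L[ℝ] W) (hL : ∀ x, ‖L x‖ ≤ ‖x‖)
    (f : 𝓢(W, ℂ)) (i : ℕ) (x : V) :
    ‖iteratedFDeriv ℝ i (fun x => f (L x)) x‖ ≤ ‖iteratedFDeriv ℝ i f (L x)‖ := by
  have h : iteratedFDeriv ℝ i (fun x => f (L x)) x =
      (iteratedFDeriv ℝ i f (L x)).compContinuousLinearMap fun _ => L :=
    L.iteratedFDeriv_comp_right (f.smooth i) x le_rfl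
  rw [h]
  refine (ContinuousMultilinearMap.norm_compContinuousLinearMap_le _ _).trans ?_
  refine mul_le_of_le_one_right (norm_nonneg _)
    (Finset.prod_le_one (fun _ _ => norm_nonneg _) fun _ _ => ?_)
  exact ContinuousLinearMap.opNorm_le_bound _ zero_le_one fun x => by simpa using hL x

theorem tens_estimate (f : 𝓢(X₁, ℂ)) (g : 𝓢(X₂, ℂ)) {k n k' n' : ℕ} (hk : k' ≤ k) (hn : n' ≤ n)
    (x : X) : ‖x‖ ^ k' * ‖iteratedFDeriv ℝ n' (fun x => f (pr1 e x) * g (pr2 e x)) x‖ ≤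
      2 ^ n * (2 ^ k * sn k n f) * (2 ^ k * sn k n g) := by
  have hf : ContDiff ℝ (⊤ : ℕ∞) fun x => f (pr1 e x) := (f.smooth ⊤).comp (pr1 e).contDiff
  have hg : ContDiff ℝ (⊤ : ℕ∞) fun x => g (pr2 e x) := (g.smooth ⊤).comp (pr2 e).contDiff
  have h := norm_iteratedFDeriv_mul_le (𝕜 := ℝ) hf hg x (n := n') (mod_cast le_top)
  have hx : ‖x‖ ^ k' ≤ (1 + ‖pr1 e x‖) ^ k * (1 + ‖pr2 e x‖) ^ k := by
    rw [← mul_pow]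
    calc ‖x‖ ^ k' ≤ (1 + ‖x‖) ^ k' := by gcongr; linarith
      _ ≤ (1 + ‖x‖) ^ k := pow_le_pow_right₀ (by linarith [norm_nonneg x]) hk
      _ ≤ _ := by gcongr; exact one_add_norm_split_le e x
  have hS : 0 ≤ sn k n f := apply_nonneg _ _
  have hS' : 0 ≤ sn k n g := apply_nonneg _ _
  calc _ ≤ ((1 + ‖pr1 e x‖) ^ k * (1 + ‖pr2 e x‖) ^ k) *
        ∑ i ∈ Finset.range (n' + 1), (n'.choose i : ℝ) *
          ‖iteratedFDeriv ℝ i (fun x => f (pr1 e x)) x‖ *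
          ‖iteratedFDeriv ℝ (n' - i) (fun x => g (pr2 e x)) x‖ := by gcongr
    _ ≤ ∑ i ∈ Finset.range (n' + 1), (n'.choose i : ℝ) *
        ((2 ^ k * sn k n f) * (2 ^ k * sn k n g)) := by
        rw [Finset.mul_sum]
        refine Finset.sum_le_sum fun i hi => ?_
        have hi' : i ≤ n := (Nat.lt_succ_iff.1 (Finset.mem_range.1 hi)).trans hn
        have h1 := le_sn (le_refl k) hi' f (pr1 e x)
        have h2 := le_sn (le_refl k) ((Nat.sub_le n' i).trans hn) g (pr2 e x)
        have h3 := norm_iteratedFDeriv_comp_le (pr1 e) (norm_pr1_le e) f i x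
        have h4 := norm_iteratedFDeriv_comp_le (pr2 e) (norm_pr2_le e) g (n' - i) x
        calc _ ≤ ((1 + ‖pr1 e x‖) ^ k * (1 + ‖pr2 e x‖) ^ k) * ((n'.choose i : ℝ) *
              ‖iteratedFDeriv ℝ i f (pr1 e x)‖ * ‖iteratedFDeriv ℝ (n' - i) g (pr2 e x)‖) := by
              gcongr
          _ = (n'.choose i : ℝ) * (((1 + ‖pr1 e x‖) ^ k * ‖iteratedFDeriv ℝ i f (pr1 e x)‖) *
              ((1 + ‖pr2 e x‖) ^ k * ‖iteratedFDeriv ℝ (n' - i) g (pr2 e x)‖)) := by ring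
          _ ≤ _ := by gcongr
    _ = 2 ^ n' * ((2 ^ k * sn k n f) * (2 ^ k * sn k n g)) := by
        rw [← Finset.sum_mul]
        congr 1
        exact_mod_cast Nat.sum_range_choose n'
    _ ≤ 2 ^ n * ((2 ^ k * sn k n f) * (2 ^ k * sn k n g)) := by
        gcongr
        norm_num
    _ = _ := by ring

/-- The tensor product of scalar test functions. -/
def tens (f : 𝓢(X₁, ℂ)) (g : 𝓢(X₂, ℂ)) : 𝓢(X, ℂ) where
  toFun x := f (pr1 e x) * g (pr2 e x)
  smooth' := ((f.smooth ⊤).comp (pr1 e).contDiff).mul ((g.smooth ⊤).comp (pr2 e).contDiff)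
  decay' _ _ := ⟨_, fun x => tens_estimate e f g le_rfl le_rfl x⟩

theorem tens_apply (f : 𝓢(X₁, ℂ)) (g : 𝓢(X₂, ℂ)) (x : X) :
    tens e f g x = f (pr1 e x) * g (pr2 e x) := rfl

theorem sn_tens_le (k n : ℕ) (f : 𝓢(X₁, ℂ)) (g : 𝓢(X₂, ℂ)) :
    sn k n (tens e f g) ≤ 2 ^ n * (2 ^ k * sn k n f) * (2 ^ k * sn k n g) := by
  have hS : 0 ≤ sn k n f := apply_nonneg _ _
  have hS' : 0 ≤ sn k n g := apply_nonneg _ _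
  exact sn_le (by positivity) fun k' hk n' hn x => tens_estimate e f g hk hn x

/-- The tensor product as a bilinear map. -/
def tensLM : 𝓢(X₁, ℂ) →ₗ[ℂ] 𝓢(X₂, ℂ) →ₗ[ℂ] 𝓢(X, ℂ) :=
  LinearMap.mk₂ ℂ (tens e) (fun f f' g => by ext x; exact add_mul _ _ _)
    (fun c f g => by ext x; exact mul_assoc _ _ _) (fun f g g' => by ext x; exact mul_add _ _ _)
    (fun c f g => by ext x; exact mul_left_comm _ _ _)

/-- The tensor product with a fixed first factor. -/
def tensR (f : 𝓢(X₁, ℂ)) : 𝓢(X₂, ℂ) →L[ℂ] 𝓢(X, ℂ) where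
  toLinearMap := tensLM e f
  cont := continuous_of_sn_bound (tensLM e f) fun k n =>
    ⟨k, n, 2 ^ n * (2 ^ k * sn k n f) * 2 ^ k, fun g => by
      rw [mul_assoc]; exact sn_tens_le e k n f g⟩

/-- The tensor product with a fixed second factor. -/
def tensL (g : 𝓢(X₂, ℂ)) : 𝓢(X₁, ℂ) →L[ℂ] 𝓢(X, ℂ) where
  toLinearMap := (tensLM e).flip g
  cont := continuous_of_sn_bound ((tensLM e).flip g) fun k n =>
    ⟨k, n, 2 ^ n * 2 ^ k * (2 ^ k * sn k n g), fun f => (sn_tens_le e k n f g).trans (by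
      apply le_of_eq; ring)⟩

@[simp]
theorem tensR_apply (f : 𝓢(X₁, ℂ)) (g : 𝓢(X₂, ℂ)) : tensR e f g = tens e f g := rfl

@[simp]
theorem tensL_apply (f : 𝓢(X₁, ℂ)) (g : 𝓢(X₂, ℂ)) : tensL e g f = tens e f g := rfl

theorem trans_tens (y : X) (f : 𝓢(X₁, ℂ)) (g : 𝓢(X₂, ℂ)) :
    trans y (tens e f g) = tens e (trans (pr1 e y) f) (trans (pr2 e y) g) := by
  ext x
  simp [tens_apply]

variable [FiniteDimensional ℝ X] [MeasurableSpace X] [BorelSpace X]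
  [FiniteDimensional ℝ X₁] [MeasurableSpace X₁] [BorelSpace X₁]
  [FiniteDimensional ℝ X₂] [MeasurableSpace X₂] [BorelSpace X₂]

/-- The isometry e preserves Lebesgue measure, which leaves Fubini on X₁ × X₂. -/
theorem integral_split (F : X₁ → ℂ) (G : X₂ → ℂ) :
    ∫ x : X, F (pr1 e x) * G (pr2 e x) = (∫ x, F x) * ∫ x, G x := by
  rw [← integral_prod_mul]
  have h2 := (WithLp.volume_preserving_ofLp X₁ X₂).integral_comp
    (MeasurableEquiv.toLp 2 (X₁ × X₂)).symm.measurableEmbedding (fun z => F z.1 * G z.2)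
  have h1 := e.measurePreserving.integral_comp e.toHomeomorph.measurableEmbedding
    (fun z : WithLp 2 (X₁ × X₂) => F z.fst * G z.snd)
  exact h1.trans h2

theorem fourier_tens (f : 𝓢(X₁, ℂ)) (g : 𝓢(X₂, ℂ)) :
    𝓕 (tens e f g) = tens e (𝓕 f) (𝓕 g) := by
  ext ξ
  rw [tens_apply]
  simp only [SchwartzMap.fourier_coe, Real.fourier_eq']
  rw [← integral_split e]
  congr 1
  funext x
  rw [inner_split e x ξ, tens_apply, smul_eq_mul, smul_eq_mul, smul_eq_mul, mul_mul_mul_comm,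
    ← Complex.exp_add]
  congr 2
  push_cast
  ring

end Tensor

/-! ### Time-frequency decomposition of test functions -/

section Gabor

variable {V : Type*} [NormedAddCommGroup V] [InnerProductSpace ℝ V] [FiniteDimensional ℝ V]
  [MeasurableSpace V] [BorelSpace V]

/-- Time-frequency shifts `x ↦ exp(2π i ⟪ξ, x⟫) h(x - y)` of a window, `a = (y, ξ)`. -/
def atom (h : 𝓢(V, ℂ)) (a : V × V) : 𝓢(V, ℂ) := famMul ℂ expFun a.2 (trans a.1 h)

theorem atom_apply (h : 𝓢(V, ℂ)) (a : V × V) (x : V) :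
    atom h a x = expFun (a.2, x) * h (x - a.1) := by
  rw [atom, famMul_apply expFun_hasTemperateGrowth, trans_apply, smul_eq_mul]

theorem continuous_atom (h : 𝓢(V, ℂ)) : Continuous (atom h) := by
  have h1 : Continuous fun a : V × V => trans a.1 h :=
    continuous_trans.comp (continuous_fst.prodMk continuous_const)
  exact (continuous_famMul expFun_hasTemperateGrowth).comp (continuous_snd.prodMk h1)

/-- The weight `(1 + ‖y‖) (1 + ‖ξ‖)`. -/
def wt (a : V × V) : ℝ := (1 + ‖a.1‖) * (1 + ‖a.2‖)

theorem one_le_wt (a : V × V) : 1 ≤ wt a :=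
  one_le_mul_of_one_le_of_one_le (le_add_of_nonneg_right (norm_nonneg _))
    (le_add_of_nonneg_right (norm_nonneg _))

theorem wt_pos (a : V × V) : 0 < wt a := zero_lt_one.trans_le (one_le_wt a)

/-- Polynomial growth in a is harmless: the rapid decay in `coef_bound` beats it, so superpositions
of atoms converge in every seminorm. -/
theorem atom_bound (h : 𝓢(V, ℂ)) (k n : ℕ) :
    ∃ (N : ℕ) (C : ℝ), 0 ≤ C ∧ ∀ a, sn k n (atom h a) ≤ C * wt a ^ N := by
  obtain ⟨N1, k1, C1, hC1, h1⟩ := famMul_bound (F := ℂ) (expFun_hasTemperateGrowth (V := V)) k n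
  obtain ⟨N2, k2, n2, C2, hC2, h2⟩ := trans_bound (V := V) (F := ℂ) k1 n
  have hS : 0 ≤ sn k2 n2 h := apply_nonneg _ _
  refine ⟨N1 + N2, C1 * (C2 * sn k2 n2 h), by positivity, fun a => ?_⟩
  refine (h1 a.2 _).trans ?_
  have hy : (1 : ℝ) ≤ 1 + ‖a.1‖ := le_add_of_nonneg_right (norm_nonneg _)
  have hξ : (1 : ℝ) ≤ 1 + ‖a.2‖ := le_add_of_nonneg_right (norm_nonneg _)
  calc _ ≤ C1 * (1 + ‖a.2‖) ^ N1 * (C2 * (1 + ‖a.1‖) ^ N2 * sn k2 n2 h) := by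
        gcongr; exact h2 _ _
    _ ≤ C1 * (1 + ‖a.2‖) ^ (N1 + N2) * (C2 * (1 + ‖a.1‖) ^ (N1 + N2) * sn k2 n2 h) := by
        gcongr <;> lia
    _ = _ := by rw [wt, mul_pow]; ring

/-- The function `(y, x) ↦ g(x - y)`. -/
def winFun (g : 𝓢(V, ℂ)) (p : V × V) : ℂ := g (p.2 - p.1)

theorem winFun_hasTemperateGrowth (g : 𝓢(V, ℂ)) : (winFun g).HasTemperateGrowth :=
  g.hasTemperateGrowth.comp
    (ContinuousLinearMap.snd ℝ V V - ContinuousLinearMap.fst ℝ V V).hasTemperateGrowth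

/-- The short-time Fourier transform. -/
def coef (g f : 𝓢(V, ℂ)) (a : V × V) : ℂ := 𝓕 (famMul ℂ (winFun g) a.1 f) a.2

theorem continuous_eval_schwartz {E F : Type*} [NormedAddCommGroup E] [NormedSpace ℝ E]
    [NormedAddCommGroup F] [NormedSpace ℂ F] : Continuous fun p : 𝓢(E, F) × E => p.1 p.2 := by
  have h1 : Continuous fun p : 𝓢(E, F) × E =>
      (SchwartzMap.toBoundedContinuousFunctionCLM ℂ E F p.1, p.2) :=
    ((SchwartzMap.toBoundedContinuousFunctionCLM ℂ E F).continuous.comp continuous_fst).prodMk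
      continuous_snd
  exact (continuous_eval (F := BoundedContinuousFunction E F)).comp h1

theorem continuous_coef (g f : 𝓢(V, ℂ)) : Continuous (coef g f) := by
  have h1 : Continuous fun a : V × V => famMul ℂ (winFun g) a.1 f :=
    (continuous_famMul (winFun_hasTemperateGrowth g)).comp
      (continuous_fst.prodMk continuous_const)
  have h2 : Continuous fun a : V × V => 𝓕 (famMul ℂ (winFun g) a.1 f) :=
    (FourierTransform.fourierCLM ℂ 𝓢(V, ℂ)).continuous.comp h1
  exact continuous_eval_schwartz.comp (h2.prodMk continuous_snd)

theorem coef_add (g f f' : 𝓢(V, ℂ)) (a : V × V) : coef g (f + f') a = coef g f a + coef g f' a := by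
  rw [coef, map_add, FourierTransform.fourier_add]
  rfl

theorem coef_smul (g f : 𝓢(V, ℂ)) (c : ℂ) (a : V × V) : coef g (c • f) a = c * coef g f a := by
  rw [coef, map_smul, FourierTransform.fourier_smul]
  rfl

/-- The inequality 1 + ‖y‖ ≤ (1 + ‖x‖)(1 + ‖x - y‖) trades decay of the window for decay in y, at
the price of a power of 1 + ‖x‖ that the test function absorbs. -/
theorem winFun_slice_bound (g : 𝓢(V, ℂ)) (N n : ℕ) {i : ℕ} (hi : i ≤ n) (y x : V) :
    ‖iteratedFDeriv ℝ i (fun x => winFun g (y, x)) x‖ ≤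
      2 ^ N * sn N n g * ((1 + ‖y‖) ^ N)⁻¹ * (1 + ‖x‖) ^ N := by
  have e : (fun x => winFun g (y, x)) = fun x => g (x + -y) := by
    funext x; simp [winFun, sub_eq_add_neg]
  rw [e, iteratedFDeriv_comp_add_right]
  have h := le_sn (le_refl N) hi g (x + -y)
  have hy : 1 + ‖y‖ ≤ (1 + ‖x‖) * (1 + ‖x + -y‖) := by
    have : ‖y‖ ≤ ‖x‖ + ‖x + -y‖ := by
      calc ‖y‖ = ‖x - (x + -y)‖ := by congr 1; abel
        _ ≤ _ := norm_sub_le _ _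
    nlinarith [mul_nonneg (norm_nonneg x) (norm_nonneg (x + -y))]
  have hyN : (1 + ‖y‖) ^ N ≤ (1 + ‖x‖) ^ N * (1 + ‖x + -y‖) ^ N := by
    rw [← mul_pow]; gcongr
  have hpos : 0 < (1 + ‖y‖) ^ N := by positivity
  rw [mul_assoc, mul_comm _⁻¹, ← div_eq_mul_inv, ← mul_div_assoc, le_div_iff₀ hpos]
  calc _ ≤ ‖iteratedFDeriv ℝ i g (x + -y)‖ * ((1 + ‖x‖) ^ N * (1 + ‖x + -y‖) ^ N) := by gcongr
    _ = ((1 + ‖x + -y‖) ^ N * ‖iteratedFDeriv ℝ i g (x + -y)‖) * (1 + ‖x‖) ^ N := by ring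
    _ ≤ _ := by gcongr

/-- Decay in y comes from the window, decay in ξ from the Fourier transform being a Schwartz
function. -/
theorem coef_bound (g : 𝓢(V, ℂ)) (N : ℕ) :
    ∃ (k n : ℕ) (C : ℝ), 0 ≤ C ∧ ∀ f a, ‖coef g f a‖ ≤ C * sn k n f * (wt a ^ N)⁻¹ := by
  obtain ⟨k1, n1, C1, hC1, h1⟩ :=
    exists_sn_bound_map (FourierTransform.fourierCLM ℂ 𝓢(V, ℂ)) N 0
  have hg : 0 ≤ sn N n1 g := apply_nonneg _ _
  refine ⟨k1 + N, n1, 2 ^ N * (C1 * (2 ^ N * sn N n1 g * (2 ^ n1 * 2 ^ (k1 + N)))), by positivity,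
    fun f a => ?_⟩
  have hw : 0 < wt a ^ N := pow_pos (wt_pos a) N
  rw [← div_eq_mul_inv, le_div_iff₀ hw]
  set u := famMul ℂ (winFun g) a.1 f
  have h2 : (1 + ‖a.2‖) ^ N * ‖𝓕 u a.2‖ ≤ 2 ^ N * sn N 0 (𝓕 u) := by
    have := le_sn (le_refl N) (le_refl 0) (𝓕 u) a.2
    rwa [norm_iteratedFDeriv_zero] at this
  have h3 : sn k1 n1 u ≤ 2 ^ N * sn N n1 g * ((1 + ‖a.1‖) ^ N)⁻¹ * (2 ^ n1 * 2 ^ (k1 + N)) *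
      sn (k1 + N) n1 f :=
    sn_smul_le (by positivity)
      (slice_hasTemperateGrowth (winFun_hasTemperateGrowth g) a.1).1
      (fun i hi x => winFun_slice_bound g N n1 hi a.1 x)
      (famMul_apply (winFun_hasTemperateGrowth g) a.1 f)
  have hf : 0 ≤ sn (k1 + N) n1 f := apply_nonneg _ _
  calc ‖coef g f a‖ * wt a ^ N = (1 + ‖a.1‖) ^ N * ((1 + ‖a.2‖) ^ N * ‖𝓕 u a.2‖) := by
        rw [wt, mul_pow, coef]; ring
    _ ≤ (1 + ‖a.1‖) ^ N * (2 ^ N * (C1 * sn k1 n1 u)) := by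
        refine mul_le_mul_of_nonneg_left (h2.trans ?_) (by positivity)
        exact mul_le_mul_of_nonneg_left (h1 u) (by positivity)
    _ ≤ (1 + ‖a.1‖) ^ N * (2 ^ N * (C1 * (2 ^ N * sn N n1 g * ((1 + ‖a.1‖) ^ N)⁻¹ *
        (2 ^ n1 * 2 ^ (k1 + N)) * sn (k1 + N) n1 f))) := by gcongr
    _ = _ := by
        have : (1 + ‖a.1‖) ^ N ≠ 0 := by positivity
        field_simp

theorem integrable_inv_one_add_norm_pow {N : ℕ} (hN : Module.finrank ℝ V < N) :
    Integrable fun x : V => ((1 + ‖x‖) ^ N)⁻¹ := by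
  have h := integrable_one_add_norm (E := V) (μ := volume) (r := N) (by exact_mod_cast hN)
  refine h.congr (Eventually.of_forall fun x => ?_)
  simp only
  rw [Real.rpow_neg (by positivity), Real.rpow_natCast]

theorem integrable_inv_wt_pow {N : ℕ} (hN : Module.finrank ℝ V < N) :
    Integrable fun a : V × V => (wt a ^ N)⁻¹ := by
  have h := (integrable_inv_one_add_norm_pow hN).mul_prod (integrable_inv_one_add_norm_pow hN)
  refine h.congr (Eventually.of_forall fun a => ?_)
  simp only [wt]
  rw [mul_pow, mul_inv]

theorem integrable_sn_coef_smul_atom (g h f : 𝓢(V, ℂ)) (k n : ℕ) :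
    Integrable fun a : V × V => sn k n (coef g f a • atom h a) := by
  obtain ⟨N, C, hC, hb⟩ := atom_bound h k n
  set d := Module.finrank ℝ V + 1
  obtain ⟨k1, n1, C1, hC1, h1⟩ := coef_bound g (N + d)
  have hf : 0 ≤ sn k1 n1 f := apply_nonneg _ _
  refine ((integrable_inv_wt_pow (V := V) (N := d) (Nat.lt_succ_self _)).const_mul
    (C1 * sn k1 n1 f * C)).mono'
    ((continuous_sn k n).comp ((continuous_coef g f).smul (continuous_atom h))).aestronglyMeasurable
    (Eventually.of_forall fun a => ?_)
  have hw := wt_pos a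
  rw [Real.norm_of_nonneg (apply_nonneg _ _), map_smul_eq_mul]
  calc _ ≤ C1 * sn k1 n1 f * (wt a ^ (N + d))⁻¹ * (C * wt a ^ N) := by
        gcongr
        · exact h1 f a
        · exact hb a
    _ = _ := by
        rw [pow_add]
        field_simp

theorem integral_fourier_mul_expFun (u : 𝓢(V, ℂ)) (x : V) :
    ∫ ξ, 𝓕 u ξ * expFun (ξ, x) = u x := by
  have h : 𝓕⁻ (𝓕 u) = u := FourierTransform.fourierInv_fourier_eq u
  conv_rhs => rw [← h]
  rw [SchwartzMap.fourierInv_coe, Real.fourierInv_eq']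
  congr 1
  funext ξ
  rw [smul_eq_mul, mul_comm]
  congr 1

/-- The ξ-integral is Fourier inversion and gives f(x) g(x - y) h(x - y); the y-integral then
contributes the factor ∫ g h = 1. -/
theorem integral_coef_smul_atom {g h : 𝓢(V, ℂ)} (hgh : ∫ x, g x * h x = 1) (f : 𝓢(V, ℂ)) (x : V) :
    ∫ a : V × V, (coef g f a • atom h a) x = f x := by
  have hint : Integrable (fun a : V × V => (coef g f a • atom h a) x) (volume.prod volume) := by
    refine (integrable_sn_coef_smul_atom g h f 0 0).mono'
      ((continuous_eval_schwartz.comp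
        (((continuous_coef g f).smul (continuous_atom h)).prodMk
          continuous_const)).aestronglyMeasurable)
      (Eventually.of_forall fun a => ?_)
    exact (SchwartzMap.norm_le_seminorm ℝ _ x).trans (seminorm_le_sn _)
  rw [Measure.volume_eq_prod, integral_prod _ hint]
  have h1 : ∀ y, ∫ ξ, (coef g f (y, ξ) • atom h (y, ξ)) x = f x * (g (x - y) * h (x - y)) := by
    intro y
    have : ∀ ξ, (coef g f (y, ξ) • atom h (y, ξ)) x =
        (𝓕 (famMul ℂ (winFun g) y f) ξ * expFun (ξ, x)) * h (x - y) := by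
      intro ξ
      rw [smul_apply, atom_apply, smul_eq_mul, coef, mul_assoc]
    simp only [this]
    rw [integral_mul_const, integral_fourier_mul_expFun,
      famMul_apply (winFun_hasTemperateGrowth g), winFun, smul_eq_mul]
    ring
  simp only [h1]
  rw [integral_const_mul, integral_sub_left_eq_self (fun z => g z * h z) volume x, hgh, mul_one]

/-- The decomposition of a test function into time-frequency shifts of a window. -/
theorem clm_eq_integral_atom {H : Type*} [NormedAddCommGroup H] [NormedSpace ℂ H] [CompleteSpace H]
    {g h : 𝓢(V, ℂ)} (hgh : ∫ x, g x * h x = 1) (T : 𝓢(V, ℂ) →L[ℂ] H) (f : 𝓢(V, ℂ)) :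
    T f = ∫ a : V × V, coef g f a • T (atom h a) := by
  have := (clm_integral (μ := volume) T ((continuous_coef g f).smul (continuous_atom h))
    (integrable_sn_coef_smul_atom g h f)
    (f := f) (fun x => (integral_coef_smul_atom hgh f x).symm)).2
  simpa using this

/-- The shifts of a single window are total. A window that is a tensor product, or one of small
support, turns this into the two density statements needed later. -/
theorem clm_eq_zero_of_atom {H : Type*} [NormedAddCommGroup H] [NormedSpace ℂ H] [CompleteSpace H]
    {g h : 𝓢(V, ℂ)} (hgh : ∫ x, g x * h x = 1) (T : 𝓢(V, ℂ) →L[ℂ] H)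
    (hT : ∀ a, T (atom h a) = 0) : T = 0 := by
  ext f
  rw [clm_eq_integral_atom hgh T f]
  simp [hT]

/-- h is a bump function and g = h / ∫ h². -/
theorem exists_window (V : Type*) [NormedAddCommGroup V] [InnerProductSpace ℝ V]
    [FiniteDimensional ℝ V] [MeasurableSpace V] [BorelSpace V] {r : ℝ} (hr : 0 < r) :
    ∃ g h : 𝓢(V, ℂ), tsupport h ⊆ Metric.closedBall 0 r ∧ ∫ x, g x * h x = 1 := by
  let b : ContDiffBump (0 : V) := ⟨r / 2, r, by positivity, by linarith⟩
  have hb : HasCompactSupport fun x => (b x : ℂ) := by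
    refine b.hasCompactSupport.comp_left (g := fun t : ℝ => (t : ℂ)) (by simp)
  have hs : ContDiff ℝ (⊤ : ℕ∞) fun x => (b x : ℂ) :=
    Complex.ofRealCLM.contDiff.comp b.contDiff
  let h : 𝓢(V, ℂ) := hb.toSchwartzMap hs
  have hh : ∀ x, h x = (b x : ℂ) := fun x => rfl
  have hpos : 0 < ∫ x, b x * b x := by
    rw [integral_pos_iff_support_of_nonneg (fun x => mul_self_nonneg _)]
    · refine lt_of_lt_of_le (Metric.measure_ball_pos volume (0 : V) hr) (measure_mono fun x hx => ?_)
      have : 0 < b x := b.pos_of_mem_ball hx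
      exact (mul_pos this this).ne'
    · exact (b.continuous.mul b.continuous).integrable_of_hasCompactSupport
        (b.hasCompactSupport.mul_left)
  refine ⟨((∫ x, b x * b x : ℝ) : ℂ)⁻¹ • h, h, ?_, ?_⟩
  · have : Function.support h ⊆ Function.support b := by
      intro x hx
      simpa [hh] using hx
    exact (closure_mono this).trans b.tsupport_eq.subset
  · have : ∀ x, (((∫ x, b x * b x : ℝ) : ℂ)⁻¹ • h) x * h x =
        ((∫ x, b x * b x : ℝ) : ℂ)⁻¹ * ((b x * b x : ℝ) : ℂ) := by
      intro x
      rw [smul_apply, hh, smul_eq_mul]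
      push_cast
      ring
    simp only [this]
    rw [integral_const_mul, integral_complex_ofReal]
    exact inv_mul_cancel₀ (by exact_mod_cast hpos.ne')

/-- A continuous linear map that annihilates the test functions with support in small balls
vanishes. -/
theorem clm_eq_zero_of_local {H : Type*} [NormedAddCommGroup H] [NormedSpace ℂ H] [CompleteSpace H]
    (T : 𝓢(V, ℂ) →L[ℂ] H) {r : ℝ} (hr : 0 < r)
    (hT : ∀ (y : V) (f : 𝓢(V, ℂ)), tsupport f ⊆ Metric.closedBall y r → T f = 0) : T = 0 := by
  obtain ⟨g, h, hs, hgh⟩ := exists_window V hr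
  refine clm_eq_zero_of_atom hgh T fun a => hT a.1 _ ?_
  refine closure_minimal (fun x hx => ?_) Metric.isClosed_closedBall
  have hx' : h (x - a.1) ≠ 0 := by
    intro h0
    apply hx
    rw [atom_apply, h0, mul_zero]
  have := hs (subset_tsupport _ hx')
  simpa [dist_eq_norm] using this

end Gabor

/-! ### The kernel theorem -/

section Extension

variable {X X₁ X₂ : Type*} [NormedAddCommGroup X] [InnerProductSpace ℝ X]
  [NormedAddCommGroup X₁] [InnerProductSpace ℝ X₁] [NormedAddCommGroup X₂] [InnerProductSpace ℝ X₂]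
  [FiniteDimensional ℝ X] [MeasurableSpace X] [BorelSpace X]
  [FiniteDimensional ℝ X₁] [MeasurableSpace X₁] [BorelSpace X₁]
  [FiniteDimensional ℝ X₂] [MeasurableSpace X₂] [BorelSpace X₂]
  (e : X ≃ₗᵢ[ℝ] WithLp 2 (X₁ × X₂)) {H : Type*} [NormedAddCommGroup H] [NormedSpace ℂ H]
  [CompleteSpace H]

/-- Together with `coef_tens` this shows that the decomposition with a tensor product window
factorizes. -/
theorem atom_tens (h₁ : 𝓢(X₁, ℂ)) (h₂ : 𝓢(X₂, ℂ)) (a : X × X) :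
    atom (tens e h₁ h₂) a =
      tens e (atom h₁ (pr1 e a.1, pr1 e a.2)) (atom h₂ (pr2 e a.1, pr2 e a.2)) := by
  ext x
  simp only [atom_apply, tens_apply, map_sub]
  have : expFun (a.2, x) = expFun (pr1 e a.2, pr1 e x) * expFun (pr2 e a.2, pr2 e x) := by
    simp only [expFun]
    rw [← Complex.exp_add, inner_split e a.2 x]
    congr 1
    push_cast
    ring
  rw [this]
  ring

theorem integral_tens_mul_tens (g₁ h₁ : 𝓢(X₁, ℂ)) (g₂ h₂ : 𝓢(X₂, ℂ)) :
    ∫ x, tens e g₁ g₂ x * tens e h₁ h₂ x = (∫ x, g₁ x * h₁ x) * ∫ x, g₂ x * h₂ x := by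
  rw [← integral_split e]
  congr 1
  funext x
  rw [tens_apply, tens_apply]
  ring

/-- A continuous linear map that annihilates all tensor products vanishes. -/
theorem clm_eq_zero_of_tens (T : 𝓢(X, ℂ) →L[ℂ] H) (hT : ∀ f g, T (tens e f g) = 0) : T = 0 := by
  obtain ⟨g₁, h₁, -, H1⟩ := exists_window X₁ one_pos
  obtain ⟨g₂, h₂, -, H2⟩ := exists_window X₂ one_pos
  refine clm_eq_zero_of_atom (g := tens e g₁ g₂) (h := tens e h₁ h₂) ?_ T fun a => ?_
  · rw [integral_tens_mul_tens, H1, H2, one_mul]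
  · rw [atom_tens, hT]

theorem clm_ext_tens {S T : 𝓢(X, ℂ) →L[ℂ] H} (hT : ∀ f g, S (tens e f g) = T (tens e f g)) :
    S = T :=
  sub_eq_zero.1 (clm_eq_zero_of_tens e (S - T) fun f g => by
    rw [sub_apply, hT, sub_self])

theorem coef_tens (g₁ f₁ : 𝓢(X₁, ℂ)) (g₂ f₂ : 𝓢(X₂, ℂ)) (a : X₁ × X₁) (b : X₂ × X₂) :
    coef (tens e g₁ g₂) (tens e f₁ f₂) (glue e a.1 b.1, glue e a.2 b.2) =
      coef g₁ f₁ a * coef g₂ f₂ b := by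
  have h : famMul ℂ (winFun (tens e g₁ g₂)) (glue e a.1 b.1) (tens e f₁ f₂) =
      tens e (famMul ℂ (winFun g₁) a.1 f₁) (famMul ℂ (winFun g₂) b.1 f₂) := by
    ext x
    rw [tens_apply]
    simp only [famMul_apply (winFun_hasTemperateGrowth _), winFun, tens_apply, map_sub, pr1_glue,
      pr2_glue, smul_eq_mul]
    ring
  simp only [coef, h, fourier_tens, tens_apply, pr1_glue, pr2_glue]

/-- Decay in the weight of the joint variable becomes decay in both weights; the square is the
reason for the order 2 * D in `exists_clm_tens`. -/
theorem wt_mul_wt_le (a : X₁ × X₁) (b : X₂ × X₂) :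
    wt a * wt b ≤ wt (glue e a.1 b.1, glue e a.2 b.2) ^ 2 := by
  have h : ∀ (x : X₁) (y : X₂), (1 + ‖x‖) * (1 + ‖y‖) ≤ (1 + ‖glue e x y‖) ^ 2 := by
    intro x y
    have h1 := norm_pr1_le e (glue e x y)
    have h2 := norm_pr2_le e (glue e x y)
    rw [pr1_glue] at h1
    rw [pr2_glue] at h2
    rw [sq]
    gcongr
  calc wt a * wt b = ((1 + ‖a.1‖) * (1 + ‖b.1‖)) * ((1 + ‖a.2‖) * (1 + ‖b.2‖)) := by
        unfold wt; ring
    _ ≤ (1 + ‖glue e a.1 b.1‖) ^ 2 * (1 + ‖glue e a.2 b.2‖) ^ 2 := by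
        gcongr
        · exact h _ _
        · exact h _ _
    _ = _ := by unfold wt; ring

theorem continuous_glue : Continuous fun p : X₁ × X₂ => glue e p.1 p.2 :=
  e.symm.continuous.comp (WithLp.prod_continuous_toLp 2 X₁ X₂)

/-- The kernel theorem: a separately continuous bilinear map on test functions extends to test
functions of both variables. -/
theorem exists_clm_tens (B : 𝓢(X₁, ℂ) →ₗ[ℂ] 𝓢(X₂, ℂ) →ₗ[ℂ] H)
    (hB1 : ∀ g, Continuous fun f => B f g) (hB2 : ∀ f, Continuous (B f)) :
    ∃ T : 𝓢(X, ℂ) →L[ℂ] H, ∀ f g, T (tens e f g) = B f g := by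
  have hB := continuous_of_separately B hB1 hB2
  obtain ⟨g₁, h₁, -, H1⟩ := exists_window X₁ one_pos
  obtain ⟨g₂, h₂, -, H2⟩ := exists_window X₂ one_pos
  obtain ⟨s, t, C, hC, hst⟩ := exists_bound_of_continuous_bilinear
    (schwartz_withSeminorms ℂ X₁ ℂ) (schwartz_withSeminorms ℂ X₂ ℂ) B hB
  obtain ⟨k1, n1, hs⟩ := finset_sup_le_sn (E := X₁) (F := ℂ) s
  obtain ⟨k2, n2, ht⟩ := finset_sup_le_sn (E := X₂) (F := ℂ) t
  obtain ⟨N1, C1, hC1, hb1⟩ := atom_bound h₁ k1 n1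
  obtain ⟨N2, C2, hC2, hb2⟩ := atom_bound h₂ k2 n2
  -- This order of decay absorbs the growth N1 and N2 of the atoms and leaves, in each variable, one
  -- power more than the dimension for integrability.
  let D := N1 + N2 + (Module.finrank ℝ X₁ + 1) + (Module.finrank ℝ X₂ + 1)
  obtain ⟨k, n, C3, hC3, hb3⟩ := coef_bound (tens e g₁ g₂) (2 * D)
  let c : 𝓢(X, ℂ) → (X₁ × X₁) × (X₂ × X₂) → ℂ := fun F p =>
    coef (tens e g₁ g₂) F (glue e p.1.1 p.2.1, glue e p.1.2 p.2.2)
  let β : (X₁ × X₁) × (X₂ × X₂) → H := fun p => B (atom h₁ p.1) (atom h₂ p.2)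
  have hβ : Continuous β := hB.comp
    (((continuous_atom h₁).comp continuous_fst).prodMk ((continuous_atom h₂).comp continuous_snd))
  have hc : ∀ F, Continuous (c F) := fun F => by
    refine (continuous_coef _ F).comp (Continuous.prodMk ?_ ?_)
    · exact (continuous_glue e).comp (by fun_prop :
        Continuous fun p : (X₁ × X₁) × (X₂ × X₂) => (p.1.1, p.2.1))
    · exact (continuous_glue e).comp (by fun_prop :
        Continuous fun p : (X₁ × X₁) × (X₂ × X₂) => (p.1.2, p.2.2))
  let w : (X₁ × X₁) × (X₂ × X₂) → ℝ := fun p =>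
    (wt p.1 ^ (Module.finrank ℝ X₁ + 1))⁻¹ * (wt p.2 ^ (Module.finrank ℝ X₂ + 1))⁻¹
  have hw : Integrable w := (integrable_inv_wt_pow (V := X₁) (Nat.lt_succ_self _)).mul_prod
    (integrable_inv_wt_pow (V := X₂) (Nat.lt_succ_self _))
  have hbound : ∀ F p, ‖c F p • β p‖ ≤ C3 * (C * C1 * C2) * sn k n F * w p := by
    intro F p
    have hF : 0 ≤ sn k n F := apply_nonneg _ _
    have w1 := one_le_wt p.1
    have w2 := one_le_wt p.2
    have w1p := wt_pos p.1
    have w2p := wt_pos p.2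
    have e1 : ‖β p‖ ≤ C * (C1 * wt p.1 ^ N1) * (C2 * wt p.2 ^ N2) := by
      refine (hst _ _).trans ?_
      gcongr
      · exact (hs _).trans (hb1 _)
      · exact (ht _).trans (hb2 _)
    have e2 : ‖c F p‖ ≤ C3 * sn k n F * ((wt p.1 * wt p.2) ^ D)⁻¹ := by
      refine (hb3 F _).trans ?_
      rw [pow_mul]
      gcongr
      exact wt_mul_wt_le e p.1 p.2
    have e3 : ((wt p.1 * wt p.2) ^ D)⁻¹ ≤ (wt p.1 ^ N1)⁻¹ * (wt p.2 ^ N2)⁻¹ * w p := by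
      have : wt p.1 ^ N1 * wt p.2 ^ N2 * (wt p.1 ^ (Module.finrank ℝ X₁ + 1) *
          wt p.2 ^ (Module.finrank ℝ X₂ + 1)) ≤ (wt p.1 * wt p.2) ^ D := by
        calc _ = wt p.1 ^ (N1 + (Module.finrank ℝ X₁ + 1)) *
              wt p.2 ^ (N2 + (Module.finrank ℝ X₂ + 1)) := by ring
          _ ≤ wt p.1 ^ D * wt p.2 ^ D := by
              gcongr <;> first | assumption | (simp only [D]; lia)
          _ = _ := (mul_pow _ _ _).symm
      simp only [w]
      rw [← mul_inv, ← mul_inv, ← mul_inv]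
      exact inv_anti₀ (by positivity) this
    rw [norm_smul]
    calc ‖c F p‖ * ‖β p‖ ≤ (C3 * sn k n F * ((wt p.1 ^ N1)⁻¹ * (wt p.2 ^ N2)⁻¹ * w p)) *
          (C * (C1 * wt p.1 ^ N1) * (C2 * wt p.2 ^ N2)) := by
          gcongr
          exact e2.trans (by gcongr)
      _ = _ := by field_simp
  have hint : ∀ F, Integrable (fun p => c F p • β p) := fun F =>
    (hw.const_mul _).mono' ((hc F).smul hβ).aestronglyMeasurable
      (Eventually.of_forall (hbound F))
  -- B is superposed over pairs of atoms with the joint coefficients of F. On a tensor product the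
  -- coefficients factorize, and Fubini gives the reconstruction formula in each variable
  -- separately.
  let T₀ : 𝓢(X, ℂ) →ₗ[ℂ] H :=
    { toFun := fun F => ∫ p, c F p • β p
      map_add' := fun F G => by
        rw [← integral_add (hint F) (hint G)]
        congr 1
        funext p
        simp only [c, coef_add, add_smul]
      map_smul' := fun z F => by
        rw [RingHom.id_apply, ← integral_smul]
        congr 1
        funext p
        simp only [c, coef_smul, mul_smul] }
  have hT₀ : ∀ F, ‖T₀ F‖ ≤ (C3 * (C * C1 * C2) * ∫ p, w p) * sn k n F := by
    intro F
    refine (norm_integral_le_of_norm_le (hw.const_mul _)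
      (Eventually.of_forall (hbound F))).trans (le_of_eq ?_)
    rw [integral_const_mul]
    ring
  refine ⟨mkCLMOfBound T₀ k n _ hT₀, fun f g => ?_⟩
  have h1 : mkCLMOfBound T₀ k n _ hT₀ (tens e f g) = ∫ p, c (tens e f g) p • β p := rfl
  rw [h1, Measure.volume_eq_prod, integral_prod _ (hint _)]
  have h2 : ∀ a, ∫ b, c (tens e f g) (a, b) • β (a, b) = coef g₁ f a • B (atom h₁ a) g := by
    intro a
    have h3 := clm_eq_integral_atom H2 ⟨B (atom h₁ a), hB2 _⟩ g
    have h4 : B (atom h₁ a) g = ∫ b, coef g₂ g b • B (atom h₁ a) (atom h₂ b) := h3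
    rw [h4, ← integral_smul]
    congr 1
    funext b
    simp only [c, coef_tens, mul_smul, β]
  simp only [h2]
  exact (clm_eq_integral_atom H1 ⟨B.flip g, hB1 g⟩ f).symm

end Extension

/-! ### Components of vector-valued test functions -/

section Components

variable {V ι : Type*} [NormedAddCommGroup V] [NormedSpace ℝ V] [Fintype ι] [DecidableEq ι]

/-- The component of index `i` of a vector-valued test function. -/
def cmp (i : ι) : 𝓢(V, ι → ℂ) →L[ℂ] 𝓢(V, ℂ) :=
  SchwartzMap.postcompCLM (ContinuousLinearMap.proj i)

/-- The vector-valued test function whose only component has index `i`. -/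
def inj (i : ι) : 𝓢(V, ℂ) →L[ℂ] 𝓢(V, ι → ℂ) :=
  SchwartzMap.postcompCLM (ContinuousLinearMap.single ℂ (fun _ : ι => ℂ) i)

theorem cmp_apply (i : ι) (f : 𝓢(V, ι → ℂ)) (x : V) : cmp i f x = f x i := rfl

theorem inj_apply (i j : ι) (f : 𝓢(V, ℂ)) (x : V) : inj i f x j = if j = i then f x else 0 := by
  change (Pi.single i (f x) : ι → ℂ) j = _
  rw [Pi.single_apply]

theorem sum_apply_schwartz {E F κ : Type*} [NormedAddCommGroup E] [NormedSpace ℝ E]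
    [NormedAddCommGroup F] [NormedSpace ℝ F] (s : Finset κ) (f : κ → 𝓢(E, F)) (x : E) :
    (∑ i ∈ s, f i) x = ∑ i ∈ s, f i x := by
  classical
  induction s using Finset.induction_on with
  | empty => simp
  | insert a s ha ih => rw [Finset.sum_insert ha, Finset.sum_insert ha, ← ih]; rfl

theorem sum_inj_cmp (f : 𝓢(V, ι → ℂ)) : ∑ i, inj i (cmp i f) = f := by
  ext x j
  rw [sum_apply_schwartz, Finset.sum_apply]
  simp [inj_apply, cmp_apply]

theorem clm_ext_inj {H : Type*} [NormedAddCommGroup H] [NormedSpace ℂ H]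
    {S T : 𝓢(V, ι → ℂ) →L[ℂ] H} (h : ∀ i f, S (inj i f) = T (inj i f)) : S = T := by
  ext f
  rw [← sum_inj_cmp f]
  simp [h]

end Components

/-! ### Separating the first point of a configuration -/

section Split

/-- The separation of the first point of a configuration from the remaining ones. -/
def splitConf (n : ℕ) : Conf (n + 1) ≃ₗᵢ[ℝ] WithLp 2 (E4 × Conf n) :=
  LinearIsometryEquiv.mk
    (LinearEquiv.ofLinearMap
      ((WithLp.linearEquiv 2 ℝ (E4 × Conf n)).symm.toLinearMap ∘ₗ
        (pt (0 : Fin (n + 1))).toLinearMap.prod (tailPts (n := n)).toLinearMap)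
      { toFun := fun z => WithLp.toLp 2 fun i : Fin (n + 1) × Fin 4 =>
          Fin.cons (α := fun _ => ℝ) (z.fst i.2) (fun j => z.snd (j, i.2)) i.1
        map_add' := fun z w => by
          ext ⟨j, μ⟩
          induction j using Fin.cases <;> simp
        map_smul' := fun c z => by
          ext ⟨j, μ⟩
          induction j using Fin.cases <;> simp }
      (by
        apply LinearMap.ext
        intro z
        rfl)
      (by
        apply LinearMap.ext
        intro x
        ext ⟨j, μ⟩
        induction j using Fin.cases <;> rfl))
    (fun x => by
      rw [← sq_eq_sq₀ (norm_nonneg _) (norm_nonneg _), WithLp.prod_norm_sq_eq_of_L2]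
      rw [EuclideanSpace.norm_sq_eq x, Fintype.sum_prod_type, Fin.sum_univ_succ,
        EuclideanSpace.norm_sq_eq, EuclideanSpace.norm_sq_eq, Fintype.sum_prod_type]
      rfl)

theorem pr1_splitConf {n : ℕ} (x : Conf (n + 1)) : pr1 (splitConf n) x = pt 0 x := rfl

theorem pr2_splitConf {n : ℕ} (x : Conf (n + 1)) : pr2 (splitConf n) x = tailPts x := rfl

variable {K n : ℕ}

theorem tensor_apply (f : Test K) (g : TestN K n) (x : Conf (n + 1)) (k : Fin (n + 1) → Fin K) :
    tensor f g x k = f (pt 0 x) (k 0) * g (tailPts x) (Fin.tail k) := rfl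

theorem cmp_tensor (f : Test K) (g : TestN K n) (k : Fin (n + 1) → Fin K) :
    cmp k (tensor f g) = tens (splitConf n) (cmp (k 0) f) (cmp (Fin.tail k) g) := rfl

theorem tensor_inj (i : Fin K) (j : Fin n → Fin K) (f : 𝓢(E4, ℂ)) (g : 𝓢(Conf n, ℂ)) :
    tensor (inj i f) (inj j g) = inj (Fin.cons i j : Fin (n + 1) → Fin K)
      (tens (splitConf n) f g) := by
  ext x k
  rw [tensor_apply, inj_apply, inj_apply, inj_apply, tens_apply, pr1_splitConf, pr2_splitConf]
  have : k = Fin.cons i j ↔ k 0 = i ∧ Fin.tail k = j := by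
    constructor
    · rintro rfl
      simp
    · rintro ⟨rfl, rfl⟩
      simp
  by_cases h0 : k 0 = i <;> by_cases h1 : Fin.tail k = j <;> simp [this, h0, h1]

theorem tensor_eq_sum (f : Test K) (g : TestN K n) :
    tensor f g = ∑ k, inj k (tens (splitConf n) (cmp (k 0) f) (cmp (Fin.tail k) g)) := by
  rw [← sum_inj_cmp (tensor f g)]
  rfl

/-- The tensor product as a bilinear map. -/
def tensorLM (K n : ℕ) : Test K →ₗ[ℂ] TestN K n →ₗ[ℂ] TestN K (n + 1) where
  toFun := tensor
  map_add' f f' := by ext g x k; exact add_mul _ _ _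
  map_smul' c f := by ext g x k; exact mul_assoc _ _ _

theorem continuous_tensor_right (f : Test K) : Continuous (tensor f : TestN K n → TestN K (n + 1)) := by
  rw [show (tensor f : TestN K n → TestN K (n + 1)) = fun g => _ from
    funext fun g => tensor_eq_sum f g]
  refine continuous_finsetSum _ fun k _ => ?_
  exact (inj k).continuous.comp ((tensR (splitConf n) (cmp (k 0) f)).continuous.comp
    (cmp (Fin.tail k)).continuous)

theorem continuous_tensor_left (g : TestN K n) : Continuous fun f : Test K => tensor f g := by
  simp only [tensor_eq_sum]
  refine continuous_finsetSum _ fun k _ => ?_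
  exact (inj k).continuous.comp ((tensL (splitConf n) (cmp (Fin.tail k) g)).continuous.comp
    (cmp (k 0)).continuous)

variable {H : Type*} [NormedAddCommGroup H] [NormedSpace ℂ H] [CompleteSpace H]

theorem clm_ext_tensor {S T : TestN K (n + 1) →L[ℂ] H}
    (h : ∀ f g, S (tensor f g) = T (tensor f g)) : S = T := by
  refine clm_ext_inj fun k => ?_
  have : S ∘L inj k = T ∘L inj k := by
    refine clm_ext_tens (splitConf n) fun f g => ?_
    have e := h (inj (k 0) f) (inj (Fin.tail k) g)
    rwa [tensor_inj, Fin.cons_self_tail] at e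
  exact fun f => DFunLike.congr_fun this f

/-- The scalar kernel theorem is applied to each component k and the results are summed. -/
theorem exists_clm_tensor (B : Test K →ₗ[ℂ] TestN K n →ₗ[ℂ] H)
    (hB1 : ∀ g, Continuous fun f => B f g) (hB2 : ∀ f, Continuous (B f)) :
    ∃ T : TestN K (n + 1) →L[ℂ] H, ∀ f g, T (tensor f g) = B f g := by
  have key : ∀ k : Fin (n + 1) → Fin K, ∃ T : 𝓢(Conf (n + 1), ℂ) →L[ℂ] H, ∀ f g,
      T (tens (splitConf n) f g) = B (inj (k 0) f) (inj (Fin.tail k) g) := fun k =>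
    exists_clm_tens (splitConf n)
      (B.compl₁₂ (inj (k 0) : 𝓢(E4, ℂ) →L[ℂ] Test K).toLinearMap
        (inj (Fin.tail k) : 𝓢(Conf n, ℂ) →L[ℂ] TestN K n).toLinearMap)
      (fun g => (hB1 _).comp (inj (k 0)).continuous)
      (fun f => (hB2 _).comp (inj (Fin.tail k)).continuous)
  choose T hT using key
  refine ⟨∑ k, T k ∘L cmp k, fun f g => ?_⟩
  have h1 : (∑ k, T k ∘L cmp k) (tensor f g) =
      ∑ k : Fin (n + 1) → Fin K, B (inj (k 0) (cmp (k 0) f))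
        (inj (Fin.tail k) (cmp (Fin.tail k) g)) := by
    rw [sum_apply]
    refine Finset.sum_congr rfl fun k _ => ?_
    rw [ContinuousLinearMap.comp_apply, cmp_tensor, hT]
  rw [h1, ← (Fin.consEquiv fun _ : Fin (n + 1) => Fin K).sum_comp, Fintype.sum_prod_type]
  conv_rhs => rw [← sum_inj_cmp f, ← sum_inj_cmp g]
  rw [Finset.sum_comm]
  simp [Fin.consEquiv, LinearMap.sum_apply]

theorem isTensor_cons {f : Test K} {v : Fin n → Test K} {G : TestN K n} (hG : IsTensor v G) :
    IsTensor (Fin.cons f v : Fin (n + 1) → Test K) (tensor f G) := by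
  intro x k
  rw [tensor_apply, hG, Fin.prod_univ_succ]
  rfl

theorem IsTensor.unique {v : Fin n → Test K} {F G : TestN K n} (hF : IsTensor v F)
    (hG : IsTensor v G) : F = G := by
  ext x k
  rw [hF, hG]

/-- `Conf 0` is a single point, so constants decay trivially. -/
theorem exists_schwartz_of_conf_zero (K : ℕ) (c : ℂ) : ∃ F : TestN K 0, ∀ x k, F x k = c := by
  refine ⟨⟨fun _ _ => c, contDiff_const, fun k m => ?_⟩, fun _ _ => rfl⟩
  refine ⟨‖(0 : Conf 0)‖ ^ k * ‖iteratedFDeriv ℝ m (fun _ : Conf 0 => fun _ : Fin 0 → Fin K => c) 0‖,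
    fun x => ?_⟩
  rw [Subsingleton.elim x 0]

theorem exists_isTensor {n : ℕ} (v : Fin n → Test K) : ∃ F : TestN K n, IsTensor v F := by
  induction n with
  | zero =>
    obtain ⟨F, hF⟩ := exists_schwartz_of_conf_zero K 1
    exact ⟨F, fun x k => by simp [hF]⟩
  | succ n ih =>
    obtain ⟨G, hG⟩ := ih (Fin.tail v)
    refine ⟨tensor (v 0) G, ?_⟩
    have := isTensor_cons (f := v 0) hG
    rwa [Fin.cons_self_tail] at this

theorem testN_zero_eq (F G : TestN K 0) (hG : ∀ x k, G x k = 1) :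
    F = F 0 (fun i => i.elim0) • G := by
  ext x k
  rw [smul_apply, Pi.smul_apply, hG, smul_eq_mul, mul_one, Subsingleton.elim x 0,
    Subsingleton.elim k]

/-- Continuous linear maps are determined by their values on `f₁ ⊗ … ⊗ fₙ`. -/
theorem clm_ext_isTensor {n : ℕ} {S T : TestN K n →L[ℂ] H}
    (h : ∀ (v : Fin n → Test K) F, IsTensor v F → S F = T F) : S = T := by
  induction n with
  | zero =>
    obtain ⟨G, hG⟩ := exists_schwartz_of_conf_zero K 1
    ext F
    rw [testN_zero_eq F G hG, map_smul, map_smul,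
      h (fun i => i.elim0) G (fun x k => by simp [hG])]
  | succ n ih =>
    refine clm_ext_tensor fun f => ?_
    have := ih (S := S ∘L ⟨tensor f, continuous_tensor_right f⟩)
      (T := T ∘L ⟨tensor f, continuous_tensor_right f⟩)
      (fun v F hF => h _ _ (isTensor_cons hF))
    exact fun g => DFunLike.congr_fun this g

end Split

/-! ### Density of product functions and extension of multilinear maps -/

/-- A subspace of a locally convex space is dense if the continuous functionals that vanish on it
are zero. -/
theorem dense_of_forall_clm {X : Type*} [AddCommGroup X] [Module ℂ X] [Module ℝ X]
    [IsScalarTower ℝ ℂ X] [TopologicalSpace X]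
    [IsTopologicalAddGroup X] [ContinuousSMul ℂ X] [LocallyConvexSpace ℝ X]
    (S : Submodule ℂ X) (h : ∀ T : X →L[ℂ] ℂ, (∀ x ∈ S, T x = 0) → T = 0) : Dense (S : Set X) := by
  rw [dense_iff_closure_eq, Set.eq_univ_iff_forall]
  by_contra! hne
  obtain ⟨x, hx⟩ := hne
  have hcl : closure (S : Set X) = (S.topologicalClosure : Set X) := rfl
  rw [hcl] at hx
  have hconv : Convex ℝ (S.topologicalClosure : Set X) :=
    (S.topologicalClosure.restrictScalars ℝ).convex
  obtain ⟨f, u, hf, hu⟩ := RCLike.geometric_hahn_banach_closed_point (𝕜 := ℂ) hconv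
    S.isClosed_topologicalClosure hx
  have hu0 : 0 < u := by simpa using hf 0 (zero_mem _)
  -- A functional bounded above on a subspace vanishes there: rescaling a until f takes the value u
  -- contradicts the strict bound.
  have hz : ∀ a ∈ S.topologicalClosure, f a = 0 := by
    intro a ha
    by_contra h0
    have h1 := hf (((u : ℂ) / f a) • a) (S.topologicalClosure.smul_mem _ ha)
    rw [map_smul, smul_eq_mul, div_mul_cancel₀ _ h0] at h1
    simp at h1
  have := h f fun a ha => hz a (S.le_topologicalClosure ha)
  rw [this] at hu
  simp at hu
  linarith

section Nuclear

variable {K : ℕ} {H : Type*} [NormedAddCommGroup H] [NormedSpace ℂ H] [CompleteSpace H]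

theorem dense_span_isTensor (K n : ℕ) :
    Dense (Submodule.span ℂ {F : TestN K n | ∃ v, IsTensor v F} : Set (TestN K n)) := by
  refine dense_of_forall_clm _ fun T hT => clm_ext_isTensor fun v F hF => ?_
  exact hT F (Submodule.subset_span ⟨v, hF⟩)

/-- A function of `n` test functions that is linear and continuous in each of them. -/
def IsSeparatelyContinuous {n : ℕ} (M : (Fin n → Test K) → H) : Prop :=
  ∀ f j, ∃ L : Test K →L[ℂ] H, ∀ g, M (Function.update f j g) = L g

/-- Induction on the number of variables: with the first variable frozen the others are extended by
the inductive hypothesis, and the kernel theorem joins the first one to them. -/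
theorem IsSeparatelyContinuous.exists_clm {n : ℕ} {M : (Fin n → Test K) → H}
    (hM : IsSeparatelyContinuous M) :
    ∃ T : TestN K n →L[ℂ] H, ∀ v F, IsTensor v F → T F = M v := by
  induction n with
  | zero =>
    obtain ⟨G, hG⟩ := exists_schwartz_of_conf_zero K 1
    let ev : TestN K 0 →L[ℂ] ℂ :=
      { toFun := fun F => F 0 fun i => i.elim0
        map_add' := fun _ _ => rfl
        map_smul' := fun _ _ => rfl
        cont := (continuous_apply _).comp
          (continuous_eval_schwartz.comp (continuous_id.prodMk continuous_const)) }
    refine ⟨ev.smulRight (M fun i => i.elim0), fun v F hF => ?_⟩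
    have h1 : ev F = 1 := by
      change F 0 _ = 1
      rw [hF]
      simp
    rw [ContinuousLinearMap.smulRight_apply, h1, one_smul, Subsingleton.elim v]
  | succ n ih =>
    have hcur : ∀ f, IsSeparatelyContinuous fun v : Fin n → Test K =>
        M (Fin.cons f v : Fin (n + 1) → Test K) := by
      intro f v j
      obtain ⟨L, hL⟩ := hM (Fin.cons f v : Fin (n + 1) → Test K) j.succ
      refine ⟨L, fun g => ?_⟩
      rw [← hL, ← Fin.cons_update]
    choose T hT using fun f => ih (hcur f)
    have hlin : ∀ v : Fin n → Test K, ∃ L : Test K →L[ℂ] H,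
        ∀ f, M (Fin.cons f v : Fin (n + 1) → Test K) = L f := by
      intro v
      obtain ⟨L, hL⟩ := hM (Fin.cons 0 v : Fin (n + 1) → Test K) 0
      refine ⟨L, fun f => ?_⟩
      rw [← hL, Fin.update_cons_zero]
    let B : Test K →ₗ[ℂ] TestN K n →ₗ[ℂ] H :=
      { toFun := fun f => (T f).toLinearMap
        map_add' := fun f f' => by
          have : T (f + f') = T f + T f' := clm_ext_isTensor fun v F hF => by
            obtain ⟨L, hL⟩ := hlin v
            rw [add_apply, hT _ v F hF, hT _ v F hF, hT _ v F hF, hL, hL, hL,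
              map_add]
          rw [this]
          rfl
        map_smul' := fun c f => by
          have : T (c • f) = c • T f := clm_ext_isTensor fun v F hF => by
            obtain ⟨L, hL⟩ := hlin v
            rw [smul_apply, hT _ v F hF, hT _ v F hF, hL, hL, map_smul]
          rw [this]
          rfl }
    -- For G in the span of products, continuity in f is part of the hypothesis. A general G is the
    -- limit of a sequence of such functions, and on a barrelled space a pointwise limit of
    -- continuous linear maps is continuous.
    have hB1 : ∀ g, Continuous fun f => B f g := by
      intro G
      have hspan : ∀ F ∈ Submodule.span ℂ {F : TestN K n | ∃ v, IsTensor v F},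
          Continuous fun f => B f F := by
        intro F hF
        induction hF using Submodule.span_induction with
        | mem F hF =>
          obtain ⟨v, hv⟩ := hF
          obtain ⟨L, hL⟩ := hlin v
          refine L.continuous.congr fun f => ?_
          rw [← hL]
          exact (hT f v F hv).symm
        | zero => simpa using continuous_const
        | add F F' _ _ h h' => simpa using! h.add h'
        | smul c F _ h => simpa using! h.const_smul c
      obtain ⟨u, hu, hlim⟩ := mem_closure_iff_seq_limit.1 (dense_span_isTensor K n G)
      let g : ℕ → Test K →L[ℂ] H := fun i => ⟨B.flip (u i), hspan _ (hu i)⟩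
      have h : Tendsto (fun i f => g i f) atTop (𝓝 fun f => B f G) := by
        rw [tendsto_pi_nhds]
        intro f
        exact ((T f).continuous.tendsto G).comp hlim
      exact (continuousLinearMapOfTendsto g h).continuous
    obtain ⟨S, hS⟩ := exists_clm_tensor B hB1 fun f => (T f).continuous
    refine ⟨S, fun v F hF => ?_⟩
    obtain ⟨G, hG⟩ := exists_isTensor (Fin.tail v)
    have h1 := isTensor_cons (f := v 0) hG
    rw [Fin.cons_self_tail] at h1
    rw [hF.unique h1, hS]
    have h2 := hT (v 0) (Fin.tail v) G hG
    rw [Fin.cons_self_tail] at h2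
    exact h2

end Nuclear

/-! ### The distributions Ψⁿ and the undeformed adjoint relation -/

/-- `f ↦ φ(f)` as a linear map. -/
def smearLM {K : ℕ} {M : Type*} [AddCommGroup M] [Module ℂ M]
    (φ : Fin K → 𝓢(E4, ℂ) →ₗ[ℂ] Module.End ℂ M) : Test K →ₗ[ℂ] Module.End ℂ M :=
  ∑ k, φ k ∘ₗ (comp k).toLinearMap

theorem smearLM_apply {K : ℕ} {M : Type*} [AddCommGroup M] [Module ℂ M]
    (φ : Fin K → 𝓢(E4, ℂ) →ₗ[ℂ] Module.End ℂ M) (f : Test K) : smearLM φ f = smear φ f := by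
  simp [smearLM, smear, LinearMap.sum_apply]

theorem smear_apply {K : ℕ} {M : Type*} [AddCommGroup M] [Module ℂ M]
    (φ : Fin K → 𝓢(E4, ℂ) →ₗ[ℂ] Module.End ℂ M) (f : Test K) (v : M) :
    smear φ f v = ∑ k, φ k (comp k f) v := by
  simp [smear, LinearMap.sum_apply]

theorem starTest_apply {K : ℕ} (bar : Fin K → Fin K) (f : Test K) (x : E4) (k : Fin K) :
    starTest bar f x k = conj (f x (bar k)) := rfl

namespace WightmanTheory

variable {K : ℕ} {H : Type*} [NormedAddCommGroup H] [InnerProductSpace ℂ H]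
  (W : WightmanTheory K H)

theorem starTest_starTest (f : Test K) : starTest W.bar (starTest W.bar f) = f := by
  ext x k
  simp [starTest_apply, W.bar_involutive k]

theorem inner_smear_left (f : Test K) (ψ ψ' : W.domain) :
    ⟪(smear W.field f ψ : H), (ψ' : H)⟫_ℂ =
      ⟪(ψ : H), (smear W.field (starTest W.bar f) ψ' : H)⟫_ℂ := by
  rw [smear_apply, smear_apply, Submodule.coe_sum, Submodule.coe_sum, sum_inner, inner_sum,
    ← (Equiv.ofBijective W.bar W.bar_involutive.bijective).sum_comp]
  refine Finset.sum_congr rfl fun k _ => ?_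
  rw [W.field_adjoint]
  have : comp k (starTest W.bar f) = conjTest (comp (W.bar k) f) := rfl
  simp only [Equiv.ofBijective_apply, W.bar_involutive k, this]

theorem inner_smear_right (f : Test K) (ψ ψ' : W.domain) :
    ⟪(ψ : H), (smear W.field f ψ' : H)⟫_ℂ =
      ⟪(smear W.field (starTest W.bar f) ψ : H), (ψ' : H)⟫_ℂ := by
  rw [inner_smear_left, starTest_starTest]

theorem continuous_inner_smear (ψ ψ' : W.domain) :
    Continuous fun f => ⟪(ψ : H), (smear W.field f ψ' : H)⟫_ℂ := by
  simp only [smear_apply, Submodule.coe_sum, inner_sum]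
  exact continuous_finsetSum _ fun k _ => (W.field_tempered k ψ ψ').comp (comp k).continuous

/-- The operator `φ(f₁) ⋯ φ(fₙ)`. -/
def opProd {n : ℕ} (f : Fin n → Test K) : Module.End ℂ W.domain :=
  (List.ofFn fun j => smear W.field (f j)).prod

theorem opProd_succ {n : ℕ} (f : Fin (n + 1) → Test K) :
    W.opProd f = smear W.field (f 0) * W.opProd (Fin.tail f) := by
  rw [opProd, List.ofFn_succ, List.prod_cons]
  rfl

/-- The fields to the left of the slot j are moved onto χ as adjoints, so weak continuity reduces to
that of a single field. -/
theorem opProd_update {n : ℕ} (f : Fin n → Test K) (j : Fin n) (v : W.domain) :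
    ∃ L : Test K →ₗ[ℂ] W.domain, (∀ g, W.opProd (Function.update f j g) v = L g) ∧
      ∀ χ : W.domain, Continuous fun g => ⟪(χ : H), (L g : H)⟫_ℂ := by
  induction n with
  | zero => exact j.elim0
  | succ n ih =>
    induction j using Fin.cases with
    | zero =>
      refine ⟨(smearLM W.field).flip (W.opProd (Fin.tail f) v), fun g => ?_, fun χ => ?_⟩
      · rw [opProd_succ, LinearMap.flip_apply, smearLM_apply, Function.update_self,
          Fin.tail_update_zero]
        rfl
      · simp only [LinearMap.flip_apply, smearLM_apply]
        exact W.continuous_inner_smear χ _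
    | succ j =>
      obtain ⟨L, hL, hc⟩ := ih (Fin.tail f) j
      refine ⟨smear W.field (f 0) ∘ₗ L, fun g => ?_, fun χ => ?_⟩
      · rw [opProd_succ, Fin.tail_update_succ, LinearMap.comp_apply, ← hL,
          Function.update_of_ne (Fin.succ_ne_zero j).symm]
        rfl
      · simp only [LinearMap.comp_apply, W.inner_smear_right]
        exact hc _

variable [CompleteSpace H]

theorem isSeparatelyContinuous_fieldVector (n : ℕ) :
    IsSeparatelyContinuous (W.fieldVector (n := n)) := by
  intro f j
  obtain ⟨L, hL, hc⟩ := W.opProd_update f j ⟨W.vacuum, W.vacuum_mem⟩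
  refine ⟨⟨W.domain.subtype ∘ₗ L, ?_⟩, fun g => congrArg Subtype.val (hL g)⟩
  exact continuous_of_dense_weak W.domain W.domain_dense _ fun χ hχ => hc ⟨χ, hχ⟩

theorem isVectorDistribution_psiN (n : ℕ) : W.IsVectorDistribution n (W.PsiN n) := by
  have h : ∃ T, W.IsVectorDistribution n T :=
    (W.isSeparatelyContinuous_fieldVector n).exists_clm
  rw [PsiN, dif_pos h]
  exact h.choose_spec

theorem eq_psiN {n : ℕ} {T : TestN K n →L[ℂ] H} (hT : W.IsVectorDistribution n T) :
    T = W.PsiN n :=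
  clm_ext_isTensor fun v F hF => by rw [hT v F hF, W.isVectorDistribution_psiN n v F hF]

theorem psi_single (n : ℕ) (F : TestN K n) : W.Psi (DFinsupp.single n F) = W.PsiN n F := by
  simp [Psi]

theorem psiN_mem_DD (n : ℕ) (F : TestN K n) : W.PsiN n F ∈ W.DD :=
  Submodule.subset_span ⟨n, F, rfl⟩

theorem range_psi : LinearMap.range W.Psi = W.DD := by
  apply le_antisymm
  · rintro _ ⟨g, rfl⟩
    refine DFinsupp.induction (p := fun g => W.Psi g ∈ W.DD) g
      (by rw [map_zero]; exact zero_mem _) fun n F g _ _ ih => ?_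
    rw [map_add, psi_single]
    exact add_mem (W.psiN_mem_DD n F) ih
  · refine Submodule.span_le.2 ?_
    rintro _ ⟨n, F, rfl⟩
    exact ⟨_, W.psi_single n F⟩

theorem dense_DD : Dense (W.DD : Set H) := by
  refine W.cyclic.mono (Submodule.span_le.2 ?_)
  rintro _ ⟨n, f, rfl⟩
  obtain ⟨F, hF⟩ := exists_isTensor f
  have := W.psiN_mem_DD n F
  rwa [W.isVectorDistribution_psiN n f F hF] at this

theorem psiN_zero_one {G : TestN K 0} (hG : ∀ x k, G x k = 1) : W.PsiN 0 G = W.vacuum := by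
  rw [W.isVectorDistribution_psiN 0 (fun i => i.elim0) G (fun x k => by simp [hG]), fieldVector]
  simp

theorem fieldVector_cons {n : ℕ} (f : Test K) (v : Fin n → Test K) :
    W.fieldVector (Fin.cons f v : Fin (n + 1) → Test K) =
      (smear W.field f (W.opProd v ⟨W.vacuum, W.vacuum_mem⟩) : W.domain) := by
  change ((W.opProd (Fin.cons f v : Fin (n + 1) → Test K) _ : W.domain) : H) = _
  rw [opProd_succ]
  simp only [Fin.cons_zero, Fin.tail_cons]
  rfl

theorem inner_fieldVector {m n : ℕ} (u : Fin m → Test K) (f : Test K) (v : Fin n → Test K) :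
    ⟪W.fieldVector u, W.fieldVector (Fin.cons f v : Fin (n + 1) → Test K)⟫_ℂ =
      ⟪W.fieldVector (Fin.cons (starTest W.bar f) u : Fin (m + 1) → Test K), W.fieldVector v⟫_ℂ := by
  rw [fieldVector_cons, fieldVector_cons]
  exact W.inner_smear_right f _ _

/-- The adjoint relation for the undeformed fields. -/
theorem inner_psiN_tensor {m n : ℕ} (h : TestN K m) (f : Test K) (g : TestN K n) :
    ⟪W.PsiN m h, W.PsiN (n + 1) (tensor f g)⟫_ℂ =
      ⟪W.PsiN (m + 1) (tensor (starTest W.bar f) h), W.PsiN n g⟫_ℂ := by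
  have h1 : ∀ (u : Fin m → Test K) F, IsTensor u F →
      ⟪W.PsiN m F, W.PsiN (n + 1) (tensor f g)⟫_ℂ =
        ⟪W.PsiN (m + 1) (tensor (starTest W.bar f) F), W.PsiN n g⟫_ℂ := by
    intro u F hF
    have := clm_ext_isTensor
      (S := innerSL ℂ (W.PsiN m F) ∘L W.PsiN (n + 1) ∘L ⟨tensor f, continuous_tensor_right f⟩)
      (T := innerSL ℂ (W.PsiN (m + 1) (tensor (starTest W.bar f) F)) ∘L W.PsiN n)
      (fun v G hG => by
        change ⟪W.PsiN m F, W.PsiN (n + 1) (tensor f G)⟫_ℂ = ⟪W.PsiN (m + 1) _, W.PsiN n G⟫_ℂ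
        rw [W.isVectorDistribution_psiN _ _ _ hF, W.isVectorDistribution_psiN _ _ _ hG,
          W.isVectorDistribution_psiN _ _ _ (isTensor_cons hF),
          W.isVectorDistribution_psiN _ _ _ (isTensor_cons hG), inner_fieldVector])
    exact DFunLike.congr_fun this g
  -- The relation is antilinear in h, so it is conjugated before being extended from products to all
  -- h.
  have := clm_ext_isTensor
    (S := innerSL ℂ (W.PsiN (n + 1) (tensor f g)) ∘L W.PsiN m)
    (T := innerSL ℂ (W.PsiN n g) ∘L W.PsiN (m + 1) ∘L
      ⟨tensor (starTest W.bar f), continuous_tensor_right _⟩)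
    (fun u F hF => by
      change ⟪W.PsiN (n + 1) (tensor f g), W.PsiN m F⟫_ℂ = ⟪W.PsiN n g, W.PsiN (m + 1) _⟫_ℂ
      rw [← inner_conj_symm, h1 u F hF, inner_conj_symm])
  have h2 : ⟪W.PsiN (n + 1) (tensor f g), W.PsiN m h⟫_ℂ =
      ⟪W.PsiN n g, W.PsiN (m + 1) (tensor (starTest W.bar f) h)⟫_ℂ := DFunLike.congr_fun this h
  rw [← inner_conj_symm, h2, inner_conj_symm]

end WightmanTheory

/-! ### Translation covariance of Ψⁿ -/

/-- The configuration all of whose points are `y`. -/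
def diag (n : ℕ) : E4 →L[ℝ] Conf n :=
  ((EuclideanSpace.equiv (Fin n × Fin 4) ℝ).symm : (Fin n × Fin 4 → ℝ) →L[ℝ] Conf n) ∘L
    ContinuousLinearMap.pi fun i => EuclideanSpace.proj i.2

theorem lorentz_one : lorentz 1 = 1 := by
  ext μ ν
  fin_cases μ <;> fin_cases ν <;>
    simp [lorentz, pauli, Matrix.trace_fin_two, Matrix.mul_apply, Fin.sum_univ_two]

theorem trans_tensor {K n : ℕ} (y : E4) (f : Test K) (g : TestN K n) :
    trans (diag (n + 1) y) (tensor f g) = tensor (trans y f) (trans (diag n y) g) := rfl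

namespace WightmanTheory

variable {K : ℕ} {H : Type*} [NormedAddCommGroup H] [InnerProductSpace ℂ H]
  (W : WightmanTheory K H)

theorem translate_smear (y : E4) (f : Test K) (ψ : W.domain) :
    W.U y 1 (smear W.field f ψ : H) = smear W.field (trans y f) ⟨W.U y 1 ψ, W.U_mem y 1 ψ ψ.2⟩ := by
  refine W.field_covariant y 1 f (trans y f) (fun x k => ?_) ψ
  rw [inv_one, map_one, lorentz_one, trans_apply]
  simp [Matrix.one_apply]

theorem translate_opProd (y : E4) {n : ℕ} (f : Fin n → Test K) :
    W.U y 1 (W.opProd f ⟨W.vacuum, W.vacuum_mem⟩ : W.domain) =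
      (W.opProd (fun j => trans y (f j)) ⟨W.vacuum, W.vacuum_mem⟩ : W.domain) := by
  induction n with
  | zero => simp [opProd, W.vacuum_invariant]
  | succ n ih =>
    rw [opProd_succ, opProd_succ]
    change W.U y 1 (smear W.field (f 0) _ : W.domain) = (smear W.field (trans y (f 0)) _ : W.domain)
    rw [translate_smear]
    congr 2
    exact Subtype.ext (ih (Fin.tail f))

variable [CompleteSpace H]

theorem translate_psiN (y : E4) {n : ℕ} (F : TestN K n) :
    W.U y 1 (W.PsiN n F) = W.PsiN n (trans (diag n y) F) := by
  have := clm_ext_isTensor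
    (S := (W.U y 1).toContinuousLinearEquiv.toContinuousLinearMap ∘L W.PsiN n)
    (T := W.PsiN n ∘L trans (diag n y))
    (fun v G hG => by
      change W.U y 1 (W.PsiN n G) = W.PsiN n (trans (diag n y) G)
      have hG' : IsTensor (fun j => trans y (v j)) (trans (diag n y) G) := by
        intro x k
        rw [trans_apply, hG]
        rfl
      rw [W.isVectorDistribution_psiN _ _ _ hG, W.isVectorDistribution_psiN _ _ _ hG']
      exact W.translate_opProd y v)
  exact DFunLike.congr_fun this F

end WightmanTheory

/-! ### Functionals concentrated on the zero set of given multipliers -/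

section Multipliers

variable {E : Type*} [NormedAddCommGroup E] [NormedSpace ℝ E]

theorem ofReal_hasTemperateGrowth {q : E → ℝ} (hq : q.HasTemperateGrowth) :
    (fun x => (q x : ℂ)).HasTemperateGrowth :=
  Complex.ofRealCLM.hasTemperateGrowth.comp hq

/-- The operator of multiplication by `exp(i q)`. -/
def expMul (q : E → ℝ) : 𝓢(E, ℂ) →L[ℂ] 𝓢(E, ℂ) :=
  SchwartzMap.smulLeftCLM ℂ fun x => Complex.exp (q x * Complex.I)

theorem expMul_apply {q : E → ℝ} (hq : q.HasTemperateGrowth) (v : 𝓢(E, ℂ)) (x : E) :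
    expMul q v x = Complex.exp (q x * Complex.I) * v x :=
  SchwartzMap.smulLeftCLM_apply_apply (cexp_hasTemperateGrowth hq) v x

/-- The operator of multiplication by `i q`. -/
def argMul (q : E → ℝ) : 𝓢(E, ℂ) →L[ℂ] 𝓢(E, ℂ) :=
  SchwartzMap.smulLeftCLM ℂ fun x => Complex.I * q x

theorem argMul_hasTemperateGrowth {q : E → ℝ} (hq : q.HasTemperateGrowth) :
    (fun x => Complex.I * (q x : ℂ)).HasTemperateGrowth :=
  (Function.HasTemperateGrowth.const Complex.I).mul (ofReal_hasTemperateGrowth hq)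

theorem argMul_apply {q : E → ℝ} (hq : q.HasTemperateGrowth) (v : 𝓢(E, ℂ)) (x : E) :
    argMul q v x = Complex.I * q x * v x :=
  SchwartzMap.smulLeftCLM_apply_apply (argMul_hasTemperateGrowth hq) v x

theorem const_mul_hasTemperateGrowth {q : E → ℝ} (hq : q.HasTemperateGrowth) (s : ℝ) :
    (fun x => s * q x).HasTemperateGrowth :=
  (Function.HasTemperateGrowth.const s).mul hq

theorem integral_argMul_exp (c : ℝ) (z : ℂ) :
    ∫ s in Set.Ioc (0 : ℝ) 1, Complex.I * c * Complex.exp ((s * c : ℝ) * Complex.I) * z =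
      Complex.exp (c * Complex.I) * z - z := by
  have h1 : ∀ s : ℝ, HasDerivAt (fun s : ℝ => Complex.exp ((s * c : ℝ) * Complex.I) * z)
      (Complex.I * c * Complex.exp ((s * c : ℝ) * Complex.I) * z) s := by
    intro s
    have h2 : HasDerivAt (fun s : ℝ => ((s * c : ℝ) : ℂ) * Complex.I)
        ((1 * c : ℝ) * Complex.I) s :=
      (((hasDerivAt_id s).mul_const c).ofReal_comp).mul_const _
    refine (h2.cexp.mul_const z).congr_deriv ?_
    push_cast
    ring
  have h3 := intervalIntegral.integral_eq_sub_of_hasDerivAt (a := 0) (b := 1) (fun s _ => h1 s)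
    (Continuous.intervalIntegrable (by fun_prop) _ _)
  rw [intervalIntegral.integral_of_le zero_le_one] at h3
  rw [h3]
  simp

/-- The derivative of `exp(i s q)` with respect to `s`. -/
def expArg (q : E → ℝ) (p : ℝ × E) : ℂ :=
  Complex.I * q p.2 * Complex.exp ((p.1 * q p.2 : ℝ) * Complex.I)

theorem expArg_hasTemperateGrowth {q : E → ℝ} (hq : q.HasTemperateGrowth) :
    (expArg q).HasTemperateGrowth := by
  have hq2 : (fun p : ℝ × E => q p.2).HasTemperateGrowth :=
    hq.comp (ContinuousLinearMap.snd ℝ ℝ E).hasTemperateGrowth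
  have h1 : (fun p : ℝ × E => p.1 * q p.2).HasTemperateGrowth :=
    (ContinuousLinearMap.fst ℝ ℝ E).hasTemperateGrowth.mul hq2
  exact (argMul_hasTemperateGrowth hq2).mul (cexp_hasTemperateGrowth h1)

theorem famMul_expArg {q : E → ℝ} (hq : q.HasTemperateGrowth) (s : ℝ) (v : 𝓢(E, ℂ)) :
    famMul ℂ (expArg q) s v = argMul q (expMul (fun x => s * q x) v) := by
  ext x
  rw [famMul_apply (expArg_hasTemperateGrowth hq), argMul_apply hq,
    expMul_apply (const_mul_hasTemperateGrowth hq s), smul_eq_mul, ← mul_assoc]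
  rfl

/-- Fundamental theorem of calculus for s ↦ exp(i s q) v on [0, 1], with T taken under the integral.
-/
theorem clm_expMul_sub [FiniteDimensional ℝ E] (T : 𝓢(E, ℂ) →L[ℂ] ℂ) {q : E → ℝ}
    (hq : q.HasTemperateGrowth) (v : 𝓢(E, ℂ)) :
    T (expMul q v) - T v = ∫ s in Set.Ioc (0 : ℝ) 1, T (argMul q (expMul (fun x => s * q x) v)) := by
  have hm := expArg_hasTemperateGrowth hq
  have hγ : Continuous fun s : ℝ => famMul ℂ (expArg q) s v :=
    (continuous_famMul (F := ℂ) hm).comp (f := fun s : ℝ => (s, v)) (by fun_prop)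
  have hpt : ∀ x, (expMul q v - v) x =
      ∫ s in Set.Ioc (0 : ℝ) 1, famMul ℂ (expArg q) s v x := by
    intro x
    simp only [famMul_apply hm, smul_eq_mul]
    rw [sub_apply, expMul_apply hq]
    exact (integral_argMul_exp (q x) (v x)).symm
  have hi : ∀ k n, Integrable (fun s => sn k n (famMul ℂ (expArg q) s v))
      (volume.restrict (Set.Ioc (0 : ℝ) 1)) := fun k n =>
    (((continuous_sn k n).comp hγ).integrableOn_Icc (a := 0) (b := 1)).mono_set
      Set.Ioc_subset_Icc_self
  have := (clm_integral T hγ hi hpt).2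
  rw [map_sub] at this
  simpa only [famMul_expArg hq] using this

/-- A functional that is invariant under multiplication by the functions `exp(i s P_μ)`, `s ∈ ℝ`,
is invariant under multiplication by `exp(i ∑ P_μ q_μ)`. -/
theorem clm_expMul_sum [FiniteDimensional ℝ E] (T : 𝓢(E, ℂ) →L[ℂ] ℂ) {ι : Type*} [Fintype ι]
    {P q : ι → E → ℝ}
    (hP : ∀ i, (P i).HasTemperateGrowth) (hq : ∀ i, (q i).HasTemperateGrowth)
    (hT : ∀ i (s : ℝ) v, T (expMul (fun x => s * P i x) v) = T v) (v : 𝓢(E, ℂ)) :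
    T (expMul (fun x => ∑ i, q i x * P i x) v) = T v := by
  -- By invariance the integrand in `clm_expMul_sub` does not depend on s, so T(i P v) = T(exp(i P)
  -- v) - T(v) = 0.
  have h0 : ∀ i v, T (argMul (P i) v) = 0 := by
    intro i v
    have h1 := clm_expMul_sub T (hP i) v
    have h2 : ∀ s : ℝ, argMul (P i) (expMul (fun x => s * P i x) v) =
        expMul (fun x => s * P i x) (argMul (P i) v) := by
      intro s
      ext x
      rw [argMul_apply (hP i), expMul_apply (const_mul_hasTemperateGrowth (hP i) s),
        expMul_apply (const_mul_hasTemperateGrowth (hP i) s), argMul_apply (hP i)]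
      ring
    have h3 : T (expMul (P i) v) = T v := by
      have := hT i 1 v
      simpa only [one_mul] using this
    simp only [h2, hT] at h1
    rw [h3, sub_self] at h1
    simpa using h1.symm
  have hs : (fun x => ∑ i, q i x * P i x).HasTemperateGrowth :=
    .sum fun i _ => (hq i).mul (hP i)
  rw [← sub_eq_zero, clm_expMul_sub T hs v]
  refine integral_eq_zero_of_ae (Eventually.of_forall fun s => ?_)
  -- With Q = ∑ q_i P_i, the function i Q w is a sum of functions i P_i (q_i w), each annihilated by
  -- T; hence the integrand vanishes.
  have h4 : ∀ w, argMul (fun x => ∑ i, q i x * P i x) w =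
      ∑ i, argMul (P i) (SchwartzMap.smulLeftCLM ℂ (fun x => (q i x : ℂ)) w) := by
    intro w
    ext x
    rw [argMul_apply hs, sum_apply_schwartz]
    simp only [argMul_apply (hP _),
      SchwartzMap.smulLeftCLM_apply_apply (ofReal_hasTemperateGrowth (hq _))]
    push_cast
    rw [Finset.mul_sum, Finset.sum_mul]
    refine Finset.sum_congr rfl fun i _ => ?_
    rw [smul_eq_mul]
    ring
  simp only [h4, map_sum, h0, Finset.sum_const_zero, Pi.zero_apply]

end Multipliers

/-! ### Complex conjugation and the Moyal twist on scalar functions -/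

section Conj

variable {V : Type*} [NormedAddCommGroup V] [InnerProductSpace ℝ V] [FiniteDimensional ℝ V]
  [MeasurableSpace V] [BorelSpace V]

/-- Complex conjugation of test functions. -/
def conjS : 𝓢(V, ℂ) →L[ℝ] 𝓢(V, ℂ) := SchwartzMap.postcompCLM (Complex.conjCLE : ℂ →L[ℝ] ℂ)

theorem conjS_apply (f : 𝓢(V, ℂ)) (x : V) : conjS f x = conj (f x) := rfl

theorem conjS_conjS (f : 𝓢(V, ℂ)) : conjS (conjS f) = f := by
  ext x
  simp [conjS_apply]

theorem conjS_smul (c : ℂ) (f : 𝓢(V, ℂ)) : conjS (c • f) = conj c • conjS f := by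
  ext x
  simp [conjS_apply]

theorem fourier_conjS (f : 𝓢(V, ℂ)) (ξ : V) : 𝓕 (conjS f) ξ = conj (𝓕 f (-ξ)) := by
  rw [SchwartzMap.fourier_coe, SchwartzMap.fourier_coe, Real.fourier_eq', Real.fourier_eq',
    ← integral_conj]
  congr 1
  funext x
  rw [smul_eq_mul, smul_eq_mul, map_mul, conjS_apply, ← Complex.exp_conj]
  congr 2
  have : (conj 2 : ℂ) = 2 := Complex.conj_ofNat 2
  simp [this]

theorem fourier_postcomp {F G : Type*} [NormedAddCommGroup F] [NormedSpace ℂ F] [CompleteSpace F]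
    [NormedAddCommGroup G] [NormedSpace ℂ G] [CompleteSpace G] (L : F →L[ℂ] G) (f : 𝓢(V, F)) :
    𝓕 (SchwartzMap.postcompCLM L f) = SchwartzMap.postcompCLM L (𝓕 f) := by
  ext ξ
  rw [SchwartzMap.postcompCLM_apply, SchwartzMap.fourier_coe, SchwartzMap.fourier_coe,
    Real.fourier_eq, Real.fourier_eq,
    ← L.integral_comp_comm ((Real.fourierIntegral_convergent_iff ξ).2 f.integrable)]
  congr 1
  funext x
  rw [Circle.smul_def, Circle.smul_def, map_smul]
  rfl

end Conj

/-- The exponent of the phase of the Moyal tensor product. -/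
def moyalArg {n : ℕ} (θ : Matrix (Fin 4) (Fin 4) ℝ) (ξ : Conf (n + 1)) : ℝ :=
  -(1 / 2) * ∑ r : Fin n, thetaForm θ (momentum 0 ξ) (momentum r.succ ξ)

theorem moyalPhase_eq {n : ℕ} (θ : Matrix (Fin 4) (Fin 4) ℝ) (ξ : Conf (n + 1)) :
    moyalPhase θ ξ = Complex.exp (moyalArg θ ξ * Complex.I) := by
  rw [moyalPhase, ← Complex.exp_sum, moyalArg, ← Finset.mul_sum]
  congr 1
  push_cast
  ring

theorem momentum_hasTemperateGrowth {n : ℕ} (j : Fin n) (μ : Fin 4) :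
    (fun ξ : Conf n => momentum j ξ μ).HasTemperateGrowth :=
  (Function.HasTemperateGrowth.const (2 * Real.pi * eta μ)).mul
    (EuclideanSpace.proj (𝕜 := ℝ) (j, μ)).hasTemperateGrowth

theorem moyalArg_hasTemperateGrowth {n : ℕ} (θ : Matrix (Fin 4) (Fin 4) ℝ) :
    (moyalArg (n := n) θ).HasTemperateGrowth := by
  refine (Function.HasTemperateGrowth.const (-(1 / 2) : ℝ)).mul ?_
  unfold thetaForm
  refine .sum fun r _ => .sum fun μ _ => .sum fun ν _ => ?_
  exact ((momentum_hasTemperateGrowth 0 μ).mul (.const _)).mul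
    (momentum_hasTemperateGrowth r.succ ν)

/-- The exponent is quadratic in the momenta. Complex conjugation reflects the momenta and therefore
only inverts the phase. -/
theorem moyalArg_neg {n : ℕ} (θ : Matrix (Fin 4) (Fin 4) ℝ) (ξ : Conf (n + 1)) :
    moyalArg θ (-ξ) = moyalArg θ ξ := by
  simp [moyalArg, thetaForm, momentum]

/-- The operator that turns the tensor product into the Moyal tensor product. -/
def moyalS {n : ℕ} (θ : Matrix (Fin 4) (Fin 4) ℝ) : 𝓢(Conf (n + 1), ℂ) →L[ℂ] 𝓢(Conf (n + 1), ℂ) :=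
  FourierTransform.fourierInvCLM ℂ 𝓢(Conf (n + 1), ℂ) ∘L expMul (moyalArg θ) ∘L
    FourierTransform.fourierCLM ℂ 𝓢(Conf (n + 1), ℂ)

theorem fourier_moyalS {n : ℕ} (θ : Matrix (Fin 4) (Fin 4) ℝ) (u : 𝓢(Conf (n + 1), ℂ)) :
    𝓕 (moyalS θ u) = expMul (moyalArg θ) (𝓕 u) :=
  FourierTransform.fourier_fourierInv_eq _

theorem fourier_injective {V F : Type*} [NormedAddCommGroup V] [InnerProductSpace ℝ V]
    [FiniteDimensional ℝ V] [MeasurableSpace V] [BorelSpace V] [NormedAddCommGroup F]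
    [NormedSpace ℂ F] [CompleteSpace F] {f g : 𝓢(V, F)} (h : 𝓕 f = 𝓕 g) : f = g := by
  rw [← FourierTransform.fourierInv_fourier_eq (F := 𝓢(V, F)) f, h,
    FourierTransform.fourierInv_fourier_eq]

theorem moyal_inj {K n : ℕ} (θ : Matrix (Fin 4) (Fin 4) ℝ) (i : Fin K) (j : Fin n → Fin K)
    (f : 𝓢(E4, ℂ)) (g : 𝓢(Conf n, ℂ)) :
    moyal θ (inj i f) (inj j g) = inj (Fin.cons i j : Fin (n + 1) → Fin K)
      (moyalS θ (tens (splitConf n) f g)) := by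
  apply fourier_injective
  ext1 ξ
  rw [fourier_moyal, tensor_inj, inj, fourier_postcomp, fourier_postcomp, fourier_moyalS,
    SchwartzMap.postcompCLM_apply, SchwartzMap.postcompCLM_apply,
    expMul_apply (moyalArg_hasTemperateGrowth θ), ← moyalPhase_eq, ← map_smul, smul_eq_mul]

theorem conjS_moyalS {n : ℕ} (θ : Matrix (Fin 4) (Fin 4) ℝ) (u : 𝓢(Conf (n + 1), ℂ)) :
    𝓕 (conjS (moyalS θ u)) = expMul (fun ξ => -moyalArg θ ξ) (𝓕 (conjS u)) := by
  ext ξ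
  rw [fourier_conjS, fourier_moyalS, expMul_apply (moyalArg_hasTemperateGrowth θ),
    expMul_apply (q := fun ξ => -moyalArg θ ξ) (moyalArg_hasTemperateGrowth θ).neg, map_mul, fourier_conjS, moyalArg_neg,
    ← Complex.exp_conj]
  congr 2
  simp

/-! ### Regrouping the points of two configurations -/

section SplitPoints

variable {a b : ℕ} {J : Type*} [Fintype J]

/-- The configurations of points labelled by `J`. -/
abbrev ConfOf (J : Type*) [Fintype J] : Type _ := EuclideanSpace ℝ (J × Fin 4)

/-- The splitting of a configuration into two configurations. -/
def splitPoints (τ : Fin a ⊕ Fin b ≃ J) : ConfOf J ≃ₗᵢ[ℝ] WithLp 2 (Conf a × Conf b) :=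
  LinearIsometryEquiv.mk
    { toFun := fun x => WithLp.toLp 2 (WithLp.toLp 2 fun i => x (τ (.inl i.1), i.2),
        WithLp.toLp 2 fun i => x (τ (.inr i.1), i.2))
      invFun := fun z => WithLp.toLp 2 fun i =>
        Sum.elim (fun r => z.fst (r, i.2)) (fun r => z.snd (r, i.2)) (τ.symm i.1)
      map_add' := fun x y => rfl
      map_smul' := fun c x => rfl
      left_inv := fun x => by
        ext ⟨j, μ⟩
        obtain ⟨i, rfl⟩ := τ.surjective j
        cases i <;> simp
      right_inv := fun z => by
        apply WithLp.ofLp_injective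
        refine Prod.ext ?_ ?_ <;> ext ⟨j, μ⟩ <;> simp }
    (fun x => by
      rw [← sq_eq_sq₀ (norm_nonneg _) (norm_nonneg _), WithLp.prod_norm_sq_eq_of_L2,
        EuclideanSpace.norm_sq_eq x, Fintype.sum_prod_type, ← τ.sum_comp, Fintype.sum_sum_type,
        EuclideanSpace.norm_sq_eq, EuclideanSpace.norm_sq_eq, Fintype.sum_prod_type,
        Fintype.sum_prod_type]
      rfl)

/-- The relabelling that moves the first point of the second group in front of the first group. -/
def moveFirst (m n : ℕ) : Fin (m + 1) ⊕ Fin n ≃ Fin m ⊕ Fin (n + 1) :=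
  Equiv.ofBijective
    (Sum.elim (Fin.cons (.inr 0) .inl : Fin (m + 1) → Fin m ⊕ Fin (n + 1)) fun r => .inr r.succ) <| by
    constructor
    · rintro (r | r) (s | s) h
      · induction r using Fin.cases <;> induction s using Fin.cases <;> simp at h ⊢
        exact h
      · induction r using Fin.cases <;> simp [Fin.succ_ne_zero, eq_comm] at h
      · induction s using Fin.cases <;> simp [Fin.succ_ne_zero] at h
      · simpa using h
    · rintro (r | r)
      · exact ⟨.inl r.succ, by simp⟩
      · induction r using Fin.cases with
        | zero => exact ⟨.inl 0, by simp⟩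
        | succ r => exact ⟨.inr r, by simp⟩

/-- The configuration all of whose points are `y`. -/
def diagOf (J : Type*) [Fintype J] (y : E4) : ConfOf J := WithLp.toLp 2 fun i => y i.2

/-- The point of f can be counted with the second group or with the first; these are the two sides
of the adjoint relation. -/
theorem tens_tens {m n : ℕ} (u : 𝓢(Conf m, ℂ)) (f : 𝓢(E4, ℂ)) (g : 𝓢(Conf n, ℂ)) :
    tens (splitPoints (Equiv.refl (Fin m ⊕ Fin (n + 1)))) u (tens (splitConf n) f g) =
      tens (splitPoints (moveFirst m n)) (tens (splitConf m) f u) g := by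
  ext x
  have h1 : pr1 (splitConf n) (pr2 (splitPoints (Equiv.refl (Fin m ⊕ Fin (n + 1)))) x) =
    pr1 (splitConf m) (pr1 (splitPoints (moveFirst m n)) x) := rfl
  have h2 : pr2 (splitConf n) (pr2 (splitPoints (Equiv.refl (Fin m ⊕ Fin (n + 1)))) x) =
    pr2 (splitPoints (moveFirst m n)) x := rfl
  have h3 : pr1 (splitPoints (Equiv.refl (Fin m ⊕ Fin (n + 1)))) x =
    pr2 (splitConf m) (pr1 (splitPoints (moveFirst m n)) x) := rfl
  rw [tens_apply, tens_apply, tens_apply, tens_apply, h1, h2, h3]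
  ring

end SplitPoints

/-! ### Matrix elements as distributions in all variables -/

section Sesquilinear

variable {X X₁ X₂ : Type*} [NormedAddCommGroup X] [InnerProductSpace ℝ X]
  [NormedAddCommGroup X₁] [InnerProductSpace ℝ X₁] [NormedAddCommGroup X₂] [InnerProductSpace ℝ X₂]
  [FiniteDimensional ℝ X] [MeasurableSpace X] [BorelSpace X]
  [FiniteDimensional ℝ X₁] [MeasurableSpace X₁] [BorelSpace X₁]
  [FiniteDimensional ℝ X₂] [MeasurableSpace X₂] [BorelSpace X₂]
  (e : X ≃ₗᵢ[ℝ] WithLp 2 (X₁ × X₂)) {H : Type*} [NormedAddCommGroup H] [InnerProductSpace ℂ H]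

/-- `conjS` undoes the antilinearity of the inner product in its first argument, so the kernel
theorem applies. -/
theorem exists_clm_inner (S : 𝓢(X₁, ℂ) →L[ℂ] H) (T : 𝓢(X₂, ℂ) →L[ℂ] H) :
    ∃ L : 𝓢(X, ℂ) →L[ℂ] ℂ, ∀ u v, L (tens e u v) = ⟪S (conjS u), T v⟫_ℂ := by
  refine exists_clm_tens e
    (LinearMap.mk₂ ℂ (fun u v => ⟪S (conjS u), T v⟫_ℂ)
      (fun u u' v => by rw [map_add, map_add, inner_add_left])
      (fun c u v => by rw [conjS_smul, map_smul, inner_smul_left, Complex.conj_conj, smul_eq_mul])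
      (fun u v v' => by rw [map_add, inner_add_right])
      (fun c u v => by rw [map_smul, inner_smul_right, smul_eq_mul])) (fun v => ?_) (fun u => ?_)
  · exact (S.continuous.comp conjS.continuous).inner continuous_const
  · exact continuous_const.inner T.continuous

theorem conjS_tens (u : 𝓢(X₁, ℂ)) (v : 𝓢(X₂, ℂ)) :
    conjS (tens e u v) = tens e (conjS u) (conjS v) := by
  ext x
  simp [conjS_apply, tens_apply]

theorem tens_expMul_right {q : X₂ → ℝ} (hq : q.HasTemperateGrowth) (u : 𝓢(X₁, ℂ)) (v : 𝓢(X₂, ℂ)) :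
    tens e u (expMul q v) = expMul (fun x => q (pr2 e x)) (tens e u v) := by
  ext x
  rw [expMul_apply (q := fun x => q (pr2 e x)) (hq.comp (pr2 e).hasTemperateGrowth), tens_apply, tens_apply, expMul_apply hq]
  ring

theorem tens_expMul_left {q : X₁ → ℝ} (hq : q.HasTemperateGrowth) (u : 𝓢(X₁, ℂ)) (v : 𝓢(X₂, ℂ)) :
    tens e (expMul q u) v = expMul (fun x => q (pr1 e x)) (tens e u v) := by
  ext x
  rw [expMul_apply (q := fun x => q (pr1 e x)) (hq.comp (pr1 e).hasTemperateGrowth), tens_apply, tens_apply, expMul_apply hq]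
  ring

end Sesquilinear

/-! ### Total momentum and the comparison of the two phases -/

/-- The total momentum in the Euclidean Fourier variables. -/
def totalMomentum {J : Type*} [Fintype J] (μ : Fin 4) (ξ : ConfOf J) : ℝ :=
  2 * Real.pi * ∑ j, ξ (j, μ)

theorem totalMomentum_hasTemperateGrowth {J : Type*} [Fintype J] (μ : Fin 4) :
    (totalMomentum (J := J) μ).HasTemperateGrowth := by
  refine (Function.HasTemperateGrowth.const (2 * Real.pi)).mul (.sum fun j _ => ?_)
  exact (EuclideanSpace.proj (𝕜 := ℝ) (j, μ)).hasTemperateGrowth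

theorem expFun_diagOf {J : Type*} [Fintype J] (μ : Fin 4) (s : ℝ) (ξ : ConfOf J) :
    expFun (diagOf J (EuclideanSpace.single μ s), ξ) =
      Complex.exp ((s * totalMomentum μ ξ : ℝ) * Complex.I) := by
  have : ⟪diagOf J (EuclideanSpace.single μ s), ξ⟫_ℝ = s * ∑ j, ξ (j, μ) := by
    rw [PiLp.inner_apply, Fintype.sum_prod_type, Finset.mul_sum]
    refine Finset.sum_congr rfl fun j _ => ?_
    rw [Finset.sum_eq_single μ]
    · simp [diagOf, mul_comm]
    · intro ν _ hν
      simp [diagOf, hν]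
    · simp
  rw [expFun, this, totalMomentum]
  congr 3
  ring

/-- For antisymmetric `θ` the phases of the two sides of the adjoint relation differ by a function
of the form `exp(i ∑ q_μ P_μ)`, where `P` is the total momentum. -/
theorem moyalArg_add_moyalArg {m n : ℕ} {θ : Matrix (Fin 4) (Fin 4) ℝ} (hθ : θ.transpose = -θ)
    (ξ : ConfOf (Fin m ⊕ Fin (n + 1))) :
    moyalArg θ (pr2 (splitPoints (Equiv.refl (Fin m ⊕ Fin (n + 1)))) ξ) =
      -moyalArg θ (pr1 (splitPoints (moveFirst m n)) ξ) +
      ∑ ν, (-(1 / 2) * ∑ μ, (2 * Real.pi * eta μ * ξ (.inr 0, μ)) * (eta μ * θ μ ν)) *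
        totalMomentum ν ξ := by
  have hee : ∀ μ, eta μ * eta μ = 1 := fun μ => by unfold eta; split_ifs <;> norm_num
  set p : E4 := momentum 0 (pr2 (splitPoints (Equiv.refl (Fin m ⊕ Fin (n + 1)))) ξ) with hp
  have hlin : ∀ q : E4, thetaForm θ p q =
      ∑ ν, (∑ μ, p μ * (eta μ * θ μ ν)) * (eta ν * q ν) := by
    intro q
    rw [thetaForm, Finset.sum_comm]
    refine Finset.sum_congr rfl fun ν _ => ?_
    rw [Finset.sum_mul]
    exact Finset.sum_congr rfl fun μ _ => by ring
  -- Antisymmetry of θ enters here: the momentum p may be added freely to the sum it is paired with,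
  -- which completes that sum to the total momentum.
  have hpp : thetaForm θ p p = 0 := by
    have h1 : thetaForm θ p p = -thetaForm θ p p := by
      conv_lhs => rw [thetaForm, Finset.sum_comm]
      rw [thetaForm, ← Finset.sum_neg_distrib]
      refine Finset.sum_congr rfl fun μ _ => ?_
      rw [← Finset.sum_neg_distrib]
      refine Finset.sum_congr rfl fun ν _ => ?_
      have : θ ν μ = -θ μ ν := by
        have := congrFun (congrFun hθ μ) ν
        simpa using this
      rw [this]
      ring
    linarith
  have hA : moyalArg θ (pr2 (splitPoints (Equiv.refl (Fin m ⊕ Fin (n + 1)))) ξ) =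
      -(1 / 2) * ∑ r : Fin n, ∑ ν, (∑ μ, p μ * (eta μ * θ μ ν)) *
        (2 * Real.pi * ξ (.inr r.succ, ν)) := by
    rw [moyalArg]
    congr 1
    refine Finset.sum_congr rfl fun r _ => ?_
    rw [hlin]
    refine Finset.sum_congr rfl fun ν _ => ?_
    congr 1
    change eta ν * (2 * Real.pi * eta ν * ξ (.inr r.succ, ν)) = _
    linear_combination (2 * Real.pi * ξ (.inr r.succ, ν)) * hee ν
  have hB : moyalArg θ (pr1 (splitPoints (moveFirst m n)) ξ) =
      -(1 / 2) * ∑ r : Fin m, ∑ ν, (∑ μ, p μ * (eta μ * θ μ ν)) *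
        (2 * Real.pi * ξ (.inl r, ν)) := by
    rw [moyalArg]
    congr 1
    refine Finset.sum_congr rfl fun r _ => ?_
    have : momentum 0 (pr1 (splitPoints (moveFirst m n)) ξ) = p := rfl
    rw [this, hlin]
    refine Finset.sum_congr rfl fun ν _ => ?_
    congr 1
    change eta ν * (2 * Real.pi * eta ν * ξ (.inl r, ν)) = _
    linear_combination (2 * Real.pi * ξ (.inl r, ν)) * hee ν
  have hC : ∑ ν, (∑ μ, p μ * (eta μ * θ μ ν)) * (2 * Real.pi * ξ (.inr 0, ν)) = 0 := by
    rw [← hpp, hlin]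
    refine Finset.sum_congr rfl fun ν _ => ?_
    congr 1
    change _ = eta ν * (2 * Real.pi * eta ν * ξ (.inr 0, ν))
    linear_combination -(2 * Real.pi * ξ (.inr 0, ν)) * hee ν
  have hD : ∑ ν, (-(1 / 2) * ∑ μ, (2 * Real.pi * eta μ * ξ (.inr 0, μ)) * (eta μ * θ μ ν)) *
        totalMomentum ν ξ = -(1 / 2) * ((∑ r : Fin m, ∑ ν, (∑ μ, p μ * (eta μ * θ μ ν)) *
        (2 * Real.pi * ξ (.inl r, ν))) +
        (∑ ν, (∑ μ, p μ * (eta μ * θ μ ν)) * (2 * Real.pi * ξ (.inr 0, ν)) +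
        ∑ r : Fin n, ∑ ν, (∑ μ, p μ * (eta μ * θ μ ν)) *
        (2 * Real.pi * ξ (.inr r.succ, ν)))) := by
    rw [Finset.sum_comm (s := (Finset.univ : Finset (Fin m))),
      Finset.sum_comm (s := (Finset.univ : Finset (Fin n))), ← Finset.sum_add_distrib,
      ← Finset.sum_add_distrib, Finset.mul_sum]
    refine Finset.sum_congr rfl fun ν _ => ?_
    rw [totalMomentum, Fintype.sum_sum_type, Fin.sum_univ_succ (fun j => ξ (.inr j, ν)),
      ← Finset.mul_sum, ← Finset.mul_sum, ← Finset.mul_sum, ← Finset.mul_sum]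
    change -(1 / 2) * (∑ μ, p μ * (eta μ * θ μ ν)) * _ = _
    ring
  rw [hA, hB, hD, hC]
  ring

theorem trans_inj {V ι : Type*} [NormedAddCommGroup V] [NormedSpace ℝ V] [Fintype ι]
    [DecidableEq ι] (y : V) (i : ι) (f : 𝓢(V, ℂ)) : trans y (inj i f) = inj i (trans y f) := rfl

theorem starTest_inj {K : ℕ} {bar : Fin K → Fin K} (hbar : Function.Involutive bar) (k : Fin K)
    (f : 𝓢(E4, ℂ)) : starTest bar (inj k f) = inj (bar k) (conjS f) := by
  ext x l
  rw [starTest_apply, inj_apply, inj_apply, conjS_apply]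
  have : bar l = k ↔ l = bar k := ⟨fun h => by rw [← h, hbar], fun h => by rw [h, hbar]⟩
  by_cases h : l = bar k
  · rw [if_pos (this.2 h), if_pos h]
  · rw [if_neg (mt this.1 h), if_neg h, map_zero]

/-- The Moyal tensor product as a bilinear map. -/
def moyalLM (θ : Matrix (Fin 4) (Fin 4) ℝ) (K n : ℕ) :
    Test K →ₗ[ℂ] TestN K n →ₗ[ℂ] TestN K (n + 1) :=
  (tensorLM K n).compr₂ (FourierTransform.fourierInvCLM ℂ (TestN K (n + 1)) ∘L
    SchwartzMap.smulLeftCLM _ (moyalPhase θ) ∘L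
    FourierTransform.fourierCLM ℂ (TestN K (n + 1))).toLinearMap

theorem moyalLM_apply (θ : Matrix (Fin 4) (Fin 4) ℝ) {K n : ℕ} (f : Test K) (g : TestN K n) :
    moyalLM θ K n f g = moyal θ f g := rfl

theorem continuous_moyal_right (θ : Matrix (Fin 4) (Fin 4) ℝ) {K n : ℕ} (f : Test K) :
    Continuous (moyal θ f : TestN K n → TestN K (n + 1)) :=
  (FourierTransform.fourierInvCLM ℂ (TestN K (n + 1)) ∘L
    SchwartzMap.smulLeftCLM _ (moyalPhase θ) ∘L
    FourierTransform.fourierCLM ℂ (TestN K (n + 1))).continuous.comp (continuous_tensor_right f)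

theorem continuous_moyal_left (θ : Matrix (Fin 4) (Fin 4) ℝ) {K n : ℕ} (g : TestN K n) :
    Continuous fun f : Test K => moyal θ f g :=
  (FourierTransform.fourierInvCLM ℂ (TestN K (n + 1)) ∘L
    SchwartzMap.smulLeftCLM _ (moyalPhase θ) ∘L
    FourierTransform.fourierCLM ℂ (TestN K (n + 1))).continuous.comp (continuous_tensor_left g)

/-! ### The adjoint relation of the deformed fields -/

namespace WightmanTheory

variable {K : ℕ} {H : Type*} [NormedAddCommGroup H] [InnerProductSpace ℂ H]
  (W : WightmanTheory K H) [CompleteSpace H]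

/-- The adjoint relation of the deformed fields for single components. -/
theorem inner_psiN_moyalS {θ : Matrix (Fin 4) (Fin 4) ℝ} (hθ : θ.transpose = -θ) {m n : ℕ}
    (i : Fin m → Fin K) (k : Fin K) (j : Fin n → Fin K) (u : 𝓢(Conf m, ℂ)) (f : 𝓢(E4, ℂ))
    (g : 𝓢(Conf n, ℂ)) :
    ⟪W.PsiN m (inj i (conjS u)), W.PsiN (n + 1) (inj (Fin.cons k j : Fin (n + 1) → Fin K)
        (moyalS θ (tens (splitConf n) f g)))⟫_ℂ =
      ⟪W.PsiN (m + 1) (inj (Fin.cons (W.bar k) i : Fin (m + 1) → Fin K)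
        (moyalS θ (tens (splitConf m) (conjS f) (conjS u)))), W.PsiN n (inj j g)⟫_ℂ := by
  set e₁ := splitPoints (Equiv.refl (Fin m ⊕ Fin (n + 1)))
  set e₂ := splitPoints (moveFirst m n)
  obtain ⟨L, hL⟩ := exists_clm_inner e₁ (W.PsiN m ∘L inj i)
    (W.PsiN (n + 1) ∘L inj (Fin.cons k j : Fin (n + 1) → Fin K))
  obtain ⟨L', hL'⟩ := exists_clm_inner e₂
    (W.PsiN (m + 1) ∘L inj (Fin.cons (W.bar k) i : Fin (m + 1) → Fin K)) (W.PsiN n ∘L inj j)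
  simp only [ContinuousLinearMap.comp_apply] at hL hL'
  -- Without the twists both sides are the same distribution in all m + 1 + n points; this is the
  -- undeformed adjoint relation.
  have hLL : L = L' := by
    refine clm_ext_tens e₁ fun u b => ?_
    have : L ∘L tensR e₁ u = L' ∘L tensR e₁ u := by
      refine clm_ext_tens (splitConf n) fun f g => ?_
      change L (tens e₁ u (tens (splitConf n) f g)) = L' (tens e₁ u (tens (splitConf n) f g))
      rw [hL, tens_tens, hL', conjS_tens, ← tensor_inj, ← tensor_inj, inner_psiN_tensor,
        starTest_inj W.bar_involutive]
    exact DFunLike.congr_fun this b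
  -- U is unitary and translates Ψⁿ, so L is invariant under a common translation of all points.
  have hinv : ∀ y v, L (trans (diagOf _ y) v) = L v := by
    intro y v
    have : L ∘L trans (diagOf _ y) = L := by
      refine clm_ext_tens e₁ fun u b => ?_
      rw [ContinuousLinearMap.comp_apply, trans_tens, hL, hL]
      have h1 : pr1 e₁ (diagOf _ y) = diag m y := rfl
      have h2 : pr2 e₁ (diagOf _ y) = diag (n + 1) y := rfl
      have h3 : conjS (trans (diag m y) u) = trans (diag m y) (conjS u) := rfl
      rw [h1, h2, h3, ← trans_inj, ← trans_inj, ← W.translate_psiN, ← W.translate_psiN,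
        LinearIsometryEquiv.inner_map_map]
    exact DFunLike.congr_fun this v
  -- This is L in momentum space, where translation invariance reads as invariance under exp(i s
  -- P_μ) with the total momentum P.
  let L₀ : 𝓢(ConfOf (Fin m ⊕ Fin (n + 1)), ℂ) →L[ℂ] ℂ :=
    L ∘L FourierTransform.fourierInvCLM ℂ 𝓢(ConfOf (Fin m ⊕ Fin (n + 1)), ℂ)
  have hL₀ : ∀ v, L v = L₀ (𝓕 v) := by
    intro v
    change L v = L (𝓕⁻ (𝓕 v))
    rw [FourierTransform.fourierInv_fourier_eq]
  have hinv₀ : ∀ (μ : Fin 4) (s : ℝ) v,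
      L₀ (expMul (fun ξ => s * totalMomentum μ ξ) v) = L₀ v := by
    intro μ s v
    have h1 := hinv (EuclideanSpace.single μ (-s)) (𝓕⁻ v)
    rw [hL₀, hL₀, FourierTransform.fourier_fourierInv_eq] at h1
    rw [← h1]
    congr 1
    ext ξ
    rw [fourier_trans, FourierTransform.fourier_fourierInv_eq,
      expMul_apply (const_mul_hasTemperateGrowth (totalMomentum_hasTemperateGrowth μ) s)]
    have : -diagOf (Fin m ⊕ Fin (n + 1)) (EuclideanSpace.single μ (-s)) =
        diagOf _ (EuclideanSpace.single μ s) := by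
      ext ⟨a, ν⟩
      simp only [diagOf, PiLp.neg_apply, PiLp.single_apply]
      split_ifs <;> simp
    rw [this, expFun_diagOf, smul_eq_mul]
  have h1 : ⟪W.PsiN m (inj i (conjS u)), W.PsiN (n + 1) (inj (Fin.cons k j : Fin (n + 1) → Fin K)
        (moyalS θ (tens (splitConf n) f g)))⟫_ℂ =
      L₀ (expMul (fun ξ => moyalArg θ (pr2 e₁ ξ))
        (𝓕 (tens e₁ u (tens (splitConf n) f g)))) := by
    rw [← hL, hL₀, fourier_tens, fourier_moyalS,
      tens_expMul_right e₁ (moyalArg_hasTemperateGrowth θ), ← fourier_tens]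
  have h2 : ⟪W.PsiN (m + 1) (inj (Fin.cons (W.bar k) i : Fin (m + 1) → Fin K)
        (moyalS θ (tens (splitConf m) (conjS f) (conjS u)))), W.PsiN n (inj j g)⟫_ℂ =
      L₀ (expMul (fun ξ => -moyalArg θ (pr1 e₂ ξ))
        (𝓕 (tens e₁ u (tens (splitConf n) f g)))) := by
    rw [← conjS_conjS (moyalS θ (tens (splitConf m) (conjS f) (conjS u))), ← hL', ← hLL, hL₀,
      fourier_tens, conjS_moyalS, conjS_tens, conjS_conjS, conjS_conjS,
      tens_expMul_left e₂ (q := fun ξ => -moyalArg θ ξ) (moyalArg_hasTemperateGrowth θ).neg,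
      ← fourier_tens, ← tens_tens]
  rw [h1, h2]
  let q : Fin 4 → ConfOf (Fin m ⊕ Fin (n + 1)) → ℝ := fun ν ξ =>
    -(1 / 2) * ∑ μ, (2 * Real.pi * eta μ * ξ (.inr 0, μ)) * (eta μ * θ μ ν)
  have hq : ∀ ν, (q ν).HasTemperateGrowth := by
    intro ν
    refine (Function.HasTemperateGrowth.const (-(1 / 2) : ℝ)).mul (.sum fun μ _ => ?_)
    exact ((Function.HasTemperateGrowth.const (2 * Real.pi * eta μ)).mul
      (EuclideanSpace.proj (𝕜 := ℝ) ((Sum.inr 0, μ) :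
        (Fin m ⊕ Fin (n + 1)) × Fin 4)).hasTemperateGrowth).mul (.const _)
  -- The two phases differ by exp(i ∑ q_ν P_ν), a factor that L₀ does not see.
  rw [← clm_expMul_sum L₀ (P := totalMomentum) (q := q) totalMomentum_hasTemperateGrowth hq hinv₀
    (expMul (fun ξ => -moyalArg θ (pr1 e₂ ξ)) _)]
  congr 1
  ext ξ
  have t1 : (fun ξ => moyalArg θ (pr2 e₁ ξ)).HasTemperateGrowth :=
    (moyalArg_hasTemperateGrowth θ).comp (pr2 e₁).hasTemperateGrowth
  have t2 : (fun ξ => -moyalArg θ (pr1 e₂ ξ)).HasTemperateGrowth :=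
    ((moyalArg_hasTemperateGrowth θ).comp (pr1 e₂).hasTemperateGrowth).neg
  have t3 : (fun ξ => ∑ ν, q ν ξ * totalMomentum ν ξ).HasTemperateGrowth :=
    .sum fun ν _ => (hq ν).mul (totalMomentum_hasTemperateGrowth ν)
  have h3 : moyalArg θ (pr2 e₁ ξ) = -moyalArg θ (pr1 e₂ ξ) + ∑ ν, q ν ξ * totalMomentum ν ξ :=
    moyalArg_add_moyalArg hθ ξ
  rw [expMul_apply t1, expMul_apply t3, expMul_apply t2, h3, ← mul_assoc, ← Complex.exp_add,
    ← add_mul, ← Complex.ofReal_add, add_comm]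

/-- The adjoint relation of the deformed fields. -/
theorem inner_psiN_moyal {θ : Matrix (Fin 4) (Fin 4) ℝ} (hθ : θ.transpose = -θ) {m n : ℕ}
    (h : TestN K m) (f : Test K) (g : TestN K n) :
    ⟪W.PsiN m h, W.PsiN (n + 1) (moyal θ f g)⟫_ℂ =
      ⟪W.PsiN (m + 1) (moyal θ (starTest W.bar f) h), W.PsiN n g⟫_ℂ := by
  have key : ∀ (i : Fin m → Fin K) (k : Fin K) (j : Fin n → Fin K) (u : 𝓢(Conf m, ℂ))
      (f : 𝓢(E4, ℂ)) (g : 𝓢(Conf n, ℂ)),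
      ⟪W.PsiN m (inj i u), W.PsiN (n + 1) (moyal θ (inj k f) (inj j g))⟫_ℂ =
        ⟪W.PsiN (m + 1) (moyal θ (starTest W.bar (inj k f)) (inj i u)), W.PsiN n (inj j g)⟫_ℂ := by
    intro i k j u f g
    have := W.inner_psiN_moyalS hθ i k j (conjS u) f g
    rw [conjS_conjS, ← moyal_inj, ← moyal_inj] at this
    rw [this, starTest_inj W.bar_involutive]
  conv_lhs => rw [← sum_inj_cmp h, ← sum_inj_cmp f, ← sum_inj_cmp g]
  conv_rhs => rw [← sum_inj_cmp h, ← sum_inj_cmp f, ← sum_inj_cmp g]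
  simp only [← moyalLM_apply, map_sum, sum_inner, inner_sum, LinearMap.sum_apply] at key ⊢
  simp only [key]
  exact Finset.sum_congr rfl fun _ _ => Finset.sum_comm

end WightmanTheory

/-! ### The deformed field operators -/

namespace WightmanTheory

variable {K : ℕ} {H : Type*} [NormedAddCommGroup H] [InnerProductSpace ℂ H]
  (W : WightmanTheory K H) [CompleteSpace H] {θ : Matrix (Fin 4) (Fin 4) ℝ}

theorem moyalBU_single (θ : Matrix (Fin 4) (Fin 4) ℝ) (f : Test K) {n : ℕ} (g : TestN K n) :
    moyalBU θ f (DFinsupp.single n g) = DFinsupp.single (n + 1) (moyal θ f g) := by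
  simp [moyalBU]

theorem inner_psi_moyalBU (hθ : θ.transpose = -θ) (f : Test K) (h g : BU K) :
    ⟪W.Psi h, W.Psi (moyalBU θ f g)⟫_ℂ = ⟪W.Psi (moyalBU θ (starTest W.bar f) h), W.Psi g⟫_ℂ := by
  refine DFinsupp.induction (p := fun h => ⟪W.Psi h, W.Psi (moyalBU θ f g)⟫_ℂ =
    ⟪W.Psi (moyalBU θ (starTest W.bar f) h), W.Psi g⟫_ℂ) h (by simp only [map_zero, inner_zero_left])
    fun m h₀ h _ _ ih => ?_
  rw [map_add, map_add, map_add, inner_add_left, inner_add_left, ih]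
  congr 1
  refine DFinsupp.induction (p := fun g => ⟪W.Psi (DFinsupp.single m h₀), W.Psi (moyalBU θ f g)⟫_ℂ =
    ⟪W.Psi (moyalBU θ (starTest W.bar f) (DFinsupp.single m h₀)), W.Psi g⟫_ℂ) g
    (by simp only [map_zero, inner_zero_right]) fun n g₀ g _ _ ih => ?_
  rw [map_add, map_add, map_add, inner_add_right, inner_add_right, ih]
  congr 1
  rw [moyalBU_single, moyalBU_single, psi_single, psi_single, psi_single, psi_single,
    W.inner_psiN_moyal hθ]

theorem eq_zero_of_inner_psi {v : H} (hv : ∀ h, ⟪W.Psi h, v⟫_ℂ = 0) : v = 0 := by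
  refine W.dense_DD.eq_zero_of_inner_right (𝕜 := ℂ) fun u hu => ?_
  rw [← range_psi] at hu
  obtain ⟨h, rfl⟩ := hu
  exact hv h

/-- By the adjoint relation the vector is orthogonal to 𝒟. In other words, the graph that defines
φ^θ(f) is single-valued. -/
theorem psi_moyalBU_eq_zero (hθ : θ.transpose = -θ) (f : Test K) {g : BU K} (hg : W.Psi g = 0) :
    W.Psi (moyalBU θ f g) = 0 :=
  W.eq_zero_of_inner_psi fun h => by rw [W.inner_psi_moyalBU hθ, hg, inner_zero_right]

theorem psi_mem_domain (f : Test K) (g : BU K) : W.Psi g ∈ (W.deformedField θ f).domain :=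
  ⟨_, ⟨g, rfl⟩, rfl⟩

theorem DD_le_domain (f : Test K) : W.DD ≤ (W.deformedField θ f).domain := by
  rw [← range_psi]
  rintro _ ⟨g, rfl⟩
  exact W.psi_mem_domain f g

theorem deformedField_psi (hθ : θ.transpose = -θ) (f : Test K) (g : BU K)
    (hg : W.Psi g ∈ (W.deformedField θ f).domain) :
    W.deformedField θ f ⟨W.Psi g, hg⟩ = W.Psi (moyalBU θ f g) := by
  have h0 : ∀ x ∈ LinearMap.range (W.Psi.prod (W.Psi ∘ₗ moyalBU θ f)), x.1 = 0 → x.2 = 0 := by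
    rintro _ ⟨g, rfl⟩ h
    exact W.psi_moyalBU_eq_zero hθ f h
  obtain ⟨g', hg'⟩ := Submodule.mem_graph_toLinearPMap h0 ⟨W.Psi g, hg⟩
  have h1 : W.Psi g' = W.Psi g := congrArg Prod.fst hg'
  have h2 : W.Psi (moyalBU θ f g') = W.deformedField θ f ⟨W.Psi g, hg⟩ := congrArg Prod.snd hg'
  rw [← h2, ← sub_eq_zero, ← map_sub, ← map_sub]
  exact W.psi_moyalBU_eq_zero hθ f (by rw [map_sub, h1, sub_self])

theorem exists_psi_of_mem_domain (f : Test K) {v : H} (hv : v ∈ (W.deformedField θ f).domain) :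
    ∃ g, W.Psi g = v := by
  obtain ⟨_, ⟨g, rfl⟩, hg⟩ := hv
  exact ⟨g, hg⟩

theorem continuous_psi_moyalBU (g : BU K) : Continuous fun f => W.Psi (moyalBU θ f g) := by
  refine DFinsupp.induction (p := fun g => Continuous fun f => W.Psi (moyalBU θ f g)) g
    (by simpa only [map_zero] using continuous_const) fun n g₀ g _ _ ih => ?_
  simp only [map_add, moyalBU_single, psi_single]
  exact ((W.PsiN (n + 1)).continuous.comp (continuous_moyal_left θ g₀)).add ih

/-- The map `f ↦ Ψ(f ⊗_θ g)`. -/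
def fieldCLM (θ : Matrix (Fin 4) (Fin 4) ℝ) (g : BU K) : Test K →L[ℂ] H where
  toFun f := W.Psi (moyalBU θ f g)
  map_add' f f' := by
    refine DFinsupp.induction (p := fun g => W.Psi (moyalBU θ (f + f') g) =
      W.Psi (moyalBU θ f g) + W.Psi (moyalBU θ f' g)) g (by simp only [map_zero, add_zero])
      fun n g₀ g _ _ ih => ?_
    simp only [map_add, moyalBU_single, psi_single, ih, ← moyalLM_apply, LinearMap.add_apply]
    abel
  map_smul' c f := by
    refine DFinsupp.induction (p := fun g => W.Psi (moyalBU θ (c • f) g) =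
      c • W.Psi (moyalBU θ f g)) g (by simp only [map_zero, smul_zero]) fun n g₀ g _ _ ih => ?_
    simp only [map_add, moyalBU_single, psi_single, ih, ← moyalLM_apply, map_smul, LinearMap.smul_apply,
      smul_add]
  cont := W.continuous_psi_moyalBU g

theorem exists_clm_inner_deformedField (hθ : θ.transpose = -θ) (ψ : H) {ψ' : H} (hψ' : ψ' ∈ W.DD) :
    ∃ T : Test K →L[ℂ] ℂ, ∀ (f : Test K) (h : ψ' ∈ (W.deformedField θ f).domain),
      T f = ⟪ψ, W.deformedField θ f ⟨ψ', h⟩⟫_ℂ := by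
  rw [← range_psi] at hψ'
  obtain ⟨g, rfl⟩ := hψ'
  refine ⟨innerSL ℂ ψ ∘L W.fieldCLM θ g, fun f h => ?_⟩
  rw [W.deformedField_psi hθ]
  rfl

theorem deformedField_star_le_adjoint (hθ : θ.transpose = -θ) (f : Test K) :
    W.deformedField θ (starTest W.bar f) ≤ (W.deformedField θ f).adjoint := by
  refine LinearPMap.IsFormalAdjoint.le_adjoint (W.dense_DD.mono (W.DD_le_domain f)) ?_
  rintro ⟨x, hx⟩ ⟨y, hy⟩
  obtain ⟨g, rfl⟩ := W.exists_psi_of_mem_domain f hx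
  obtain ⟨h, rfl⟩ := W.exists_psi_of_mem_domain _ hy
  rw [W.deformedField_psi hθ, W.deformedField_psi hθ]
  simp only
  rw [W.inner_psi_moyalBU hθ, W.starTest_starTest]

end WightmanTheory

/-! ### One-sided Fourier transforms of functions that vanish on an interval -/

section Cauchy

/-- The real points of modulus at least `δ`. -/
def outerReals (δ : ℝ) : Set ℂ := (fun t : ℝ => (t : ℂ)) '' {t | δ ≤ |t|}

theorem isClosed_outerReals (δ : ℝ) : IsClosed (outerReals δ) :=
  Complex.isometry_ofReal.isClosedEmbedding.isClosedMap _ (isClosed_le continuous_const continuous_abs)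

/-- The gap |t| < δ joins the two half planes to one connected domain, so a zero of the Cauchy
transform can propagate from one to the other. -/
theorem starConvex_compl_outerReals {δ : ℝ} (hδ : 0 < δ) : StarConvex ℝ 0 (outerReals δ)ᶜ := by
  rw [starConvex_zero_iff]
  rintro w hw s hs0 hs1 ⟨t, ht, he⟩
  have ht' : δ ≤ |t| := ht
  rcases hs0.eq_or_lt with rfl | hs
  · have : t = 0 := by simpa using he
    rw [this, abs_zero] at ht'
    linarith
  · refine hw ⟨t / s, ?_, ?_⟩
    · change δ ≤ |t / s|
      rw [abs_div, abs_of_pos hs, le_div_iff₀ hs]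
      nlinarith
    · have hs' : (s : ℂ) ≠ 0 := by exact_mod_cast hs.ne'
      have he' : (t : ℂ) = s * w := by simpa using he
      change ((t / s : ℝ) : ℂ) = w
      push_cast
      rw [he']
      field_simp

/-- The Cauchy transform. -/
def cauchy (k : ℝ → ℂ) (w : ℂ) : ℂ := ∫ t, k t * (t - w)⁻¹

variable {k : ℝ → ℂ} {δ : ℝ}

theorem exists_bound_of_notMem_outerReals {w₀ : ℂ} (hw₀ : w₀ ∉ outerReals δ) :
    ∃ c > 0, ∀ w ∈ Metric.ball w₀ c, ∀ t : ℝ, δ ≤ |t| → c ≤ ‖(t : ℂ) - w‖ := by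
  obtain ⟨c, hc, hb⟩ := Metric.isOpen_iff.1 (isClosed_outerReals δ).isOpen_compl w₀ hw₀
  refine ⟨c / 2, by positivity, fun w hw t ht => ?_⟩
  have h1 : c ≤ ‖(t : ℂ) - w₀‖ := by
    by_contra! hlt
    exact hb (by rwa [Metric.mem_ball, dist_eq_norm]) ⟨t, ht, rfl⟩
  have h2 : ‖w - w₀‖ < c / 2 := by rwa [Metric.mem_ball, dist_eq_norm] at hw
  have h3 : ‖(t : ℂ) - w₀‖ ≤ ‖(t : ℂ) - w‖ + ‖w - w₀‖ := by
    calc ‖(t : ℂ) - w₀‖ = ‖((t : ℂ) - w) + (w - w₀)‖ := by congr 1; ring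
      _ ≤ _ := norm_add_le _ _
  linarith

theorem norm_mul_inv_pow_le (hk0 : ∀ t, |t| < δ → k t = 0) {c : ℝ} (hc : 0 < c) {w : ℂ}
    (hw : ∀ t : ℝ, δ ≤ |t| → c ≤ ‖(t : ℂ) - w‖) (m : ℕ) (t : ℝ) :
    ‖k t * (((t : ℂ) - w) ^ m)⁻¹‖ ≤ ‖k t‖ * (c ^ m)⁻¹ := by
  rcases lt_or_ge |t| δ with h | h
  · rw [hk0 t h]
    simp
  · rw [norm_mul, norm_inv, norm_pow]
    gcongr
    exact hw t h

theorem integrable_cauchy (hk : Continuous k) (hi : Integrable k) (hk0 : ∀ t, |t| < δ → k t = 0)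
    {w : ℂ} (hw : w ∉ outerReals δ) : Integrable fun t => k t * ((t : ℂ) - w)⁻¹ := by
  obtain ⟨c, hc, hb⟩ := exists_bound_of_notMem_outerReals hw
  refine (hi.norm.mul_const (c ^ 1)⁻¹).mono' ?_ (Eventually.of_forall fun t => ?_)
  · exact (hk.measurable.mul
      ((Complex.continuous_ofReal.sub continuous_const).measurable.inv)).aestronglyMeasurable
  · have := norm_mul_inv_pow_le hk0 hc (hb w (Metric.mem_ball_self hc)) 1 t
    rwa [pow_one] at this

theorem differentiableOn_cauchy (hk : Continuous k) (hi : Integrable k)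
    (hk0 : ∀ t, |t| < δ → k t = 0) : DifferentiableOn ℂ (cauchy k) (outerReals δ)ᶜ := by
  intro w₀ hw₀
  obtain ⟨c, hc, hb⟩ := exists_bound_of_notMem_outerReals hw₀
  have hm : ∀ w m, AEStronglyMeasurable (fun t : ℝ => k t * (((t : ℂ) - w) ^ m)⁻¹) volume :=
    fun w m => (hk.measurable.mul
      (((Complex.continuous_ofReal.sub continuous_const).pow m).measurable.inv)).aestronglyMeasurable
  have h := hasDerivAt_integral_of_dominated_loc_of_deriv_le (μ := volume) (x₀ := w₀)
    (F := fun w (t : ℝ) => k t * ((t : ℂ) - w)⁻¹) (F' := fun w (t : ℝ) => k t * (((t : ℂ) - w) ^ 2)⁻¹)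
    (bound := fun t => ‖k t‖ * (c ^ 2)⁻¹)
    (Metric.ball_mem_nhds w₀ hc)
    (Eventually.of_forall fun w => by simpa using hm w 1)
    (integrable_cauchy hk hi hk0 hw₀) (hm w₀ 2)
    (Eventually.of_forall fun t w hw => norm_mul_inv_pow_le hk0 hc (hb w hw) 2 t)
    (hi.norm.mul_const _)
    (Eventually.of_forall fun t w hw => by
      rcases lt_or_ge |t| δ with h | h
      · simp only [hk0 t h, zero_mul]
        exact hasDerivAt_const _ _
      · have hne : (t : ℂ) - w ≠ 0 := norm_pos_iff.1 (hc.trans_le (hb w hw t h))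
        have := (((hasDerivAt_id w).const_sub (t : ℂ)).inv hne).const_mul (k t)
        refine this.congr_deriv ?_
        simp)
  exact h.2.differentiableAt.differentiableWithinAt

/-- For Im w < 0 the kernel (t - w)⁻¹ equals -2πi ∫ exp(2πi (t - w) a) da over a > 0, a
superposition of exponentials against which k integrates to zero. -/
theorem cauchy_eq_zero_of_im_neg (hi : Integrable k)
    (hside : ∀ a : ℝ, 0 ≤ a → ∫ t : ℝ, Complex.exp (2 * Real.pi * a * t * Complex.I) * k t = 0)
    {w : ℂ} (hw : w.im < 0) : cauchy k w = 0 := by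
  have hpi := Real.pi_pos
  let z : ℝ → ℂ := fun t => 2 * Real.pi * Complex.I * (t - w)
  have hz : ∀ t, (z t).re = 2 * Real.pi * w.im := by
    intro t
    simp [z]
  have hzneg : ∀ t, (z t).re < 0 := fun t => by rw [hz]; nlinarith
  have hinner : ∀ t : ℝ, k t * ((t : ℂ) - w)⁻¹ =
      (-(2 * Real.pi * Complex.I)) * ∫ a in Set.Ioi (0 : ℝ), k t * Complex.exp (z t * a) := by
    intro t
    rw [integral_const_mul, integral_exp_mul_complex_Ioi (hzneg t)]
    have h1 : (t : ℂ) - w ≠ 0 := by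
      intro h
      have := congrArg Complex.im h
      simp at this
      linarith
    have h2 : (Real.pi : ℂ) ≠ 0 := by exact_mod_cast hpi.ne'
    simp only [z, Complex.ofReal_zero, mul_zero, Complex.exp_zero]
    field_simp [Complex.I_ne_zero]
  have hint : Integrable (Function.uncurry fun (t a : ℝ) => k t * Complex.exp (z t * a))
      (volume.prod (volume.restrict (Set.Ioi (0 : ℝ)))) := by
    have h1 : Integrable (fun p : ℝ × ℝ => ‖k p.1‖ * Real.exp (2 * Real.pi * w.im * p.2))
        (volume.prod (volume.restrict (Set.Ioi (0 : ℝ)))) :=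
      hi.norm.mul_prod (integrableOn_exp_mul_Ioi (by nlinarith) 0)
    refine h1.mono' ?_ (Eventually.of_forall fun p => ?_)
    · refine hi.aestronglyMeasurable.comp_fst.mul ?_
      refine Continuous.aestronglyMeasurable ?_
      fun_prop
    · simp only [Function.uncurry]
      rw [norm_mul, Complex.norm_exp]
      have : (z p.1 * p.2).re = 2 * Real.pi * w.im * p.2 := by
        rw [Complex.re_mul_ofReal, hz]
      rw [this]
  rw [cauchy]
  simp only [hinner]
  rw [integral_const_mul, integral_integral_swap hint]
  refine mul_eq_zero_of_right _ (setIntegral_eq_zero_of_forall_eq_zero fun a ha => ?_)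
  have h3 : ∀ t : ℝ, k t * Complex.exp (z t * a) = Complex.exp (-(2 * Real.pi * Complex.I * w * a)) *
      (Complex.exp (2 * Real.pi * a * t * Complex.I) * k t) := by
    intro t
    rw [← mul_assoc, ← Complex.exp_add, mul_comm]
    congr 2
    simp only [z]
    ring
  simp only [h3]
  rw [integral_const_mul, hside a (le_of_lt ha), mul_zero]

/-- The Poisson kernel of width 1 / c is an approximate identity. -/
theorem poisson_tendsto (hk : Continuous k) (hi : Integrable k) (t₀ : ℝ) :
    Tendsto (fun c : ℝ => ∫ t, ((c * (Real.pi⁻¹ * (1 + (c * (t₀ - t)) ^ 2)⁻¹) : ℝ) : ℂ) * k t) atTop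
      (𝓝 (k t₀)) := by
  have h := tendsto_integral_comp_smul_smul_of_integrable' (μ := volume) (x₀ := t₀)
    (φ := fun x : ℝ => Real.pi⁻¹ * (1 + x ^ 2)⁻¹) (fun x => by positivity)
    (by rw [integral_const_mul, integral_univ_inv_one_add_sq, inv_mul_cancel₀ Real.pi_pos.ne'])
    (by
      rw [Module.finrank_self]
      simp only [pow_one]
      refine squeeze_zero (g := fun x : ℝ => Real.pi⁻¹ * ‖x‖⁻¹) (fun x => by positivity)
        (fun x => ?_) ?_
      · rw [← mul_assoc, mul_comm ‖x‖, mul_assoc]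
        refine mul_le_mul_of_nonneg_left ?_ (by positivity)
        rcases eq_or_ne x 0 with rfl | hx
        · simp
        · have hx' : 0 < ‖x‖ := norm_pos_iff.2 hx
          rw [← div_eq_mul_inv, div_le_iff₀ (by positivity), inv_mul_eq_div, le_div_iff₀ hx',
            Real.norm_eq_abs, ← sq, sq_abs]
          linarith
      · have := (tendsto_inv_atTop_zero.comp (tendsto_norm_cobounded_atTop (E := ℝ))).const_mul
          Real.pi⁻¹
        simpa using! this)
    hi hk.continuousAt
  simp only [Module.finrank_self, pow_one, smul_eq_mul, Complex.real_smul] at h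
  exact h

/-- An integrable function whose Fourier transform vanishes on a half line and that vanishes on an
interval is zero. -/
theorem eq_zero_of_fourier_halfLine (hk : Continuous k) (hi : Integrable k) (hδ : 0 < δ)
    (hk0 : ∀ t, |t| < δ → k t = 0)
    (hside : ∀ a : ℝ, 0 ≤ a → ∫ t : ℝ, Complex.exp (2 * Real.pi * a * t * Complex.I) * k t = 0) :
    k = 0 := by
  have hopen := (isClosed_outerReals δ).isOpen_compl
  have him : ∀ w : ℂ, w.im ≠ 0 → w ∈ (outerReals δ)ᶜ := by
    rintro w hw ⟨t, -, rfl⟩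
    exact hw (Complex.ofReal_im t)
  have hI : (-Complex.I) ∈ (outerReals δ)ᶜ := him _ (by simp)
  have han : AnalyticOnNhd ℂ (cauchy k) (outerReals δ)ᶜ :=
    (differentiableOn_cauchy hk hi hk0).analyticOnNhd hopen
  have hne : (0 : ℂ) ∈ (outerReals δ)ᶜ := by
    rintro ⟨t, ht, h⟩
    have ht' : δ ≤ |t| := ht
    have : t = 0 := by simpa using h
    rw [this, abs_zero] at ht'
    linarith
  have hpre : IsPreconnected (outerReals δ)ᶜ :=
    ((starConvex_compl_outerReals hδ).isPathConnected hne).isConnected.isPreconnected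
  have hev : cauchy k =ᶠ[𝓝 (-Complex.I)] 0 := by
    have : {w : ℂ | w.im < 0} ∈ 𝓝 (-Complex.I) :=
      (isOpen_lt Complex.continuous_im continuous_const).mem_nhds (by simp)
    filter_upwards [this] with w hw
    exact cauchy_eq_zero_of_im_neg hi hside hw
  -- By the identity theorem the Cauchy transform, zero in the lower half plane, also vanishes in
  -- the upper one.
  have hzero := han.eqOn_zero_of_preconnected_of_eventuallyEq_zero hpre hI hev
  funext t₀
  refine tendsto_nhds_unique (poisson_tendsto hk hi t₀) ?_
  refine Tendsto.congr' ?_ tendsto_const_nhds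
  filter_upwards [eventually_gt_atTop 0] with c hc
  have hc0 : (c : ℂ) ≠ 0 := by exact_mod_cast hc.ne'
  set w₁ : ℂ := t₀ + (c : ℂ)⁻¹ * Complex.I with hw₁
  set w₂ : ℂ := t₀ - (c : ℂ)⁻¹ * Complex.I with hw₂
  have i1 : w₁.im = c⁻¹ := by
    simp [hw₁, ← Complex.ofReal_inv]
  have i2 : w₂.im = -c⁻¹ := by
    simp [hw₂, ← Complex.ofReal_inv]
  have m1 : w₁ ∈ (outerReals δ)ᶜ := him _ (by rw [i1]; positivity)
  have m2 : w₂ ∈ (outerReals δ)ᶜ := him _ (by rw [i2, neg_ne_zero]; positivity)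
  have h1 : cauchy k w₁ = 0 := hzero m1
  have h2 : cauchy k w₂ = 0 := hzero m2
  -- The Poisson kernel is the difference of the Cauchy kernels at t₀ ± i / c, up to the factor 2πi.
  have hpt : ∀ t : ℝ, ((c * (Real.pi⁻¹ * (1 + (c * (t₀ - t)) ^ 2)⁻¹) : ℝ) : ℂ) * k t =
      (2 * Real.pi * Complex.I)⁻¹ * (k t * ((t : ℂ) - w₁)⁻¹ - k t * ((t : ℂ) - w₂)⁻¹) := by
    intro t
    have n1 : (t : ℂ) - w₁ ≠ 0 := by
      intro h
      have := congrArg Complex.im h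
      rw [Complex.sub_im, i1, Complex.ofReal_im, Complex.zero_im] at this
      have := inv_pos.2 hc
      linarith
    have n2 : (t : ℂ) - w₂ ≠ 0 := by
      intro h
      have := congrArg Complex.im h
      rw [Complex.sub_im, i2, Complex.ofReal_im, Complex.zero_im] at this
      have := inv_pos.2 hc
      linarith
    have hpi : (Real.pi : ℂ) ≠ 0 := by exact_mod_cast Real.pi_pos.ne'
    have n3 : (1 + ((c : ℂ) * (t₀ - t)) ^ 2) ≠ 0 := by
      have : (0 : ℝ) < 1 + (c * (t₀ - t)) ^ 2 := by positivity
      exact_mod_cast this.ne'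
    have hprod : ((t : ℂ) - w₁) * ((t : ℂ) - w₂) = (1 + ((c : ℂ) * (t₀ - t)) ^ 2) / c ^ 2 := by
      rw [hw₁, hw₂]
      field_simp
      ring_nf
      rw [Complex.I_sq]
      ring
    have hdiff : ((t : ℂ) - w₁)⁻¹ - ((t : ℂ) - w₂)⁻¹ =
        2 * Complex.I * c * (1 + ((c : ℂ) * (t₀ - t)) ^ 2)⁻¹ := by
      rw [inv_sub_inv n1 n2, hprod]
      rw [hw₁, hw₂]
      field_simp
      ring
    rw [← mul_sub, hdiff]
    push_cast
    field_simp [Complex.I_ne_zero]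
  simp only [hpt]
  rw [integral_const_mul, integral_sub (integrable_cauchy hk hi hk0 m1)
    (integrable_cauchy hk hi hk0 m2)]
  change _ = _ * (cauchy k w₁ - cauchy k w₂)
  rw [h1, h2, sub_zero, mul_zero]
  rfl

end Cauchy

/-! ### Smearing along a line -/

section Line

variable {V F : Type*} [NormedAddCommGroup V] [InnerProductSpace ℝ V] [FiniteDimensional ℝ V]
  [MeasurableSpace V] [BorelSpace V] [NormedAddCommGroup F] [NormedSpace ℂ F] [CompleteSpace F]

theorem norm_le_sn_mul_inv (f : 𝓢(V, F)) (N : ℕ) (x : V) :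
    ‖f x‖ ≤ 2 ^ N * sn N 0 f * ((1 + ‖x‖) ^ N)⁻¹ := by
  have h := le_sn (le_refl N) (le_refl 0) f x
  rw [norm_iteratedFDeriv_zero] at h
  rw [← div_eq_mul_inv, le_div_iff₀ (by positivity), mul_comm]
  exact h

theorem integrable_norm_mul_pow (f : 𝓢(V, F)) (N : ℕ) :
    Integrable fun x => ‖f x‖ * (1 + ‖x‖) ^ N := by
  set d := Module.finrank ℝ V + 1
  refine ((integrable_inv_one_add_norm_pow (V := V) (N := d) (Nat.lt_succ_self _)).const_mul
    (2 ^ (N + d) * sn (N + d) 0 f)).mono' ?_ (Eventually.of_forall fun x => ?_)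
  · exact (f.continuous.norm.mul ((continuous_const.add continuous_norm).pow N)).aestronglyMeasurable
  · rw [Real.norm_of_nonneg (by positivity)]
    calc _ ≤ 2 ^ (N + d) * sn (N + d) 0 f * ((1 + ‖x‖) ^ (N + d))⁻¹ * (1 + ‖x‖) ^ N := by
          gcongr
          exact norm_le_sn_mul_inv f (N + d) x
      _ = _ := by
          rw [pow_add (1 + ‖x‖)]
          field_simp

theorem fourier_famMul_expFun (u : 𝓢(V, ℂ)) (a ξ : V) :
    𝓕 (famMul ℂ expFun a u) ξ = 𝓕 u (ξ - a) := by
  rw [SchwartzMap.fourier_coe, SchwartzMap.fourier_coe, Real.fourier_eq', Real.fourier_eq']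
  congr 1
  funext x
  rw [famMul_apply expFun_hasTemperateGrowth, smul_smul, expFun, ← Complex.exp_add, inner_sub_right,
    real_inner_comm x a]
  congr 2
  push_cast
  ring

theorem lineMultiplier_hasTemperateGrowth (d : V) (χ : 𝓢(ℝ, ℂ)) :
    (fun ξ : V => 𝓕 χ ⟪d, ξ⟫_ℝ).HasTemperateGrowth :=
  (𝓕 χ).hasTemperateGrowth.comp (innerSL ℝ d).hasTemperateGrowth

/-- The smearing `x ↦ ∫ χ(t) f(x - t d) dt` of a test function along a line. -/
def lineSmear (d : V) (χ : 𝓢(ℝ, ℂ)) : 𝓢(V, F) →L[ℂ] 𝓢(V, F) :=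
  FourierTransform.fourierInvCLM ℂ 𝓢(V, F) ∘L
    SchwartzMap.smulLeftCLM F (fun ξ : V => 𝓕 χ ⟪d, ξ⟫_ℝ) ∘L
    FourierTransform.fourierCLM ℂ 𝓢(V, F)

theorem fourier_lineSmear (d : V) (χ : 𝓢(ℝ, ℂ)) (f : 𝓢(V, F)) (ξ : V) :
    𝓕 (lineSmear d χ f) ξ = 𝓕 χ ⟪d, ξ⟫_ℝ • 𝓕 f ξ := by
  have h : 𝓕 (lineSmear d χ f) =
      SchwartzMap.smulLeftCLM F (fun ξ : V => 𝓕 χ ⟪d, ξ⟫_ℝ) (𝓕 f) :=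
    FourierTransform.fourier_fourierInv_eq _
  rw [h, SchwartzMap.smulLeftCLM_apply_apply (lineMultiplier_hasTemperateGrowth d χ)]

theorem integral_expFun_smul_fourier (f : 𝓢(V, F)) (x : V) :
    ∫ ξ, expFun (ξ, x) • 𝓕 f ξ = f x := by
  have h : 𝓕⁻ (𝓕 f) = f := FourierTransform.fourierInv_fourier_eq f
  conv_rhs => rw [← h]
  rw [SchwartzMap.fourierInv_coe, Real.fourierInv_eq']
  rfl

/-- Fubini and Fourier inversion turn the multiplier into an average of translates. The definition
by a multiplier gives the Schwartz property without further work. -/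
theorem lineSmear_apply (d : V) (χ : 𝓢(ℝ, ℂ)) (f : 𝓢(V, F)) (x : V) :
    lineSmear d χ f x = ∫ t, (χ t • trans (t • d) f) x := by
  rw [← integral_expFun_smul_fourier (lineSmear d χ f) x]
  have h1 : ∀ ξ, expFun (ξ, x) • 𝓕 (lineSmear d χ f) ξ =
      ∫ t, χ t • expFun (ξ, x - t • d) • 𝓕 f ξ := by
    intro ξ
    rw [fourier_lineSmear, SchwartzMap.fourier_coe, Real.fourier_eq', ← smul_assoc, smul_eq_mul,
      ← integral_const_mul, ← integral_smul_const]
    congr 1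
    funext t
    have key : expFun (ξ, x - t • d) =
        expFun (ξ, x) * Complex.exp ((-2 * Real.pi * ⟪t, ⟪d, ξ⟫_ℝ⟫_ℝ : ℝ) * Complex.I) := by
      simp only [expFun]
      rw [← Complex.exp_add, inner_sub_right, real_inner_smul_right, real_inner_comm d ξ]
      congr 1
      simp only [RCLike.inner_apply, conj_trivial]
      push_cast
      ring
    rw [key, smul_smul, smul_eq_mul]
    congr 1
    ring
  have hint : Integrable (Function.uncurry fun (ξ : V) (t : ℝ) =>
      χ t • expFun (ξ, x - t • d) • 𝓕 f ξ) (volume.prod volume) := by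
    have h2 : Integrable (fun p : V × ℝ => ‖𝓕 f p.1‖ * ‖χ p.2‖) (volume.prod volume) :=
      (𝓕 f).integrable.norm.mul_prod χ.integrable.norm
    refine h2.mono' ?_ (Eventually.of_forall fun p => ?_)
    · refine Continuous.aestronglyMeasurable ?_
      refine (χ.continuous.comp continuous_snd).smul (Continuous.smul ?_
        ((𝓕 f).continuous.comp continuous_fst))
      exact (expFun_hasTemperateGrowth (V := V)).1.continuous.comp
        (continuous_fst.prodMk (continuous_const.sub (continuous_snd.smul continuous_const)))
    · simp only [Function.uncurry]
      rw [norm_smul, norm_smul, norm_expFun, one_mul, mul_comm]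
  simp only [h1]
  rw [integral_integral_swap hint]
  congr 1
  funext t
  rw [integral_smul, integral_expFun_smul_fourier]
  rfl

theorem one_add_norm_smul_pow_le (d : V) (t : ℝ) (N : ℕ) :
    (1 + ‖t • d‖) ^ N ≤ (1 + ‖d‖) ^ N * (1 + ‖t‖) ^ N := by
  rw [← mul_pow, norm_smul]
  gcongr
  nlinarith [norm_nonneg t, norm_nonneg d, mul_nonneg (norm_nonneg t) (norm_nonneg d)]

theorem continuous_trans_line (d : V) (f : 𝓢(V, F)) : Continuous fun t : ℝ => trans (t • d) f :=
  (continuous_trans (V := V) (F := F)).comp (f := fun t : ℝ => (t • d, f))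
    ((continuous_id.smul continuous_const).prodMk continuous_const)

theorem clm_lineSmear {H : Type*} [NormedAddCommGroup H] [NormedSpace ℂ H] [CompleteSpace H]
    (T : 𝓢(V, F) →L[ℂ] H) (d : V) (χ : 𝓢(ℝ, ℂ)) (f : 𝓢(V, F)) :
    T (lineSmear d χ f) = ∫ t, χ t • T (trans (t • d) f) := by
  have hγ : Continuous fun t : ℝ => χ t • trans (t • d) f :=
    χ.continuous.smul (continuous_trans_line d f)
  have hi : ∀ k n, Integrable fun t : ℝ => sn k n (χ t • trans (t • d) f) := by
    intro k n
    obtain ⟨N, k', n', C, hC, hb⟩ := trans_bound (V := V) (F := F) k n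
    have hS : 0 ≤ sn k' n' f := apply_nonneg _ _
    refine ((integrable_norm_mul_pow χ N).mul_const (C * (1 + ‖d‖) ^ N * sn k' n' f)).mono'
      ((continuous_sn k n).comp hγ).aestronglyMeasurable (Eventually.of_forall fun t => ?_)
    rw [Real.norm_of_nonneg (apply_nonneg _ _), map_smul_eq_mul]
    calc _ ≤ ‖χ t‖ * (C * ((1 + ‖d‖) ^ N * (1 + ‖t‖) ^ N) * sn k' n' f) := by
          gcongr
          refine (hb (t • d) f).trans ?_
          gcongr
          exact one_add_norm_smul_pow_le d t N
      _ = _ := by ring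
  have := (clm_integral (μ := volume) T hγ hi (f := lineSmear d χ f)
    (fun x => lineSmear_apply d χ f x)).2
  simpa using this

end Line

/-! ### Continuation for polynomially bounded functions -/

section OneSided

/-- A polynomially bounded continuous function that vanishes on an interval and whose Fourier
transform vanishes on a half line is zero. -/
theorem eq_zero_of_oneSided {g : ℝ → ℂ} (hg : Continuous g) {C : ℝ} {N : ℕ}
    (hb : ∀ t, ‖g t‖ ≤ C * (1 + ‖t‖) ^ N) {δ : ℝ} (hδ : 0 < δ) (hg0 : ∀ t, |t| < δ → g t = 0)
    (h : ∀ χ : 𝓢(ℝ, ℂ), (∀ ξ ≤ 0, 𝓕 χ ξ = 0) → ∫ t, χ t * g t = 0) (t₀ : ℝ) : g t₀ = 0 := by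
  -- The bump lives on [0, 4], so its inverse Fourier transform E has one-sided spectrum, and E(0) =
  -- ∫ β > 0. The factor E(t - t₀) makes g integrable and keeps its value at t₀ up to the nonzero
  -- factor E(0).
  let b : ContDiffBump (2 : ℝ) := ⟨1, 2, one_pos, one_lt_two⟩
  have hbs : HasCompactSupport fun x => (b x : ℂ) :=
    b.hasCompactSupport.comp_left (g := fun t : ℝ => (t : ℂ)) (by simp)
  let β : 𝓢(ℝ, ℂ) := hbs.toSchwartzMap (Complex.ofRealCLM.contDiff.comp b.contDiff)
  have hβ : ∀ x, β x = (b x : ℂ) := fun x => rfl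
  let E : 𝓢(ℝ, ℂ) := 𝓕⁻ β
  have hE : 𝓕 E = β := FourierTransform.fourier_fourierInv_eq β
  have hE0 : E 0 ≠ 0 := by
    have h1 : E 0 = ∫ x, β x := by
      change (𝓕⁻ β : 𝓢(ℝ, ℂ)) 0 = _
      rw [SchwartzMap.fourierInv_coe, Real.fourierInv_eq']
      simp
    simp only [h1, hβ]
    rw [integral_complex_ofReal]
    have : 0 < ∫ x, b x := b.integral_pos
    exact_mod_cast this.ne'
  have hEneg : ∀ ξ ≤ 0, 𝓕 E ξ = 0 := by
    intro ξ hξ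
    rw [hE, hβ, b.zero_of_le_dist, Complex.ofReal_zero]
    change (2 : ℝ) ≤ dist ξ 2
    rw [Real.dist_eq, abs_of_nonpos (by linarith)]
    linarith
  let k : ℝ → ℂ := fun t => trans t₀ E t * g t
  have hkc : Continuous k := (trans t₀ E).continuous.mul hg
  have hki : Integrable k := by
    refine ((integrable_norm_mul_pow (trans t₀ E) N).mul_const C).mono' hkc.aestronglyMeasurable
      (Eventually.of_forall fun t => ?_)
    rw [norm_mul]
    calc _ ≤ ‖trans t₀ E t‖ * (C * (1 + ‖t‖) ^ N) := by gcongr; exact hb t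
      _ = _ := by ring
  have hk0 : ∀ t, |t| < δ → k t = 0 := fun t ht => by simp only [k, hg0 t ht, mul_zero]
  -- Modulation by a ≥ 0 shifts the Fourier transform of the window to the right, so the modulated
  -- window is still admissible in h.
  have hside : ∀ a : ℝ, 0 ≤ a →
      ∫ t : ℝ, Complex.exp (2 * Real.pi * a * t * Complex.I) * k t = 0 := by
    intro a ha
    have h1 := h (famMul ℂ expFun a (trans t₀ E)) fun ξ hξ => by
      rw [fourier_famMul_expFun, fourier_trans, hEneg _ (by linarith), smul_zero]
    rw [← h1]
    congr 1
    funext t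
    rw [famMul_apply expFun_hasTemperateGrowth, expFun, smul_eq_mul]
    simp only [k]
    rw [← mul_assoc]
    congr 3
    simp only [RCLike.inner_apply, conj_trivial]
    push_cast
    ring
  have hz := congrFun (eq_zero_of_fourier_halfLine hkc hki hδ hk0 hside) t₀
  simp only [k, trans_apply, sub_self, Pi.zero_apply, mul_eq_zero] at hz
  exact hz.resolve_left hE0

end OneSided

/-! ### The spectrum condition along a line -/

namespace WightmanTheory

variable {K : ℕ} {H : Type*} [NormedAddCommGroup H] [InnerProductSpace ℂ H]
  (W : WightmanTheory K H)

theorem translate_add (y y' : E4) (v : H) : W.U (y + y') 1 v = W.U y 1 (W.U y' 1 v) := by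
  rw [W.U_mul, lorentz_one, one_mul]
  congr 3
  simp [Matrix.toEuclideanLin]

theorem continuous_translate (v : H) : Continuous fun y => W.U y 1 v :=
  (W.U_continuous v).comp (continuous_id.prodMk continuous_const)

variable [CompleteSpace H]

theorem integrable_smul_translate (f : 𝓢(E4, ℂ)) (v : H) :
    Integrable fun y => f y • W.U y 1 v := by
  refine (f.integrable.norm.mul_const ‖v‖).mono'
    (f.continuous.smul (W.continuous_translate v)).aestronglyMeasurable
    (Eventually.of_forall fun y => ?_)
  rw [norm_smul, LinearIsometryEquiv.norm_map]

/-- The map `f ↦ ∫ f(y) U(y) v dy`. -/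
def smearTranslate (v : H) : 𝓢(E4, ℂ) →L[ℂ] H :=
  mkCLMOfBound
    { toFun := fun f => ∫ y, f y • W.U y 1 v
      map_add' := fun f g => by
        rw [← integral_add (W.integrable_smul_translate f v) (W.integrable_smul_translate g v)]
        congr 1
        funext y
        rw [add_apply, add_smul]
      map_smul' := fun c f => by
        rw [RingHom.id_apply, ← integral_smul]
        congr 1
        funext y
        rw [smul_apply, smul_assoc] }
    -- The exponent 5 exceeds the dimension 4, which makes the weight integrable.
    5 0 (2 ^ 5 * ‖v‖ * ∫ y : E4, ((1 + ‖y‖) ^ 5)⁻¹)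
    (fun f => by
      have hi : Integrable fun y : E4 => ((1 + ‖y‖) ^ 5)⁻¹ :=
        integrable_inv_one_add_norm_pow (by rw [finrank_euclideanSpace_fin]; norm_num)
      refine (norm_integral_le_of_norm_le (hi.const_mul (2 ^ 5 * sn 5 0 f * ‖v‖))
        (Eventually.of_forall fun y => ?_)).trans (le_of_eq ?_)
      · rw [norm_smul, LinearIsometryEquiv.norm_map]
        calc _ ≤ 2 ^ 5 * sn 5 0 f * ((1 + ‖y‖) ^ 5)⁻¹ * ‖v‖ := by
              gcongr
              exact norm_le_sn_mul_inv f 5 y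
          _ = _ := by ring
      · rw [integral_const_mul]
        ring)

theorem smearTranslate_apply (v : H) (f : 𝓢(E4, ℂ)) :
    W.smearTranslate v f = ∫ y, f y • W.U y 1 v := rfl

theorem smearTranslate_trans (v : H) (z : E4) (f : 𝓢(E4, ℂ)) :
    W.smearTranslate v (trans z f) = W.U z 1 (W.smearTranslate v f) := by
  rw [smearTranslate_apply, smearTranslate_apply, ← integral_add_right_eq_self _ z]
  have := ((W.U z 1).toContinuousLinearEquiv.toContinuousLinearMap).integral_comp_comm
    (W.integrable_smul_translate f v)
  refine Eq.trans ?_ this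
  congr 1
  funext y
  rw [trans_apply, add_sub_cancel_right, add_comm, translate_add]
  exact (map_smul (W.U z 1) _ _).symm

theorem smearTranslate_eq_zero {f : 𝓢(E4, ℂ)}
    (hf : ∀ p ∈ forwardCone, ∫ y : E4, f y * Complex.exp (Complex.I * (mink p y : ℝ)) = 0) (v : H) :
    W.smearTranslate v f = 0 := by
  refine ext_inner_left ℂ fun ψ => ?_
  rw [inner_zero_right, ← W.spectrum_condition f hf ψ v, smearTranslate_apply,
    ← integral_inner (W.integrable_smul_translate f v)]
  simp only [inner_smul_right]

theorem integral_mul_exp_mink (f : 𝓢(E4, ℂ)) (p : E4) :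
    ∫ y : E4, f y * Complex.exp (Complex.I * (mink p y : ℝ)) =
      𝓕 f (WithLp.toLp 2 fun μ => -(eta μ * p μ) / (2 * Real.pi)) := by
  rw [SchwartzMap.fourier_coe, Real.fourier_eq']
  congr 1
  funext y
  rw [smul_eq_mul, mul_comm]
  congr 2
  have : mink p y = -2 * Real.pi *
      ⟪y, (WithLp.toLp 2 fun μ => -(eta μ * p μ) / (2 * Real.pi) : E4)⟫_ℝ := by
    rw [mink, PiLp.inner_apply, Finset.mul_sum]
    refine Finset.sum_congr rfl fun μ _ => ?_
    simp only [RCLike.inner_apply, conj_trivial]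
    field_simp [Real.pi_pos.ne']
  rw [this]
  push_cast
  ring

/-- The spectrum condition along a line in a direction of the forward light cone. -/
theorem integral_smul_translate_line {e : E4} (he : ∀ p ∈ forwardCone, 0 ≤ mink p e) {χ : 𝓢(ℝ, ℂ)}
    (hχ : ∀ ξ ≤ 0, 𝓕 χ ξ = 0) (v : H) : ∫ t, χ t • W.U (t • e) 1 v = 0 := by
  have hint : ∀ v, Integrable fun t : ℝ => χ t • W.U (t • e) 1 v := by
    intro v
    refine (χ.integrable.norm.mul_const ‖v‖).mono' ?_ (Eventually.of_forall fun y => ?_)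
    · exact (χ.continuous.smul ((W.continuous_translate v).comp
        (continuous_id.smul continuous_const))).aestronglyMeasurable
    · rw [norm_smul, LinearIsometryEquiv.norm_map]
  -- J = ∫ χ(t) U(t e) dt kills every vector ∫ f(y) U(y) v dy, because smearing f with χ along e
  -- makes its Fourier transform vanish on the spectrum. As f is arbitrary and y ↦ J U(y) v is
  -- continuous, J U(y) v = 0 for all y, in particular for y = 0.
  let J : H →L[ℂ] H := LinearMap.mkContinuous
    { toFun := fun v => ∫ t, χ t • W.U (t • e) 1 v
      map_add' := fun v w => by
        rw [← integral_add (hint v) (hint w)]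
        simp only [map_add, smul_add]
      map_smul' := fun c v => by
        rw [RingHom.id_apply, ← integral_smul]
        congr 1
        funext t
        rw [map_smul, smul_comm] }
    (∫ t, ‖χ t‖) (fun v => by
      rw [← integral_mul_const]
      refine norm_integral_le_of_norm_le (χ.integrable.norm.mul_const _)
        (Eventually.of_forall fun t => ?_)
      rw [norm_smul, LinearIsometryEquiv.norm_map])
  have hJ : ∀ f, J (W.smearTranslate v f) = 0 := by
    intro f
    have h1 : J (W.smearTranslate v f) = W.smearTranslate v (lineSmear e χ f) := by
      rw [clm_lineSmear]
      simp only [smearTranslate_trans]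
      rfl
    rw [h1]
    refine W.smearTranslate_eq_zero (fun p hp => ?_) v
    rw [integral_mul_exp_mink, fourier_lineSmear, hχ, zero_smul]
    have : ⟪e, (WithLp.toLp 2 fun μ => -(eta μ * p μ) / (2 * Real.pi) : E4)⟫_ℝ =
        -mink p e / (2 * Real.pi) := by
      rw [mink, PiLp.inner_apply, ← Finset.sum_neg_distrib, Finset.sum_div]
      refine Finset.sum_congr rfl fun μ _ => ?_
      simp only [RCLike.inner_apply, conj_trivial]
      ring
    rw [this]
    exact div_nonpos_of_nonpos_of_nonneg (neg_nonpos.2 (he p hp)) (by positivity)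
  have hcont : Continuous fun y => J (W.U y 1 v) := J.continuous.comp (W.continuous_translate v)
  have hae : ∀ᵐ y : E4, J (W.U y 1 v) = 0 := by
    refine ae_eq_zero_of_integral_contDiff_smul_eq_zero hcont.locallyIntegrable fun g hg hs => ?_
    have hs' : HasCompactSupport fun x => (g x : ℂ) :=
      hs.comp_left (g := fun t : ℝ => (t : ℂ)) (by simp)
    have h2 := hJ (hs'.toSchwartzMap (Complex.ofRealCLM.contDiff.comp hg))
    rw [smearTranslate_apply, ← J.integral_comp_comm (W.integrable_smul_translate _ v)] at h2
    rw [← h2]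
    congr 1
    funext y
    rw [map_smul]
    rfl
  have h0 : (fun y => J (W.U y 1 v)) = fun _ => 0 :=
    (hcont.ae_eq_iff_eq volume continuous_const).1 hae
  have := congrFun h0 0
  simp only [W.U_one] at this
  exact this

end WightmanTheory

/-! ### Translations, supports and the Moyal product -/

section Translations

theorem trans_trans {V F : Type*} [NormedAddCommGroup V] [NormedSpace ℝ V] [NormedAddCommGroup F]
    [NormedSpace ℂ F] (y z : V) (f : 𝓢(V, F)) : trans y (trans z f) = trans (y + z) f := by
  ext x
  simp [sub_sub]

theorem trans_zero {V F : Type*} [NormedAddCommGroup V] [NormedSpace ℝ V] [NormedAddCommGroup F]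
    [NormedSpace ℂ F] (f : 𝓢(V, F)) : trans 0 f = f := by
  ext x
  simp

/-- A common translation and the twist are both multiplications on the Fourier side, so they
commute. -/
theorem trans_moyal {K n : ℕ} (θ : Matrix (Fin 4) (Fin 4) ℝ) (y : E4) (f : Test K) (g : TestN K n) :
    trans (diag (n + 1) y) (moyal θ f g) = moyal θ (trans y f) (trans (diag n y) g) := by
  apply fourier_injective
  ext1 ξ
  rw [fourier_trans, fourier_moyal, fourier_moyal, ← trans_tensor, fourier_trans, smul_comm]

theorem tsupport_trans_subset {K : ℕ} {f : Test K} {x : E4} {r : ℝ}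
    (hf : tsupport f ⊆ Metric.closedBall x r) {y z : E4} {s : ℝ} (h : dist (x + z) y + r ≤ s) :
    tsupport (trans z f) ⊆ Metric.closedBall y s := by
  refine closure_minimal (fun w hw => ?_) Metric.isClosed_closedBall
  have h1 : w - z ∈ Metric.closedBall x r := hf (subset_tsupport _ hw)
  have h2 : dist w (x + z) ≤ r := by
    rw [Metric.mem_closedBall, dist_eq_norm] at h1
    rw [dist_eq_norm]
    convert h1 using 2
    abel
  exact (dist_triangle w (x + z) y).trans (by linarith)

theorem tsupport_inj_subset {V ι : Type*} [NormedAddCommGroup V] [NormedSpace ℝ V] [Fintype ι]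
    [DecidableEq ι] (i : ι) (f : 𝓢(V, ℂ)) : tsupport (inj i f) ⊆ tsupport f := by
  refine closure_mono fun x hx hx0 => hx ?_
  ext j
  rw [inj_apply, hx0]
  simp

end Translations

/-! ### Iterated Moyal products -/

section Iterates

variable {K : ℕ} (θ : Matrix (Fin 4) (Fin 4) ℝ)

/-- The constant test function `1` on the space of configurations without points. -/
def oneTest (K : ℕ) : TestN K 0 := (exists_schwartz_of_conf_zero K 1).choose

theorem oneTest_apply (x : Conf 0) (k : Fin 0 → Fin K) : oneTest K x k = 1 :=
  (exists_schwartz_of_conf_zero K 1).choose_spec x k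

/-- The iterated Moyal tensor products `f₁ ⊗_θ (f₂ ⊗_θ ⋯ (fₙ ⊗_θ g))`. -/
def moyalFold (fs : List (Test K)) (g : BU K) : BU K := fs.foldr (fun f g => moyalBU θ f g) g

/-- The sequence that belongs to `φ^θ(f₁) ⋯ φ^θ(fₙ) Ω`. -/
def moyalVec (fs : List (Test K)) : BU K := moyalFold θ fs (DFinsupp.single 0 (oneTest K))

theorem moyalFold_cons (f : Test K) (fs : List (Test K)) (g : BU K) :
    moyalFold θ (f :: fs) g = moyalBU θ f (moyalFold θ fs g) := rfl

theorem moyalVec_cons (f : Test K) (fs : List (Test K)) :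
    moyalVec θ (f :: fs) = moyalBU θ f (moyalVec θ fs) := rfl

theorem moyalVec_append (fs gs : List (Test K)) :
    moyalVec θ (fs ++ gs) = moyalFold θ fs (moyalVec θ gs) := List.foldr_append ..

/-- Prepending deformed fields is continuous on each degree, so matrix elements remain distributions
in the variables to the right. -/
theorem exists_moyalFold_single (fs : List (Test K)) (n : ℕ) :
    ∃ (m : ℕ) (T : TestN K n →L[ℂ] TestN K m), ∀ G,
      moyalFold θ fs (DFinsupp.single n G) = DFinsupp.single m (T G) := by
  induction fs with
  | nil => exact ⟨n, ContinuousLinearMap.id ℂ _, fun G => rfl⟩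
  | cons f fs ih =>
    obtain ⟨m, T, hT⟩ := ih
    refine ⟨m + 1, ⟨moyal θ f, continuous_moyal_right θ f⟩ ∘L T, fun G => ?_⟩
    rw [moyalFold_cons, hT, WightmanTheory.moyalBU_single]
    rfl

/-- G is independent of y: translating all factors amounts to a diagonal translation of one fixed
test function, to which the spectrum condition applies. -/
theorem exists_moyalVec_single (fs : List (Test K)) :
    ∃ (n : ℕ) (G : TestN K n), ∀ y : E4,
      moyalVec θ (fs.map (trans y)) = DFinsupp.single n (trans (diag n y) G) := by
  induction fs with
  | nil =>
    refine ⟨0, oneTest K, fun y => ?_⟩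
    have : trans (diag 0 y) (oneTest K) = oneTest K := by
      ext x k
      rw [trans_apply, oneTest_apply, oneTest_apply]
    rw [this]
    rfl
  | cons f fs ih =>
    obtain ⟨n, G, hG⟩ := ih
    refine ⟨n + 1, moyal θ f G, fun y => ?_⟩
    rw [List.map_cons, moyalVec_cons, hG, WightmanTheory.moyalBU_single, trans_moyal]

theorem map_trans_zero (fs : List (Test K)) : fs.map (trans (0 : E4)) = fs :=
  (List.map_congr_left fun f _ => trans_zero f).trans (List.map_id fs)

theorem map_trans_trans (y z : E4) (fs : List (Test K)) :
    (fs.map (trans z)).map (trans y) = fs.map (trans (y + z)) := by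
  rw [List.map_map]
  exact List.map_congr_left fun f _ => trans_trans y z f

/-- The operator that turns the tensor product into the Moyal tensor product. -/
def moyalOp (K n : ℕ) : TestN K (n + 1) →L[ℂ] TestN K (n + 1) :=
  FourierTransform.fourierInvCLM ℂ (TestN K (n + 1)) ∘L
    SchwartzMap.smulLeftCLM _ (moyalPhase θ) ∘L
    FourierTransform.fourierCLM ℂ (TestN K (n + 1))

theorem fourier_moyalOp {n : ℕ} (u : TestN K (n + 1)) (ξ : Conf (n + 1)) :
    𝓕 (moyalOp θ K n u) ξ = moyalPhase θ ξ • 𝓕 u ξ := by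
  have h : 𝓕 (moyalOp θ K n u) = SchwartzMap.smulLeftCLM _ (moyalPhase θ) (𝓕 u) :=
    FourierTransform.fourier_fourierInv_eq _
  rw [h, SchwartzMap.smulLeftCLM_apply_apply (moyalPhase_hasTemperateGrowth θ)]

/-- The exponent of the twist is linear in θ. Since the twist is invertible, twisted products are as
total as ordinary ones. -/
theorem moyalOp_moyalOp_neg {n : ℕ} (u : TestN K (n + 1)) :
    moyalOp θ K n (moyalOp (-θ) K n u) = u := by
  apply fourier_injective
  ext1 ξ
  have : moyalArg (-θ) ξ = -moyalArg θ ξ := by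
    simp [moyalArg, thetaForm]
  rw [fourier_moyalOp, fourier_moyalOp, smul_smul, moyalPhase_eq, moyalPhase_eq, ← Complex.exp_add,
    this]
  simp

/-- The iterated Moyal tensor products span a dense subspace. -/
theorem clm_eq_zero_of_moyalVec {n : ℕ} (T : TestN K n →L[ℂ] ℂ)
    (hT : ∀ fs G, moyalVec θ fs = DFinsupp.single n G → T G = 0) : T = 0 := by
  induction n with
  | zero =>
    ext F
    rw [testN_zero_eq F (oneTest K) oneTest_apply, map_smul, hT [] (oneTest K) rfl]
    simp
  | succ n ih =>
    have h1 : T ∘L moyalOp θ K n = 0 := by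
      refine clm_ext_tensor fun f g => ?_
      have := ih (T ∘L ⟨moyal θ f, continuous_moyal_right θ f⟩) fun fs G hG => by
        refine hT (f :: fs) (moyal θ f G) ?_
        rw [moyalVec_cons, hG, WightmanTheory.moyalBU_single]
      exact DFunLike.congr_fun this g
    ext F
    rw [← moyalOp_moyalOp_neg θ F]
    exact DFunLike.congr_fun h1 _

end Iterates

/-! ### Directions in the forward light cone -/

section Directions

theorem mink_single_zero (p : E4) (t : ℝ) : mink p (EuclideanSpace.single 0 t) = p 0 * t := by
  simp [mink, eta]

theorem mink_add_right (p x y : E4) : mink p (x + y) = mink p x + mink p y := by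
  simp [mink, mul_add, Finset.sum_add_distrib]

/-- A basis of `ℝ⁴` in the forward light cone. -/
def coneDir : Fin 4 → E4 :=
  Fin.cons (EuclideanSpace.single 0 1) fun i => EuclideanSpace.single 0 1 + EuclideanSpace.single i.succ 1

/-- For p in the cone every spatial component is at most p₀, so the products p₀ and p₀ - p_j are
nonnegative. -/
theorem mink_coneDir_nonneg (i : Fin 4) {p : E4} (hp : p ∈ forwardCone) :
    0 ≤ mink p (coneDir i) := by
  obtain ⟨h1, h2⟩ := hp
  have h3 : 0 ≤ p 0 * p 0 - p 1 * p 1 - p 2 * p 2 - p 3 * p 3 := by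
    simpa [mink, Fin.sum_univ_four, eta, sub_eq_add_neg] using h1
  have h4 : ∀ j, j ≠ 0 → p j ≤ p 0 := by
    intro j hj
    refine abs_le_of_sq_le_sq' ?_ h2 |>.2
    fin_cases j
    · exact absurd rfl hj
    all_goals
      simp
      nlinarith [mul_self_nonneg (p 1), mul_self_nonneg (p 2), mul_self_nonneg (p 3)]
  induction i using Fin.cases with
  | zero =>
    simp only [coneDir, Fin.cons_zero, mink_single_zero]
    linarith
  | succ i =>
    have hs : mink p (coneDir i.succ) = mink p (EuclideanSpace.single 0 1) +
        mink p (EuclideanSpace.single i.succ 1) := mink_add_right _ _ _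
    have : mink p (EuclideanSpace.single i.succ 1) = -p i.succ := by
      rw [mink, Finset.sum_eq_single i.succ]
      · simp [eta, Fin.succ_ne_zero]
      · intro j _ hj
        simp [hj]
      · simp
    rw [hs, this, mink_single_zero]
    linarith [h4 i.succ (Fin.succ_ne_zero i)]

theorem eq_sum_coneDir (z : E4) : z = ((z 0 - z 1 - z 2 - z 3) • coneDir 0 + z 1 • coneDir 1 +
    z 2 • coneDir 2) + z 3 • coneDir 3 := by
  have h1 : coneDir 1 = EuclideanSpace.single 0 1 + EuclideanSpace.single 1 1 := rfl
  have h2 : coneDir 2 = EuclideanSpace.single 0 1 + EuclideanSpace.single 2 1 := rfl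
  have h3 : coneDir 3 = EuclideanSpace.single 0 1 + EuclideanSpace.single 3 1 := rfl
  have h0 : coneDir 0 = EuclideanSpace.single 0 1 := rfl
  rw [h0, h1, h2, h3]
  ext j
  fin_cases j
  · simp
    ring
  all_goals simp

end Directions

/-! ### The Reeh–Schlieder property -/

namespace WightmanTheory

variable {K : ℕ} {H : Type*} [NormedAddCommGroup H] [InnerProductSpace ℂ H]
  (W : WightmanTheory K H) [CompleteSpace H] {θ : Matrix (Fin 4) (Fin 4) ℝ}

/-- Analytic continuation along a line: a functional that factors through `Ψⁿ` and vanishes on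
small translates of a test function along a line in the forward light cone vanishes on all
translates along this line. -/
theorem eq_zero_of_translate_line {n : ℕ} {Λ : TestN K n →L[ℂ] ℂ}
    (hΛ : ∀ G, W.PsiN n G = 0 → Λ G = 0) {e : E4} (he : ∀ p ∈ forwardCone, 0 ≤ mink p e)
    {G : TestN K n} {δ : ℝ} (hδ : 0 < δ)
    (h0 : ∀ t : ℝ, |t| < δ → Λ (trans (t • diag n e) G) = 0) (t : ℝ) :
    Λ (trans (t • diag n e) G) = 0 := by
  obtain ⟨k, m, C, hC, hb⟩ := exists_sn_bound_clm Λ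
  obtain ⟨N, k', m', C', hC', hb'⟩ := trans_bound (V := Conf n) (F := (Fin n → Fin K) → ℂ) k m
  have hS : 0 ≤ sn k' m' G := apply_nonneg _ _
  refine eq_zero_of_oneSided (g := fun t => Λ (trans (t • diag n e) G))
    (Λ.continuous.comp (continuous_trans_line _ G))
    (C := C * (C' * (1 + ‖diag n e‖) ^ N * sn k' m' G)) (N := N) (fun t => ?_) hδ h0
    (fun χ hχ => ?_) t
  · calc _ ≤ C * (C' * ((1 + ‖diag n e‖) ^ N * (1 + ‖t‖) ^ N) * sn k' m' G) := by
          refine (hb _).trans ?_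
          gcongr
          refine (hb' _ _).trans ?_
          gcongr
          exact one_add_norm_smul_pow_le _ t N
      _ = _ := by ring
  -- By the spectrum condition the smearing with χ annihilates Ψⁿ(G); as Λ factors through Ψⁿ, the
  -- function of t has a one-sided Fourier transform.
  · have h1 : W.PsiN n (lineSmear (diag n e) χ G) = 0 := by
      rw [clm_lineSmear, ← W.integral_smul_translate_line he hχ (W.PsiN n G)]
      simp only [W.translate_psiN, map_smul]
    have h2 := hΛ _ h1
    rw [clm_lineSmear] at h2
    exact h2

theorem eq_zero_of_translate {n : ℕ} {Λ : TestN K n →L[ℂ] ℂ}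
    (hΛ : ∀ G, W.PsiN n G = 0 → Λ G = 0) {G : TestN K n}
    (h0 : ∀ᶠ z in 𝓝 (0 : E4), Λ (trans (diag n z) G) = 0) (z : E4) :
    Λ (trans (diag n z) G) = 0 := by
  -- S contains 0 and is stable under moving any distance along each cone direction; these
  -- directions span ℝ⁴, so S is everything. Vanishing on a neighbourhood is what lets the line
  -- argument restart at each new point.
  let S : Set E4 := {z | ∀ᶠ w in 𝓝 z, Λ (trans (diag n w) G) = 0}
  have hstep : ∀ (i : Fin 4) (t : ℝ), ∀ z ∈ S, z + t • coneDir i ∈ S := by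
    intro i t z hz
    have h1 : ∀ᶠ w in 𝓝 z, Λ (trans (diag n (w + t • coneDir i)) G) = 0 := by
      filter_upwards [eventually_eventually_nhds.2 hz] with w hw
      have hc : Tendsto (fun s : ℝ => w + s • coneDir i) (𝓝 0) (𝓝 w) := by
        have : Continuous fun s : ℝ => w + s • coneDir i :=
          continuous_const.add (continuous_id.smul continuous_const)
        simpa using this.tendsto 0
      obtain ⟨δ, hδ, hball⟩ := Metric.eventually_nhds_iff.1 (hc.eventually hw)
      have e1 : ∀ s : ℝ, trans (diag n (w + s • coneDir i)) G =
          trans (s • diag n (coneDir i)) (trans (diag n w) G) := by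
        intro s
        rw [trans_trans, map_add, map_smul, add_comm]
      rw [e1]
      refine W.eq_zero_of_translate_line hΛ (fun p hp => mink_coneDir_nonneg i hp) hδ
        (fun s hs => ?_) t
      rw [← e1]
      exact hball (by simpa using hs)
    have h2 : Tendsto (fun w => w - t • coneDir i) (𝓝 (z + t • coneDir i)) (𝓝 z) := by
      have : Continuous fun w : E4 => w - t • coneDir i := continuous_id.sub continuous_const
      simpa using this.tendsto (z + t • coneDir i)
    have h3 := h2.eventually h1
    simp only [sub_add_cancel] at h3
    exact h3
  have hz : z ∈ S := by
    have h4 := hstep 3 (z 3) _ (hstep 2 (z 2) _ (hstep 1 (z 1) _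
      (hstep 0 (z 0 - z 1 - z 2 - z 3) 0 h0)))
    rw [zero_add, ← eq_sum_coneDir] at h4
    exact h4
  exact hz.self_of_nhds

theorem psi_moyalFold_eq_zero (hθ : θ.transpose = -θ) (fs : List (Test K)) {g : BU K}
    (hg : W.Psi g = 0) : W.Psi (moyalFold θ fs g) = 0 := by
  induction fs with
  | nil => exact hg
  | cons f fs ih => exact W.psi_moyalBU_eq_zero hθ f ih

/-- If a vector is orthogonal to `φ^θ(f₁) ⋯ φ^θ(fₘ) U(z) φ^θ(g₁) ⋯ φ^θ(gₙ) Ω` for small `z`, then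
also for all `z`. -/
theorem inner_moyalVec_translate (hθ : θ.transpose = -θ) {ψ : H} {pre post : List (Test K)}
    (h0 : ∀ᶠ z in 𝓝 (0 : E4), ⟪ψ, W.Psi (moyalVec θ (pre ++ post.map (trans z)))⟫_ℂ = 0) (z : E4) :
    ⟪ψ, W.Psi (moyalVec θ (pre ++ post.map (trans z)))⟫_ℂ = 0 := by
  obtain ⟨n, G, hG⟩ := exists_moyalVec_single θ post
  obtain ⟨m, T, hT⟩ := exists_moyalFold_single θ pre n
  let Λ : TestN K n →L[ℂ] ℂ := innerSL ℂ ψ ∘L W.PsiN m ∘L T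
  have hΛ : ∀ z, Λ (trans (diag n z) G) =
      ⟪ψ, W.Psi (moyalVec θ (pre ++ post.map (trans z)))⟫_ℂ := by
    intro z
    rw [moyalVec_append, hG, hT, psi_single]
    rfl
  -- Well-definedness of the deformed fields makes the matrix element depend on G only through
  -- Ψⁿ(G).
  have hker : ∀ G, W.PsiN n G = 0 → Λ G = 0 := by
    intro G hG
    have h1 := W.psi_moyalFold_eq_zero hθ pre (g := DFinsupp.single n G) (by rw [psi_single, hG])
    rw [hT, psi_single] at h1
    change ⟪ψ, W.PsiN m (T G)⟫_ℂ = 0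
    rw [h1, inner_zero_right]
  rw [← hΛ]
  refine W.eq_zero_of_translate hker ?_ z
  simpa only [hΛ] using h0

theorem isDeformedVector_moyalVec (hθ : θ.transpose = -θ) {O : Set E4} {fs : List (Test K)}
    (hfs : ∀ f ∈ fs, tsupport f ⊆ O) : W.IsDeformedVector θ O (W.Psi (moyalVec θ fs)) := by
  induction fs with
  | nil =>
    have : W.Psi (moyalVec θ []) = W.vacuum := by
      change W.Psi (DFinsupp.single 0 (oneTest K)) = _
      rw [psi_single, psiN_zero_one]
      exact oneTest_apply
    rw [this]
    exact .vacuum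
  | cons f fs ih =>
    have h1 := IsDeformedVector.field f (hfs f (by simp))
      ⟨W.Psi (moyalVec θ fs), W.psi_mem_domain (θ := θ) f (moyalVec θ fs)⟩
      (ih fun g hg => hfs g (by simp [hg]))
    rwa [W.deformedField_psi hθ, ← moyalVec_cons] at h1

theorem exists_clm_moyalVec_middle (pre post : List (Test K)) :
    ∃ T : Test K →L[ℂ] H, ∀ f, T f = W.Psi (moyalVec θ (pre ++ f :: post)) := by
  obtain ⟨n, G, hG⟩ := exists_moyalVec_single θ post
  obtain ⟨m, T, hT⟩ := exists_moyalFold_single θ pre (n + 1)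
  have h1 : moyalVec θ post = DFinsupp.single n G := by
    have := hG 0
    rwa [map_trans_zero, map_zero, trans_zero] at this
  refine ⟨W.PsiN m ∘L T ∘L ⟨(moyalLM θ K n).flip G, continuous_moyal_left θ G⟩, fun f => ?_⟩
  rw [moyalVec_append, moyalVec_cons, h1, moyalBU_single, hT, psi_single]
  rfl

/-- Induction on the number k of unrestricted factors; the others share one small ball with
arbitrary centre. The radius is halved in each step, to leave room for the small translations from
which the continuation in z starts. -/
theorem inner_moyalVec_eq_zero (hθ : θ.transpose = -θ) {O : Set E4} (hO : IsOpen O)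
    (hne : O.Nonempty) {ψ : H} (hψ : ∀ v, W.IsDeformedVector θ O v → ⟪ψ, v⟫_ℂ = 0) (k : ℕ) :
    ∃ r > 0, ∀ (y : E4) (pre post : List (Test K)), pre.length = k →
      (∀ f ∈ post, tsupport f ⊆ Metric.closedBall y r) →
      ⟪ψ, W.Psi (moyalVec θ (pre ++ post))⟫_ℂ = 0 := by
  have hshift : ∀ {r : ℝ} {x y : E4} {post : List (Test K)},
      (∀ f ∈ post, tsupport f ⊆ Metric.closedBall y r) →
      ∀ f ∈ post.map (trans (x - y)), tsupport f ⊆ Metric.closedBall x r := by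
    intro r x y post h f hf
    obtain ⟨g, hg, rfl⟩ := List.mem_map.1 hf
    exact tsupport_trans_subset (h g hg) (by simp)
  have hnear : ∀ {r : ℝ} {x z : E4} {post : List (Test K)},
      (∀ f ∈ post, tsupport f ⊆ Metric.closedBall x (r / 2)) → dist z 0 < r / 2 →
      ∀ f ∈ post.map (trans z), tsupport f ⊆ Metric.closedBall x r := by
    intro r x z post h hz f hf
    obtain ⟨g, hg, rfl⟩ := List.mem_map.1 hf
    refine tsupport_trans_subset (h g hg) ?_
    rw [dist_eq_norm, add_sub_cancel_left]
    rw [dist_zero_right] at hz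
    linarith
  have hback : ∀ (x y : E4) (post : List (Test K)),
      (post.map (trans (x - y))).map (trans (y - x)) = post := by
    intro x y post
    rw [map_trans_trans, sub_add_sub_cancel, sub_self, map_trans_zero]
  induction k with
  | zero =>
    obtain ⟨x₀, hx₀⟩ := hne
    obtain ⟨r, hr, hball⟩ := Metric.nhds_basis_closedBall.mem_iff.1 (hO.mem_nhds hx₀)
    refine ⟨r / 2, by positivity, fun y pre post hpre hpost => ?_⟩
    rw [List.length_eq_zero_iff.1 hpre, ← hback x₀ y post]
    -- Moved to x₀ and shifted slightly, the factors stay in O; continuation in z carries them back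
    -- to y.
    refine W.inner_moyalVec_translate hθ (Metric.eventually_nhds_iff.2
      ⟨r / 2, by positivity, fun z hz => ?_⟩) _
    exact hψ _ (W.isDeformedVector_moyalVec hθ fun f hf =>
      (hnear (hshift hpost) hz f hf).trans hball)
  | succ k ih =>
    obtain ⟨r, hr, hk⟩ := ih
    refine ⟨r / 2, by positivity, fun y pre' post hpre hpost => ?_⟩
    obtain rfl | ⟨pre, f, rfl⟩ := List.eq_nil_or_concat pre'
    · simp at hpre
    have hlen : pre.length = k := by simpa using hpre
    obtain ⟨T, hT⟩ := W.exists_clm_moyalVec_middle (θ := θ) pre post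
    -- By linearity and continuity the last unrestricted factor may be taken in a small ball around
    -- some x. Once the factors of `post` are moved to that ball, the inductive hypothesis applies;
    -- continuation in z returns them to y while this factor stays fixed.
    have hzero : innerSL ℂ ψ ∘L T = 0 := by
      refine clm_ext_inj fun i => ?_
      have h1 : (innerSL ℂ ψ ∘L T) ∘L inj i = 0 := by
        refine clm_eq_zero_of_local _ (half_pos hr) fun x u hu => ?_
        change ⟪ψ, T (inj i u)⟫_ℂ = 0
        have hu' : tsupport (inj i u) ⊆ Metric.closedBall x (r / 2) :=
          (tsupport_inj_subset i u).trans hu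
        rw [hT, ← hback x y post, List.append_cons]
        refine W.inner_moyalVec_translate hθ (Metric.eventually_nhds_iff.2
          ⟨r / 2, by positivity, fun z hz => ?_⟩) _
        rw [← List.append_cons]
        refine hk x pre _ hlen fun g hg => ?_
        rcases List.mem_cons.1 hg with rfl | hg
        · exact hu'.trans (Metric.closedBall_subset_closedBall (by linarith))
        · exact hnear (hshift hpost) hz g hg
      exact fun u => DFunLike.congr_fun h1 u
    rw [List.concat_eq_append, ← List.append_cons, ← hT]
    exact DFunLike.congr_fun hzero f

/-- The Reeh-Schlieder property. -/
theorem dense_localDomain (hθ : θ.transpose = -θ) {O : Set E4} (hO : IsOpen O)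
    (hne : O.Nonempty) : Dense (W.localDomain θ O : Set H) := by
  rw [Submodule.dense_iff_topologicalClosure_eq_top, Submodule.topologicalClosure_eq_top_iff,
    Submodule.eq_bot_iff]
  intro ψ hψ
  have h1 : ∀ v, W.IsDeformedVector θ O v → ⟪ψ, v⟫_ℂ = 0 := fun v hv =>
    (Submodule.mem_orthogonal' _ _).1 hψ v (Submodule.subset_span hv)
  have h2 : ∀ fs : List (Test K), ⟪ψ, W.Psi (moyalVec θ fs)⟫_ℂ = 0 := by
    intro fs
    obtain ⟨r, -, hr⟩ := W.inner_moyalVec_eq_zero hθ hO hne h1 fs.length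
    -- With `post` empty all factors are unrestricted and the centre of the ball is irrelevant.
    have := hr 0 fs [] rfl (by simp)
    rwa [List.append_nil] at this
  have h3 : ∀ n F, ⟪ψ, W.PsiN n F⟫_ℂ = 0 := by
    intro n F
    have := clm_eq_zero_of_moyalVec θ (innerSL ℂ ψ ∘L W.PsiN n) fun fs G hG => by
      change ⟪ψ, W.PsiN n G⟫_ℂ = 0
      rw [← psi_single, ← hG, h2]
    exact DFunLike.congr_fun this F
  refine W.dense_DD.eq_zero_of_inner_left (𝕜 := ℂ) fun v hv => ?_
  induction hv using Submodule.span_induction with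
  | mem v hv =>
    obtain ⟨n, F, rfl⟩ := hv
    exact h3 n F
  | zero => exact inner_zero_right _
  | add v w _ _ hv hw => rw [inner_add_right, hv, hw, add_zero]
  | smul c v _ hv => rw [inner_smul_right, hv, mul_zero]

end WightmanTheory

end

end DeformedWightman

theorem mainTheorem3 {K : ℕ} {H : Type*} [NormedAddCommGroup H] [InnerProductSpace ℂ H]
    [CompleteSpace H] [TopologicalSpace.SeparableSpace H]
    (W : DeformedWightman.WightmanTheory K H) (θ : Matrix (Fin 4) (Fin 4) ℝ)
    (hθ : θ.transpose = -θ) :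
    -- the vector-valued distributions `Ψⁿ` are well defined
    (∀ n, W.IsVectorDistribution n (W.PsiN n) ∧
      ∀ T, W.IsVectorDistribution n T → T = W.PsiN n) ∧
    -- a) the dense space `𝒟` is contained in the domain of `φ^θ(f)`,
    -- which is well defined by `φ^θ(f) Ψ(g) = Ψ(f ⊗_θ g)`
    (Dense (W.DD : Set H) ∧ ∀ f : DeformedWightman.Test K, W.DD ≤ (W.deformedField θ f).domain ∧
      ∀ (g : DeformedWightman.BU K) (hg : W.Psi g ∈ (W.deformedField θ f).domain),
        W.deformedField θ f ⟨W.Psi g, hg⟩ = W.Psi (DeformedWightman.moyalBU θ f g)) ∧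
    -- b) matrix elements are tempered distributions
    (∀ ψ ∈ W.DD, ∀ ψ' ∈ W.DD, ∃ T : DeformedWightman.Test K →L[ℂ] ℂ,
      ∀ (f : DeformedWightman.Test K) (hψ' : ψ' ∈ (W.deformedField θ f).domain),
        T f = inner ℂ ψ (W.deformedField θ f ⟨ψ', hψ'⟩)) ∧
    -- c) adjoints
    (∀ f : DeformedWightman.Test K,
      W.deformedField θ (DeformedWightman.starTest W.bar f) ≤
      (W.deformedField θ f).adjoint) ∧
    -- d) Reeh-Schlieder property
    (∀ O : Set DeformedWightman.E4, IsOpen O → O.Nonempty → Dense (W.localDomain θ O : Set H)) := by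
  refine ⟨fun n => ⟨W.isVectorDistribution_psiN n, fun T hT => W.eq_psiN hT⟩,
    ⟨W.dense_DD, fun f => ⟨W.DD_le_domain f, W.deformedField_psi hθ f⟩⟩,
    fun ψ _ ψ' hψ' => W.exists_clm_inner_deformedField hθ ψ hψ',
    W.deformedField_star_le_adjoint hθ, fun O hO hne => W.dense_localDomain hθ hO hne⟩
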